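/- For $\lambda\in\mathbb R$ let $M_\lambda$ denote the Aharonov–Bohm operator on $L^2(\mathbb R^2)$, that is, the closure of $$\Big(-i\partial_x-\frac{\lambda y}{x^2+y^2}\Big)^2+\Big(-i\partial_y+\frac{\lambda x}{x^2+y^2}\Big)^2$$ defined on $C_c^\infty(\mathbb R^2\setminus\{0\})$; it is a positive hermitian operator. With the unitary dilations $(U_\tau f)(x)=e^{\tau}f(e^{\tau}x)$, an operator $T$ is called homogeneous (of degree $-2$) if $U_\tau TU_\tau^{-1}=e^{-2\tau}T$ for all $\tau\in\mathbb R$. It is called rotation symmetric if $R_\theta TR_\theta^{-1}=T$ for all $\theta\in\mathbb R$, where, in polar coordinates, $(R_\theta f)(r,\phi)=f(r,\phi+\theta)$. For $l\in\mathbb Z$ let $\mathcal H_l=\{f: R_\theta f=e^{il\theta}f \text{ for all }\theta\}$ be the eigenspace of the angular momentum $-i\partial_\phi$ for the eigenvalue $l$, and by the part of $T$ in $\mathcal H_l$ we mean the restriction of $T$ to $\{f\in\mathcal D(T)\cap\mathcal H_l : Tf\in\mathcal H_l\}$, regarded as an operator on $\mathcal H_l$. The Friedrichs extension $F$ and the Krein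 extension $K$ of a positive hermitian operator $S$ are the positive self-adjoint extensions of $S$ such that $K\le H\le F$, in the sense of quadratic forms, for every positive self-adjoint extension $H$ of $S$. Let $M_\lambda^{FF}$ and $M_\lambda^{KK}$ be the Friedrichs and the Krein extension of $M_\lambda$. (i) If $\lambda\in\mathbb Z$, then $M_\lambda$ has deficiency indices $(1,1)$. We have $M_\lambda^{FF}=M_\lambda^{KK}$; this operator is homogeneous, it is the only homogeneous self-adjoint extension of $M_\lambda$, and moreover it is the only homogeneous operator $H$ with $M_\lambda\subsetneq H\subsetneq M_\lambda^*$. (ii) If $\lambda\notin\mathbb Z$, then $M_\lambda$ has deficiency indices $(2,2)$, and it has exactly four homogeneous and rotation symmetric self-adjoint extensions. They are pairwise distinct operators $M_\lambda^{FF}$, $M_\lambda^{KK}$, $M_\lambda^{FK}$, $M_\lambda^{KF}$, where, with $n=\lfloor\lambda\rfloor$, the part of $M_\lambda^{FK}$ in $\mathcal H_{-n-1}$ is the Friedrichs extension of the part of $M_\lambda$ in $\mathcal H_{-n-1}$ and the part of $M_\lambda^{FK}$ in $\mathcal H_{-n}$ is the Krein extension of the part of $M_\lambda$ in $\mathcal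 H_{-n}$, while for $M_\lambda^{KF}$ the roles of Friedrichs and Krein are interchanged. -/

import Mathlib

open MeasureTheory Filter Topology
open scoped ContDiff InnerProductSpace

noncomputable section

namespace AharonovBohm

/-! ### Unbounded operators on a Hilbert space -/

section Abstract

variable {E : Type*} [NormedAddCommGroup E] [InnerProductSpace ℂ E] [CompleteSpace E]

/-- The deficiency space `ker (S† - z)`. -/
def deficiencySpace (S : E →ₗ.[ℂ] E) (z : ℂ) : Submodule ℂ E :=
  (LinearMap.ker (S.adjoint.toFun - z • S.adjoint.domain.subtype)).map S.adjoint.domain.subtype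

/-- `S` is a densely defined hermitian operator with deficiency indices `(p, q)`, that is
`dim ker (S† - i) = p` and `dim ker (S† + i) = q`. -/
structure HasDeficiencyIndices (S : E →ₗ.[ℂ] E) (p q : ℕ) : Prop where
  dense : Dense (S.domain : Set E)
  hermitian : S.IsFormalAdjoint S
  rank_pos : Module.rank ℂ (deficiencySpace S Complex.I) = p
  rank_neg : Module.rank ℂ (deficiencySpace S (-Complex.I)) = q

/-- The real number `⟨f, T f⟩` for `f` in the domain of a hermitian operator `T`. -/
def quadForm (T : E →ₗ.[ℂ] E) (f : T.domain) : ℝ := (⟪(f : E), T f⟫_ℂ).re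

/-- `H` is a self-adjoint extension of `S`. -/
def IsSelfAdjointExtension (S H : E →ₗ.[ℂ] E) : Prop :=
  S ≤ H ∧ IsSelfAdjoint H

/-- `H` is a positive self-adjoint extension of `S`. -/
def IsPositiveSelfAdjointExtension (S H : E →ₗ.[ℂ] E) : Prop :=
  IsSelfAdjointExtension S H ∧ ∀ f : H.domain, 0 ≤ quadForm H f

/-- `f` belongs to the form domain of the positive operator `T` and `a` is the value at `f` of
the closed quadratic form of `T`, the closure of `f ↦ ⟨f, T f⟩`. -/
def IsFormValue (T : E →ₗ.[ℂ] E) (f : E) (a : ℝ) : Prop :=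
  ∃ u : ℕ → T.domain,
    Tendsto (fun n => (u n : E)) atTop (𝓝 f) ∧
    Tendsto (fun p : ℕ × ℕ => quadForm T (u p.1 - u p.2)) atTop (𝓝 0) ∧
    Tendsto (fun n => quadForm T (u n)) atTop (𝓝 a)

/-- `A ≤ B` in the sense of quadratic forms, for positive self-adjoint operators: the form domain
of `B` is contained in that of `A`, and there the form of `A` is at most that of `B`. -/
def FormLE (A B : E →ₗ.[ℂ] E) : Prop :=
  ∀ (f : E) (b : ℝ), IsFormValue B f b → ∃ a : ℝ, IsFormValue A f a ∧ a ≤ b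

/-- `F` is the Friedrichs extension of `S`: the largest positive self-adjoint extension. -/
def IsFriedrichsExtension (S F : E →ₗ.[ℂ] E) : Prop :=
  IsPositiveSelfAdjointExtension S F ∧
    ∀ H : E →ₗ.[ℂ] E, IsPositiveSelfAdjointExtension S H → FormLE H F

/-- `K` is the Krein extension of `S`: the smallest positive self-adjoint extension. -/
def IsKreinExtension (S K : E →ₗ.[ℂ] E) : Prop :=
  IsPositiveSelfAdjointExtension S K ∧
    ∀ H : E →ₗ.[ℂ] E, IsPositiveSelfAdjointExtension S H → FormLE K H

end Abstract

/-! ### The Hilbert space `L²(ℝ²)`, dilations and rotations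

The plane `ℝ²` is identified with `ℂ` through `(x, y) ↦ x + i y`; the volume on `ℂ` is Lebesgue
measure. -/

/-- The Hilbert space `L²(ℝ²)`. -/
abbrev L2 : Type := Lp ℂ 2 (volume : Measure ℂ)

theorem memLp_dilation (τ : ℝ) (f : L2) :
    MemLp (fun z : ℂ => (Real.exp τ : ℂ) * f ((Real.exp τ : ℂ) * z)) 2 volume := by
  have hmap : Measure.map (fun z : ℂ => Real.exp τ • z) (volume : Measure ℂ) =
      ENNReal.ofReal |(Real.exp τ ^ Module.finrank ℝ ℂ)⁻¹| • volume :=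
    Measure.map_addHaar_smul volume (Real.exp_pos τ).ne'
  have h : MemLp (f ∘ fun z : ℂ => Real.exp τ • z) 2 volume := by
    refine MemLp.comp_of_map ?_ (measurable_const_smul (Real.exp τ)).aemeasurable
    rw [hmap]
    exact (Lp.memLp f).smul_measure ENNReal.ofReal_ne_top
  have h2 := h.const_mul (Real.exp τ : ℂ)
  simpa [Function.comp_def] using h2

/-- The unitary dilation `(U_τ f)(x) = e^τ f(e^τ x)` on `L²(ℝ²)`. -/
def dilation (τ : ℝ) (f : L2) : L2 := (memLp_dilation τ f).toLp _

/-- The rotation `(R_θ f)(z) = f(e^{iθ} z)`; in polar coordinates `f(r, φ) ↦ f(r, φ + θ)`, so that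
`R_θ = exp(i θ L)` with the angular momentum `L = -i ∂_φ`. -/
def rotate (θ : ℝ) : L2 →ₗᵢ[ℂ] L2 :=
  Lp.compMeasurePreservingₗᵢ ℂ (rotation (Circle.exp θ)) (rotation (Circle.exp θ)).measurePreserving

/-- `T` is homogeneous of degree `ν`, that is `U_τ T U_τ⁻¹ = e^{ν τ} T` for all real `τ`. -/
def IsHomogeneous (ν : ℝ) (T : L2 →ₗ.[ℂ] L2) : Prop :=
  ∀ (τ : ℝ) (f : T.domain), ∃ h : dilation τ f ∈ T.domain,
    dilation τ (T f) = (Real.exp (ν * τ) : ℂ) • T ⟨dilation τ f, h⟩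

/-- `T` is rotation symmetric, that is `R_θ T R_θ⁻¹ = T` for all real `θ`. -/
def IsRotationSymmetric (T : L2 →ₗ.[ℂ] L2) : Prop :=
  ∀ (θ : ℝ) (f : T.domain), ∃ h : rotate θ f ∈ T.domain,
    rotate θ (T f) = T ⟨rotate θ f, h⟩

/-- The spectral subspace `𝓗_l` of the angular momentum for the eigenvalue `l`. -/
def sector (l : ℤ) : Submodule ℂ L2 :=
  ⨅ θ : ℝ, LinearMap.ker
    ((rotate θ).toLinearMap - Complex.exp (Complex.I * l * θ) • LinearMap.id)

theorem isClosed_sector (l : ℤ) : IsClosed (sector l : Set L2) := by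
  unfold sector
  rw [Submodule.coe_iInf]
  refine isClosed_iInter fun θ => ?_
  have h : Continuous fun f : L2 =>
      rotate θ f - Complex.exp (Complex.I * l * θ) • f :=
    (rotate θ).continuous.sub (continuous_const_smul _)
  exact isClosed_singleton.preimage h

instance (l : ℤ) : CompleteSpace (sector l) := (isClosed_sector l).completeSpace_coe

/-- The part of `T` in `𝓗_l`: the restriction of `T` to those `f ∈ D(T) ∩ 𝓗_l` with `T f ∈ 𝓗_l`
(the last condition is automatic if `T` is rotation symmetric). -/
def sectorPart (T : L2 →ₗ.[ℂ] L2) (l : ℤ) : sector l →ₗ.[ℂ] sector l where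
  domain :=
    { carrier := {f | ∃ h : (f : L2) ∈ T.domain, T ⟨f, h⟩ ∈ sector l}
      add_mem' := by
        rintro a b ⟨ha, ha'⟩ ⟨hb, hb'⟩
        refine ⟨T.domain.add_mem ha hb, ?_⟩
        have := T.map_add ⟨a, ha⟩ ⟨b, hb⟩
        exact this ▸ (sector l).add_mem ha' hb'
      zero_mem' := by
        refine ⟨T.domain.zero_mem, ?_⟩
        have := T.map_zero
        exact this ▸ (sector l).zero_mem
      smul_mem' := by
        rintro c a ⟨ha, ha'⟩
        refine ⟨T.domain.smul_mem c ha, ?_⟩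
        have := T.map_smul c ⟨a, ha⟩
        exact this ▸ (sector l).smul_mem c ha' }
  toFun :=
    { toFun := fun f => ⟨T ⟨(f : sector l), f.2.1⟩, f.2.2⟩
      map_add' := by
        intro a b
        exact Subtype.ext (T.map_add ⟨(a : sector l), a.2.1⟩ ⟨(b : sector l), b.2.1⟩)
      map_smul' := by
        intro c a
        exact Subtype.ext (T.map_smul c ⟨(a : sector l), a.2.1⟩) }

/-! ### The Aharonov–Bohm operator -/

/-- The space `C_c^∞(ℝ² \ {0})` of test functions. -/
def testFunctions : Submodule ℂ (ℂ → ℂ) where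
  carrier := {f | ContDiff ℝ ∞ f ∧ HasCompactSupport f ∧ (0 : ℂ) ∉ tsupport f}
  add_mem' := by
    rintro f g ⟨hf, hf', hf0⟩ ⟨hg, hg', hg0⟩
    refine ⟨hf.add hg, hf'.add hg', fun h => ?_⟩
    rcases tsupport_add f g h with h | h
    exacts [hf0 h, hg0 h]
  zero_mem' := ⟨contDiff_const, HasCompactSupport.zero, by simp [tsupport]⟩
  smul_mem' := by
    rintro c f ⟨hf, hf', hf0⟩
    refine ⟨hf.const_smul c, hf'.smul_left (f := fun _ => c), fun h => hf0 ?_⟩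
    exact tsupport_smul_subset_right (fun _ : ℂ => c) f h

/-- The differential expression `-i ∂_v f + a f`, where `∂_v` is the derivative in the
direction `v`. -/
def covDeriv (v : ℂ) (a : ℂ → ℝ) (f : ℂ → ℂ) : ℂ → ℂ :=
  fun z => -Complex.I * fderiv ℝ f z v + a z * f z

theorem covDeriv_mem (v : ℂ) {a : ℂ → ℝ} (ha : ∀ z, z ≠ 0 → ContDiffAt ℝ ∞ a z)
    {f : ℂ → ℂ} (hf : f ∈ testFunctions) : covDeriv v a f ∈ testFunctions := by
  obtain ⟨h1, h2, h3⟩ := hf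
  have hsub : Function.support (covDeriv v a f) ⊆ tsupport f := by
    intro z hz
    by_contra hzt
    apply hz
    have e1 : f z = 0 := image_eq_zero_of_notMem_tsupport hzt
    have e2 : fderiv ℝ f z = 0 := by
      by_contra h
      exact hzt (support_fderiv_subset ℝ h)
    simp [covDeriv, e1, e2]
  have hts : tsupport (covDeriv v a f) ⊆ tsupport f :=
    closure_minimal hsub (isClosed_tsupport f)
  refine ⟨?_, ?_, fun h => h3 (hts h)⟩
  · rw [contDiff_iff_contDiffAt]
    intro z
    by_cases hz : z = 0
    · subst hz
      have : covDeriv v a f =ᶠ[𝓝 0] fun _ => 0 :=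
        notMem_tsupport_iff_eventuallyEq.mp fun h => h3 (hts h)
      exact contDiffAt_const.congr_of_eventuallyEq this
    · have d1 : ContDiff ℝ ∞ fun w => fderiv ℝ f w v :=
        (h1.fderiv_right (m := ∞) (by simp)).clm_apply contDiff_const
      have d2 : ContDiffAt ℝ ∞ (fun w => (a w : ℂ)) z :=
        Complex.ofRealCLM.contDiff.contDiffAt.comp z (ha z hz)
      exact (contDiffAt_const.mul d1.contDiffAt).add (d2.mul h1.contDiffAt)
  · exact h2.of_isClosed_subset (isClosed_tsupport _) hts

/-- `-i ∂_v + a` as a linear operator on test functions. -/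
def covDerivₗ (v : ℂ) (a : ℂ → ℝ) (ha : ∀ z, z ≠ 0 → ContDiffAt ℝ ∞ a z) :
    testFunctions →ₗ[ℂ] testFunctions where
  toFun f := ⟨covDeriv v a f, covDeriv_mem v ha f.2⟩
  map_add' f g := by
    apply Subtype.ext
    funext z
    have hf := (f.2.1.differentiable (by simp)) z
    have hg := (g.2.1.differentiable (by simp)) z
    have h : fderiv ℝ (f.1 + g.1) z = fderiv ℝ f.1 z + fderiv ℝ g.1 z := fderiv_add hf hg
    simp only [covDeriv, Submodule.coe_add, Pi.add_apply, h, _root_.add_apply]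
    ring
  map_smul' c f := by
    apply Subtype.ext
    funext z
    have hf := (f.2.1.differentiable (by simp)) z
    have h : fderiv ℝ (c • f.1) z = c • fderiv ℝ f.1 z := fderiv_const_smul hf c
    simp only [covDeriv, Submodule.coe_smul, Pi.smul_apply, h, _root_.smul_apply,
      smul_eq_mul, RingHom.id_apply]
    ring

/-- The coefficient `-λ y / (x² + y²)`. -/
def coeffX (lam : ℝ) (z : ℂ) : ℝ := -(lam * z.im / (z.re ^ 2 + z.im ^ 2))

/-- The coefficient `λ x / (x² + y²)`. -/
def coeffY (lam : ℝ) (z : ℂ) : ℝ := lam * z.re / (z.re ^ 2 + z.im ^ 2)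

theorem re_sq_add_im_sq_ne_zero {z : ℂ} (hz : z ≠ 0) : z.re ^ 2 + z.im ^ 2 ≠ 0 := by
  intro h
  apply hz
  apply Complex.ext
  · simp only [Complex.zero_re]; nlinarith [sq_nonneg z.re, sq_nonneg z.im]
  · simp only [Complex.zero_im]; nlinarith [sq_nonneg z.re, sq_nonneg z.im]

theorem contDiffAt_coeffX (lam : ℝ) (z : ℂ) (hz : z ≠ 0) : ContDiffAt ℝ ∞ (coeffX lam) z := by
  have hre : ContDiff ℝ ∞ Complex.re := Complex.reCLM.contDiff
  have him : ContDiff ℝ ∞ Complex.im := Complex.imCLM.contDiff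
  exact ((contDiffAt_const.mul him.contDiffAt).div
    ((hre.pow 2).add (him.pow 2)).contDiffAt (re_sq_add_im_sq_ne_zero hz)).neg

theorem contDiffAt_coeffY (lam : ℝ) (z : ℂ) (hz : z ≠ 0) : ContDiffAt ℝ ∞ (coeffY lam) z := by
  have hre : ContDiff ℝ ∞ Complex.re := Complex.reCLM.contDiff
  have him : ContDiff ℝ ∞ Complex.im := Complex.imCLM.contDiff
  exact (contDiffAt_const.mul hre.contDiffAt).div
    ((hre.pow 2).add (him.pow 2)).contDiffAt (re_sq_add_im_sq_ne_zero hz)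

/-- The differential operator
`(-i ∂_x - λ y / (x² + y²))² + (-i ∂_y + λ x / (x² + y²))²` on test functions. -/
def formalOperator (lam : ℝ) : testFunctions →ₗ[ℂ] testFunctions :=
  covDerivₗ 1 (coeffX lam) (contDiffAt_coeffX lam) ∘ₗ
      covDerivₗ 1 (coeffX lam) (contDiffAt_coeffX lam) +
    covDerivₗ Complex.I (coeffY lam) (contDiffAt_coeffY lam) ∘ₗ
      covDerivₗ Complex.I (coeffY lam) (contDiffAt_coeffY lam)

theorem memLp_testFunction (f : testFunctions) : MemLp (f : ℂ → ℂ) 2 volume :=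
  f.2.1.continuous.memLp_of_hasCompactSupport f.2.2.1

/-- The inclusion of the test functions in `L²(ℝ²)`. -/
def testToL2 : testFunctions →ₗ[ℂ] L2 where
  toFun f := (memLp_testFunction f).toLp _
  map_add' f g := MemLp.toLp_add (memLp_testFunction f) (memLp_testFunction g)
  map_smul' c f := MemLp.toLp_const_smul c (memLp_testFunction f)

theorem testToL2_injective : Function.Injective testToL2 := by
  intro f g h
  have h' := (MemLp.toLp_eq_toLp_iff (memLp_testFunction f) (memLp_testFunction g)).mp h
  exact Subtype.ext (Continuous.ae_eq_iff_eq volume f.2.1.continuous g.2.1.continuous |>.mp h')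

/-- The differential operator as an operator in `L²(ℝ²)` with domain `C_c^∞(ℝ² \ {0})`. -/
def preOperator (lam : ℝ) : L2 →ₗ.[ℂ] L2 where
  domain := LinearMap.range testToL2
  toFun := testToL2 ∘ₗ formalOperator lam ∘ₗ
    (LinearEquiv.ofInjective testToL2 testToL2_injective).symm.toLinearMap

/-- The Aharonov–Bohm operator `M_λ`: the minimal operator, that is the closure of the
differential operator on `C_c^∞(ℝ² \ {0})`. -/
def abOperator (lam : ℝ) : L2 →ₗ.[ℂ] L2 := (preOperator lam).closure

end AharonovBohm

end

set_option linter.unusedSectionVars false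

noncomputable section

namespace AharonovBohm

/-! ### Von Neumann's extension theory with finitely many boundary pairs. -/

section Abstract

variable {E : Type*} [NormedAddCommGroup E] [InnerProductSpace ℂ E] [CompleteSpace E]

/-! ### Graphs of hermitian operators and of their adjoints -/

/-! In the variable `s = log r`, on functions of angular momentum `l`, the operator is `e^{-2s}(-∂²
+ (l+λ)²)`. Near the origin the homogeneous solutions are `r^k` and `r^{-k}` with `k = |l+λ|` (for
`k = 0`: `1` and `log r`), and both are square integrable at `0` exactly when `k < 1`. Hence
extensions only involve the critical modes with `|l+λ| < 1`: the single mode `l = -λ`, with `k = 0`,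
when `λ` is an integer, and otherwise the two modes `-⌊λ⌋` and `-⌊λ⌋-1`, with `0 < k < 1`.

Deficiency indices are squeezed between two bounds, without Bessel functions. From above: the
angular Fourier coefficients of a deficiency vector solve `p'' = ((l+λ)² ± i e^{2s}) p` with
`e^{2s}|p|²` integrable; convexity of `|p|²` shows that `p` is determined by `p(0)`, and that `p =
0` in noncritical modes (`exists_injective_deficiencySpace`). From below: cut-off versions of the
two solutions in each critical mode lie in `D(M†)`, and the boundary form between them is their
Wronskian (`polarL2_wronskian`), so they are independent modulo `D(M)`. Von Neumann's decomposition
(`exists_add_deficiency`) forces equality and shows that these vectors span `D(M†)` modulo `D(M)`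
(`BoundaryPairs.finrank_deficiency`). Choosing one vector from each pair gives a self-adjoint
extension (`BoundaryPairs.isSelfAdjoint_ext`).

The extremal extensions come from moving the cutoff. The vector `r^k` with `k ≥ 0` can be cut off
ever closer to the origin, with norm and energy tending to `0`; then `D(M)` is a form core and the
extension is Friedrichs (`isFriedrichsExtension_of_approx`). The vector `r^k` with `k ≤ 0` can be
cut off ever farther out, with energy and norm of the image tending to `0`; this gives the Krein
extension (`isKreinExtension_of_approx`). For `k = 0` logarithmic cutoffs do both, so the two
extensions coincide. The same arguments apply within one sector.

Modulo `D(M)`, the dilations act on the boundary vectors of a mode with distinct eigenvalues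
`e^{τ(1±k)}` if `k > 0`, and by a Jordan block if `k = 0`, because `log(e^τ r) = log r + τ`. In the
first case rotation symmetry separates the modes and homogeneity selects one vector of each pair,
which leaves four extensions (`CriticalModes.exists_eq_ext`). In the second case the only proper
nonzero invariant subspace is the line of the constant (`CriticalModes.eq_ext_of_homogeneous`). -/

theorem mem_graph_adjoint_iff {S : E →ₗ.[ℂ] E} (hd : Dense (S.domain : Set E)) {y w : E} :
    (y, w) ∈ S.adjoint.graph ↔ ∀ a b, (a, b) ∈ S.graph → ⟪w, a⟫_ℂ = ⟪y, b⟫_ℂ := by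
  rw [LinearPMap.adjoint_graph_eq_graph_adjoint hd, Submodule.mem_adjoint_iff]
  refine forall_congr' fun a => forall_congr' fun b => imp_congr_right fun _ => ?_
  rw [sub_eq_zero, ← inner_conj_symm b, ← inner_conj_symm a]
  exact ⟨fun h => (star_injective h).symm, fun h => congrArg _ h.symm⟩

theorem isFormalAdjoint_iff_graph {S T : E →ₗ.[ℂ] E} :
    S.IsFormalAdjoint T ↔
      ∀ a b c d, (a, b) ∈ S.graph → (c, d) ∈ T.graph → ⟪b, c⟫_ℂ = ⟪a, d⟫_ℂ := by
  constructor
  · rintro h a b c d h1 h2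
    obtain ⟨x, rfl, rfl⟩ := (LinearPMap.mem_graph_iff S).1 h1
    obtain ⟨y, rfl, rfl⟩ := (LinearPMap.mem_graph_iff T).1 h2
    exact h x y
  · intro h x y
    exact h _ _ _ _ (S.mem_graph x) (T.mem_graph y)

theorem graph_le {S T : E →ₗ.[ℂ] E} (h : S ≤ T) {a b : E} (hab : (a, b) ∈ S.graph) :
    (a, b) ∈ T.graph :=
  LinearPMap.le_graph_of_le h hab

theorem exists_graph {S : E →ₗ.[ℂ] E} {a : E} (h : a ∈ S.domain) : ∃ b, (a, b) ∈ S.graph :=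
  LinearPMap.mem_domain_iff.1 h

theorem mem_domain_of_graph {S : E →ₗ.[ℂ] E} {a b : E} (h : (a, b) ∈ S.graph) : a ∈ S.domain :=
  LinearPMap.mem_domain_iff.2 ⟨b, h⟩

theorem graph_unique {S : E →ₗ.[ℂ] E} {a b c : E} (h : (a, b) ∈ S.graph) (h' : (a, c) ∈ S.graph) :
    b = c :=
  LinearPMap.mem_graph_snd_inj S h h' rfl

theorem mem_deficiencySpace {S : E →ₗ.[ℂ] E} {z : ℂ} {f : E} :
    f ∈ deficiencySpace S z ↔ (f, z • f) ∈ S.adjoint.graph := by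
  unfold deficiencySpace
  rw [Submodule.mem_map, LinearPMap.mem_graph_iff]
  constructor
  · rintro ⟨y, hy, rfl⟩
    refine ⟨y, rfl, ?_⟩
    rw [LinearMap.mem_ker, LinearMap.sub_apply, sub_eq_zero] at hy
    exact hy
  · rintro ⟨y, hy, hy'⟩
    refine ⟨y, ?_, hy⟩
    rw [LinearMap.mem_ker, LinearMap.sub_apply, sub_eq_zero]
    change S.adjoint y = z • (y : E)
    rw [hy', hy]

/-- `S` is closed, densely defined and hermitian. -/
structure IsClosedHermitian (S : E →ₗ.[ℂ] E) : Prop where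
  dense : Dense (S.domain : Set E)
  hermitian : S.IsFormalAdjoint S
  closed : S.IsClosed

theorem IsClosedHermitian.le_adjoint {S : E →ₗ.[ℂ] E} (hS : IsClosedHermitian S) :
    S ≤ S.adjoint :=
  LinearPMap.IsFormalAdjoint.le_adjoint hS.dense hS.hermitian

/-- For hermitian `S` the number `⟨b, a⟩` is real, so the cross term is the real part of an
imaginary number. -/
theorem norm_sub_I_smul_sq {S : E →ₗ.[ℂ] E} (hS : S.IsFormalAdjoint S) {a b : E}
    (h : (a, b) ∈ S.graph) : ‖b - Complex.I • a‖ ^ 2 = ‖a‖ ^ 2 + ‖b‖ ^ 2 := by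
  have h1 : ⟪b, a⟫_ℂ = ⟪a, b⟫_ℂ := isFormalAdjoint_iff_graph.1 hS _ _ _ _ h h
  have h2 : (⟪b, a⟫_ℂ).im = 0 := by
    have := congrArg Complex.im (inner_conj_symm (𝕜 := ℂ) b a)
    rw [h1, Complex.conj_im] at this
    rw [h1]; linarith
  have h3 := @norm_sub_sq ℂ _ _ _ _ b (Complex.I • a)
  rw [inner_smul_right, norm_smul, Complex.norm_I, one_mul] at h3
  have h4 : RCLike.re (Complex.I * ⟪b, a⟫_ℂ) = 0 := by
    change (Complex.I * ⟪b, a⟫_ℂ).re = 0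
    simp [Complex.mul_re, h2]
  rw [h3, h4]; ring

/-- The range of `S - i` is closed. -/
theorem isClosed_range_sub_I {S : E →ₗ.[ℂ] E} (hS : IsClosedHermitian S) :
    IsClosed ((S.graph.map (LinearMap.snd ℂ E E - Complex.I • LinearMap.fst ℂ E E) :
      Submodule ℂ E) : Set E) := by
  have hcl : IsClosed (S.graph : Set (E × E)) := hS.closed
  have : CompleteSpace S.graph := hcl.completeSpace_coe
  let L : S.graph →L[ℂ] E := (ContinuousLinearMap.snd ℂ E E -
    Complex.I • ContinuousLinearMap.fst ℂ E E).comp S.graph.subtypeL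
  -- The Pythagorean identity bounds `b - i a` below by the graph norm; the graph is complete, so
  -- the range is closed.
  have hL : AntilipschitzWith 1 L := by
    refine ContinuousLinearMap.antilipschitz_of_bound L fun x => ?_
    obtain ⟨⟨a, b⟩, hx⟩ := x
    have h := norm_sub_I_smul_sq hS.hermitian hx
    have e : L ⟨(a, b), hx⟩ = b - Complex.I • a := rfl
    rw [e]
    change max ‖a‖ ‖b‖ ≤ _
    simp only [NNReal.coe_one, one_mul]
    refine max_le ?_ ?_ <;> refine abs_le_of_sq_le_sq' ?_ (norm_nonneg _) |>.2 <;>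
      nlinarith [sq_nonneg ‖a‖, sq_nonneg ‖b‖]
  have h2 := hL.isClosed_range L.uniformContinuous
  convert h2 using 1
  ext y
  simp [L]

/-- Von Neumann's formula. Split `g - i f` along the closed range of `S - i` and its orthogonal
complement, which is the kernel of `S† + i`. -/
theorem exists_add_deficiency {S : E →ₗ.[ℂ] E} (hS : IsClosedHermitian S) {f g : E}
    (hfg : (f, g) ∈ S.adjoint.graph) : ∃ s ∈ S.domain, ∃ n ∈ deficiencySpace S Complex.I,
      ∃ n' ∈ deficiencySpace S (-Complex.I), f = s + n + n' := by
  set R := S.graph.map (LinearMap.snd ℂ E E - Complex.I • LinearMap.fst ℂ E E) with hR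
  have : CompleteSpace R := (isClosed_range_sub_I hS).completeSpace_coe
  obtain ⟨r, hr, n, hn, e⟩ := R.exists_add_mem_mem_orthogonal (g - Complex.I • f)
  obtain ⟨⟨s, s'⟩, hs, rfl⟩ := hr
  have hnT : (n, -Complex.I • n) ∈ S.adjoint.graph := by
    rw [mem_graph_adjoint_iff hS.dense]
    intro a b hab
    have h1 := (Submodule.mem_orthogonal' R n).1 hn (b - Complex.I • a) ⟨(a, b), hab, rfl⟩
    rw [inner_sub_right, inner_smul_right, sub_eq_zero] at h1
    rw [inner_smul_left, h1]
    simp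
  have hsT : (s, s') ∈ S.adjoint.graph := graph_le hS.le_adjoint hs
  -- The factor `i/2` is chosen so that `(S† - i)((i/2) n) = (i/2)(-2i) n = n`; hence `f - s - (i/2)
  -- n` is annihilated by `S† - i`.
  have h2 : ((Complex.I / 2) • n, (Complex.I / 2) • (-Complex.I • n)) ∈ S.adjoint.graph :=
    S.adjoint.graph.smul_mem (Complex.I / 2) hnT
  have h3 := S.adjoint.graph.sub_mem (S.adjoint.graph.sub_mem hfg hsT) h2
  refine ⟨s, mem_domain_of_graph hs, f - s - (Complex.I / 2) • n, ?_, (Complex.I / 2) • n, ?_, ?_⟩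
  · rw [mem_deficiencySpace]
    convert h3 using 1
    have e' : g = (s' - Complex.I • s) + n + Complex.I • f := by
      exact sub_eq_iff_eq_add.1 e
    refine Prod.ext rfl ?_
    change Complex.I • (f - s - (Complex.I / 2) • n) = g - s' - (Complex.I / 2) • (-Complex.I • n)
    rw [e']
    have : Complex.I * (Complex.I / 2) = -(1 / 2) := by
      rw [← mul_div_assoc, Complex.I_mul_I]; ring
    simp only [smul_sub, smul_smul]
    rw [this]
    have h5 : Complex.I / 2 * -Complex.I = 1 / 2 := by
      rw [mul_comm, neg_mul, this]; ring
    rw [h5]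
    module
  · exact (deficiencySpace S (-Complex.I)).smul_mem _ (mem_deficiencySpace.2 hnT)
  · abel

/-! ### Boundary data -/

/-- A family of pairs of vectors in the domain of `S†`, on which the boundary form
`⟨S† f, g⟩ - ⟨f, S† g⟩` is symplectic in normal form. -/
structure BoundaryPairs (S : E →ₗ.[ℂ] E) (ι : Type*) where
  vec : ι → Bool → E
  img : ι → Bool → E
  mem_graph : ∀ i b, (vec i b, img i b) ∈ S.adjoint.graph
  symm : ∀ i j b c, (i ≠ j ∨ b = c) → ⟪img i b, vec j c⟫_ℂ = ⟪vec i b, img j c⟫_ℂ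
  ne : ∀ i, ⟪img i true, vec i false⟫_ℂ ≠ ⟪vec i true, img i false⟫_ℂ

namespace BoundaryPairs

variable {S : E →ₗ.[ℂ] E} {ι : Type*} (B : BoundaryPairs S ι)

theorem ne' (i : ι) (b : Bool) :
    ⟪B.img i b, B.vec i (!b)⟫_ℂ - ⟪B.vec i b, B.img i (!b)⟫_ℂ ≠ 0 := by
  rw [sub_ne_zero]
  cases b
  · intro h
    apply B.ne i
    have := congrArg (starRingEnd ℂ) h
    rw [inner_conj_symm, inner_conj_symm] at this
    exact this.symm
  · exact B.ne i

/-- The boundary form of `B.vec i b` with an element of the graph of `S†`. -/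
def form (i : ι) (b : Bool) : E × E →ₗ[ℂ] ℂ :=
  (innerSL ℂ (B.img i b)).toLinearMap ∘ₗ LinearMap.fst ℂ E E -
    (innerSL ℂ (B.vec i b)).toLinearMap ∘ₗ LinearMap.snd ℂ E E

theorem form_apply (i : ι) (b : Bool) (x y : E) :
    B.form i b (x, y) = ⟪B.img i b, x⟫_ℂ - ⟪B.vec i b, y⟫_ℂ := rfl

theorem form_of_mem (hd : Dense (S.domain : Set E)) (i : ι) (b : Bool) {x y : E}
    (h : (x, y) ∈ S.graph) : B.form i b (x, y) = 0 := by
  rw [form_apply, sub_eq_zero]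
  exact (mem_graph_adjoint_iff hd).1 (B.mem_graph i b) x y h

theorem form_vec (i j : ι) (b c : Bool) (h : i ≠ j ∨ b = c) :
    B.form i b (B.vec j c, B.img j c) = 0 := by
  rw [form_apply, B.symm i j b c h, sub_self]

variable [Fintype ι]

/-- In symplectic normal form only the partner of `(i, b)` pairs with it, so the boundary form reads
off one coefficient. -/
theorem form_sum (i : ι) (b : Bool) (c : ι → Bool → ℂ) :
    B.form i b (∑ j, ∑ d, c j d • (B.vec j d, B.img j d)) =
      c i (!b) * B.form i b (B.vec i (!b), B.img i (!b)) := by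
  classical
  rw [map_sum, Finset.sum_eq_single i]
  · rw [map_sum, Finset.sum_eq_single (!b)]
    · rw [map_smul, smul_eq_mul]
    · intro d _ hd
      rw [map_smul, B.form_vec i i b d (Or.inr (by cases b <;> cases d <;> simp_all)), smul_zero]
    · simp
  · intro j _ hj
    rw [map_sum]
    refine Finset.sum_eq_zero fun d _ => ?_
    rw [map_smul, B.form_vec i j b d (Or.inl hj.symm), smul_zero]
  · simp

theorem sum_mem_graph (c : ι → Bool → ℂ) :
    (∑ j, ∑ d, c j d • (B.vec j d, B.img j d)) ∈ S.adjoint.graph :=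
  Submodule.sum_mem _ fun j _ => Submodule.sum_mem _ fun d _ =>
    Submodule.smul_mem _ _ (B.mem_graph j d)

theorem fst_sum (c : ι → Bool → ℂ) :
    (∑ j, ∑ d, c j d • (B.vec j d, B.img j d)).1 = ∑ j, ∑ d, c j d • B.vec j d := by
  simp [Prod.fst_sum]

theorem snd_sum (c : ι → Bool → ℂ) :
    (∑ j, ∑ d, c j d • (B.vec j d, B.img j d)).2 = ∑ j, ∑ d, c j d • B.img j d := by
  simp [Prod.snd_sum]

/-- The boundary form vanishes on the graph of `S`, while on the combination it returns each
coefficient times a nonzero number. -/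
theorem coeff_eq_zero (hS : IsClosedHermitian S) (c : ι → Bool → ℂ)
    (h : (∑ j, ∑ d, c j d • B.vec j d) ∈ S.domain) : ∀ i b, c i b = 0 := by
  intro i b
  obtain ⟨y, hy⟩ := exists_graph h
  have h1 := B.sum_mem_graph c
  have h2 := B.form_sum i (!b) c
  have h3 : (∑ j, ∑ d, c j d • (B.vec j d, B.img j d)) = (∑ j, ∑ d, c j d • B.vec j d, y) := by
    refine Prod.ext (B.fst_sum c) ?_
    refine graph_unique (S := S.adjoint) (a := ∑ j, ∑ d, c j d • B.vec j d) ?_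
      (graph_le hS.le_adjoint hy)
    rw [← B.fst_sum c]
    exact h1
  rw [h3, B.form_of_mem hS.dense _ _ hy, Bool.not_not, form_apply] at h2
  rcases mul_eq_zero.1 h2.symm with h4 | h4
  · exact h4
  · have := B.ne' i (!b)
    rw [Bool.not_not] at this
    exact absurd h4 this

theorem linearIndependent_mkQ (hS : IsClosedHermitian S) :
    LinearIndependent ℂ (fun x : ι × Bool => S.domain.mkQ (B.vec x.1 x.2)) := by
  rw [Fintype.linearIndependent_iff]
  intro c hc x
  refine B.coeff_eq_zero hS (fun i b => c (i, b)) ?_ x.1 x.2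
  rw [← Submodule.ker_mkQ S.domain, LinearMap.mem_ker, map_sum, ← hc, Fintype.sum_prod_type]
  simp

/-- A dimension squeeze in the quotient by `D(S)`. The `2|ι|` classes of the boundary vectors are
independent, and they lie in the sum of the images of the two deficiency spaces, each of dimension
at most `|ι|`. All the inequalities are therefore equalities, which yields the indices and the
spanning statement together. -/
theorem finrank_deficiency (hS : IsClosedHermitian S)
    (hp : ∃ φ : deficiencySpace S Complex.I →ₗ[ℂ] (ι → ℂ), Function.Injective φ)
    (hn : ∃ φ : deficiencySpace S (-Complex.I) →ₗ[ℂ] (ι → ℂ), Function.Injective φ) :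
    HasDeficiencyIndices S (Fintype.card ι) (Fintype.card ι) ∧
      ∀ f ∈ S.adjoint.domain, ∃ s ∈ S.domain, ∃ c : ι → Bool → ℂ,
        f = s + ∑ j, ∑ d, c j d • B.vec j d := by
  classical
  obtain ⟨φ, hφ⟩ := hp
  obtain ⟨ψ, hψ⟩ := hn
  have f1 : Module.Finite ℂ (deficiencySpace S Complex.I) := Module.Finite.of_injective φ hφ
  have f2 : Module.Finite ℂ (deficiencySpace S (-Complex.I)) := Module.Finite.of_injective ψ hψ
  have r1 : Module.finrank ℂ (deficiencySpace S Complex.I) ≤ Fintype.card ι := by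
    simpa using LinearMap.finrank_le_finrank_of_injective hφ
  have r2 : Module.finrank ℂ (deficiencySpace S (-Complex.I)) ≤ Fintype.card ι := by
    simpa using LinearMap.finrank_le_finrank_of_injective hψ
  set π := S.domain.mkQ with hπ
  set A := (deficiencySpace S Complex.I).map π with hA
  set A' := (deficiencySpace S (-Complex.I)).map π with hA'
  set V := Submodule.span ℂ (Set.range fun x : ι × Bool => π (B.vec x.1 x.2)) with hV
  have a1 : Module.finrank ℂ A ≤ Module.finrank ℂ (deficiencySpace S Complex.I) :=
    Submodule.finrank_map_le _ _
  have a2 : Module.finrank ℂ A' ≤ Module.finrank ℂ (deficiencySpace S (-Complex.I)) :=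
    Submodule.finrank_map_le _ _
  have a3 : Module.finrank ℂ (A ⊔ A' : Submodule ℂ (E ⧸ S.domain)) ≤
      Module.finrank ℂ A + Module.finrank ℂ A' := Submodule.finrank_add_le_finrank_add_finrank _ _
  have v1 : Module.finrank ℂ V = Fintype.card ι + Fintype.card ι := by
    rw [hV, finrank_span_eq_card (B.linearIndependent_mkQ hS), Fintype.card_prod,
      Fintype.card_bool]
    ring
  have hTA : ∀ f ∈ S.adjoint.domain, π f ∈ A ⊔ A' := by
    intro f hf
    obtain ⟨g, hg⟩ := exists_graph hf
    obtain ⟨s, hs, n, hn, n', hn', rfl⟩ := exists_add_deficiency hS hg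
    have : π s = 0 := by rwa [← LinearMap.mem_ker, hπ, Submodule.ker_mkQ]
    rw [map_add, map_add, this, zero_add]
    exact Submodule.add_mem_sup (Submodule.mem_map_of_mem hn) (Submodule.mem_map_of_mem hn')
  have hVA : V ≤ A ⊔ A' := by
    rw [hV, Submodule.span_le]
    rintro _ ⟨x, rfl⟩
    exact hTA _ (mem_domain_of_graph (B.mem_graph x.1 x.2))
  have v2 := Submodule.finrank_mono hVA
  have heq : V = A ⊔ A' := Submodule.eq_of_le_of_finrank_le hVA (by omega)
  refine ⟨⟨hS.dense, hS.hermitian, ?_, ?_⟩, ?_⟩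
  · rw [← Module.finrank_eq_rank, Nat.cast_inj]; omega
  · rw [← Module.finrank_eq_rank, Nat.cast_inj]; omega
  · intro f hf
    have h := hTA f hf
    rw [← heq, hV, Submodule.mem_span_range_iff_exists_fun] at h
    obtain ⟨c, hc⟩ := h
    refine ⟨f - ∑ j, ∑ d, c (j, d) • B.vec j d, ?_, fun j d => c (j, d), by abel⟩
    rw [← Submodule.ker_mkQ S.domain, LinearMap.mem_ker, map_sub, sub_eq_zero, ← hπ, ← hc,
      Fintype.sum_prod_type]
    simp

/-- The extension of `S` whose domain is spanned by that of `S` and one vector out of each pair. -/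
def ext (σ : ι → Bool) : E →ₗ.[ℂ] E :=
  S.adjoint.domRestrict (S.domain ⊔ Submodule.span ℂ (Set.range fun i => B.vec i (σ i)))

theorem mem_ext_graph (hS : IsClosedHermitian S) (σ : ι → Bool) {x y : E} :
    (x, y) ∈ (B.ext σ).graph ↔ ∃ s s' : E, ∃ c : ι → ℂ, (s, s') ∈ S.graph ∧
      x = s + ∑ i, c i • B.vec i (σ i) ∧ y = s' + ∑ i, c i • B.img i (σ i) := by
  have key : ∀ s s' : E, ∀ c : ι → ℂ, (s, s') ∈ S.graph →
      (s + ∑ i, c i • B.vec i (σ i), s' + ∑ i, c i • B.img i (σ i)) ∈ S.adjoint.graph := by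
    intro s s' c hs
    have h1 := Submodule.sum_mem S.adjoint.graph (t := Finset.univ)
      (f := fun i => c i • (B.vec i (σ i), B.img i (σ i)))
      fun i _ => Submodule.smul_mem _ (c i) (B.mem_graph i (σ i))
    have h2 := Submodule.add_mem _ (graph_le hS.le_adjoint hs) h1
    convert h2 using 1
    refine Prod.ext ?_ ?_
    · simp [Prod.fst_sum]
    · simp [Prod.snd_sum]
  constructor
  · intro h
    have hx : x ∈ (S.domain ⊔ Submodule.span ℂ (Set.range fun i => B.vec i (σ i))) :=
      (mem_domain_of_graph h).1
    have hT : (x, y) ∈ S.adjoint.graph := graph_le LinearPMap.domRestrict_le h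
    obtain ⟨s, hs, t, ht, rfl⟩ := Submodule.mem_sup.1 hx
    obtain ⟨c, rfl⟩ := (Submodule.mem_span_range_iff_exists_fun ℂ).1 ht
    obtain ⟨s', hs'⟩ := exists_graph hs
    exact ⟨s, s', c, hs', rfl, graph_unique hT (key s s' c hs')⟩
  · rintro ⟨s, s', c, hs, rfl, rfl⟩
    have h := key s s' c hs
    obtain ⟨⟨z, hz⟩, h1, h2⟩ := (LinearPMap.mem_graph_iff _).1 h
    have h1' : z = s + ∑ i, c i • B.vec i (σ i) := h1
    refine (LinearPMap.mem_graph_iff _).2 ⟨⟨z, ⟨?_, hz⟩⟩, h1, ?_⟩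
    · rw [h1']
      refine Submodule.add_mem_sup (mem_domain_of_graph hs) ?_
      exact (Submodule.mem_span_range_iff_exists_fun ℂ).2 ⟨c, rfl⟩
    · rw [← h2]
      exact LinearPMap.domRestrict_apply rfl

theorem le_ext (hS : IsClosedHermitian S) (σ : ι → Bool) : S ≤ B.ext σ :=
  LinearPMap.le_graph_iff.1 fun ⟨s, s'⟩ h =>
    (B.mem_ext_graph hS σ).2 ⟨s, s', 0, h, by simp, by simp⟩

theorem ext_le_adjoint (σ : ι → Bool) : B.ext σ ≤ S.adjoint := LinearPMap.domRestrict_le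

theorem vec_mem_ext (hS : IsClosedHermitian S) (σ : ι → Bool) (i : ι) :
    (B.vec i (σ i), B.img i (σ i)) ∈ (B.ext σ).graph := by
  classical
  refine (B.mem_ext_graph hS σ).2 ⟨0, 0, Pi.single i 1, S.graph.zero_mem, ?_, ?_⟩ <;>
  simp [Pi.single_apply]

/-- Vectors selected one per pair span an isotropic subspace for the boundary form. -/
theorem ext_isFormalAdjoint (hS : IsClosedHermitian S) (σ : ι → Bool) :
    (B.ext σ).IsFormalAdjoint (B.ext σ) := by
  rw [isFormalAdjoint_iff_graph]
  intro a b c d h1 h2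
  have hT1 : (a, b) ∈ S.adjoint.graph := graph_le (B.ext_le_adjoint σ) h1
  have hT2 : (c, d) ∈ S.adjoint.graph := graph_le (B.ext_le_adjoint σ) h2
  obtain ⟨s, s', k, hs, rfl, rfl⟩ := (B.mem_ext_graph hS σ).1 h1
  obtain ⟨t, t', m, ht, rfl, rfl⟩ := (B.mem_ext_graph hS σ).1 h2
  have e1 : ∀ i, ⟪B.img i (σ i), t⟫_ℂ = ⟪B.vec i (σ i), t'⟫_ℂ := fun i =>
    (mem_graph_adjoint_iff hS.dense).1 (B.mem_graph i (σ i)) _ _ ht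
  have e2 : ∀ i, ⟪s', B.vec i (σ i)⟫_ℂ = ⟪s, B.img i (σ i)⟫_ℂ := fun i => by
    have := (mem_graph_adjoint_iff hS.dense).1 (B.mem_graph i (σ i)) _ _ hs
    rw [← inner_conj_symm, ← inner_conj_symm s, this]
  have e3 : ⟪s', t⟫_ℂ = ⟪s, t'⟫_ℂ := isFormalAdjoint_iff_graph.1 hS.hermitian _ _ _ _ hs ht
  have e4 : ∀ i j, ⟪B.img i (σ i), B.vec j (σ j)⟫_ℂ = ⟪B.vec i (σ i), B.img j (σ j)⟫_ℂ := by
    intro i j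
    refine B.symm _ _ _ _ ?_
    by_cases h : i = j
    · exact Or.inr (by rw [h])
    · exact Or.inl h
  simp only [inner_add_left, inner_add_right, sum_inner, inner_sum, inner_smul_left,
    inner_smul_right, e1, e2, e3, e4]

/-- The isotropic subspace is maximal: pairing an element of the adjoint's domain with the selected
vector of a pair kills its coefficient along the other one. -/
theorem isSelfAdjoint_ext (hS : IsClosedHermitian S)
    (hdec : ∀ f ∈ S.adjoint.domain, ∃ s ∈ S.domain, ∃ c : ι → Bool → ℂ,
        f = s + ∑ j, ∑ d, c j d • B.vec j d) (σ : ι → Bool) :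
    IsSelfAdjoint (B.ext σ) := by
  classical
  have hd : Dense ((B.ext σ).domain : Set E) := hS.dense.mono (B.le_ext hS σ).1
  have hsym := B.ext_isFormalAdjoint hS σ
  rw [LinearPMap.isSelfAdjoint_def]
  refine le_antisymm ?_ (LinearPMap.IsFormalAdjoint.le_adjoint hd hsym)
  refine LinearPMap.le_graph_iff.1 ?_
  rintro ⟨y, z⟩ h
  have h' := (mem_graph_adjoint_iff hd).1 h
  have hT : (y, z) ∈ S.adjoint.graph :=
    (mem_graph_adjoint_iff hS.dense).2 fun a b hab => h' a b (graph_le (B.le_ext hS σ) hab)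
  obtain ⟨s, hs, c, rfl⟩ := hdec y (mem_domain_of_graph hT)
  obtain ⟨s', hs'⟩ := exists_graph hs
  have hsum : (s + ∑ j, ∑ d, c j d • B.vec j d, z) =
      (s, s') + ∑ j, ∑ d, c j d • (B.vec j d, B.img j d) := by
    refine Prod.ext (by rw [Prod.fst_add, B.fst_sum]) ?_
    refine graph_unique hT ?_
    have := Submodule.add_mem _ (graph_le hS.le_adjoint hs') (B.sum_mem_graph c)
    rw [← Prod.mk.eta (p := (s, s') + _)] at this
    rwa [Prod.fst_add, B.fst_sum] at this
  -- The selected vector of pair `j` belongs to the extension, so its boundary form with an element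
  -- of the adjoint graph is zero.
  have hc : ∀ j, c j (!(σ j)) = 0 := by
    intro j
    have h1 : B.form j (σ j) (s + ∑ j, ∑ d, c j d • B.vec j d, z) = 0 := by
      rw [form_apply, sub_eq_zero]
      have := h' _ _ (B.vec_mem_ext hS σ j)
      rw [← inner_conj_symm, ← this, inner_conj_symm]
    rw [hsum, map_add, B.form_of_mem hS.dense _ _ hs', zero_add, B.form_sum, form_apply] at h1
    exact (mul_eq_zero.1 h1).resolve_right (B.ne' j (σ j))
  have hred : ∀ (F : ι → Bool → E), ∑ j, ∑ d, c j d • F j d = ∑ j, c j (σ j) • F j (σ j) := by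
    intro F
    refine Finset.sum_congr rfl fun j _ => ?_
    rw [Finset.sum_eq_single (σ j)]
    · intro d _ hd
      have : d = !(σ j) := by revert hd; cases d <;> cases σ j <;> simp
      rw [this, hc j, zero_smul]
    · simp
  refine (B.mem_ext_graph hS σ).2 ⟨s, s', fun j => c j (σ j), hs', by rw [hred], ?_⟩
  have := congrArg Prod.snd hsum
  rw [Prod.snd_add, B.snd_sum, hred (fun j d => B.img j d)] at this
  exact this

end BoundaryPairs

end Abstract

/-! ### Closed forms and criteria for the Friedrichs and Krein extensions. -/

section Forms

variable {E : Type*} [NormedAddCommGroup E] [InnerProductSpace ℂ E] [CompleteSpace E]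

/-! ### Quadratic forms of hermitian operators -/

variable {S H : E →ₗ.[ℂ] E}

theorem quadForm_add (hs : H.IsFormalAdjoint H) (x y : H.domain) :
    quadForm H (x + y) = quadForm H x + quadForm H y + 2 * (⟪(x : E), H y⟫_ℂ).re := by
  have h : (⟪(y : E), H x⟫_ℂ).re = (⟪(x : E), H y⟫_ℂ).re := by
    rw [← hs x y, ← inner_conj_symm, Complex.conj_re]
  simp only [quadForm, Submodule.coe_add, LinearPMap.map_add, inner_add_left, inner_add_right,
    Complex.add_re]
  rw [h]; ring

theorem quadForm_smul (c : ℂ) (x : H.domain) :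
    quadForm H (c • x) = ‖c‖ ^ 2 * quadForm H x := by
  simp only [quadForm, Submodule.coe_smul, LinearPMap.map_smul, inner_smul_left, inner_smul_right]
  rw [← mul_assoc, Complex.mul_conj']
  norm_cast
  rw [Complex.re_ofReal_mul]

theorem quadForm_neg (x : H.domain) : quadForm H (-x) = quadForm H x := by
  have := quadForm_smul (H := H) (-1) x
  simpa using this

theorem quadForm_sub (hs : H.IsFormalAdjoint H) (x y : H.domain) :
    quadForm H (x - y) = quadForm H x + quadForm H y - 2 * (⟪(x : E), H y⟫_ℂ).re := by
  rw [sub_eq_add_neg, quadForm_add hs, quadForm_neg, LinearPMap.map_neg, inner_neg_right,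
    Complex.neg_re]
  ring

/-- The form of a positive hermitian operator as a semidefinite inner product. -/
@[reducible]
def formCore (hs : H.IsFormalAdjoint H) (hp : ∀ f : H.domain, 0 ≤ quadForm H f) :
    PreInnerProductSpace.Core ℂ H.domain where
  inner x y := ⟪(x : E), H y⟫_ℂ
  conj_inner_symm x y := by
    change (starRingEnd ℂ) ⟪(y : E), H x⟫_ℂ = ⟪(x : E), H y⟫_ℂ
    rw [← hs x y, inner_conj_symm]
  re_inner_nonneg x := hp x
  add_left x y z := by
    change ⟪((x + y : H.domain) : E), H z⟫_ℂ = ⟪(x : E), H z⟫_ℂ + ⟪(y : E), H z⟫_ℂ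
    rw [Submodule.coe_add, inner_add_left]
  smul_left x y c := by
    change ⟪((c • x : H.domain) : E), H y⟫_ℂ = (starRingEnd ℂ) c * ⟪(x : E), H y⟫_ℂ
    rw [Submodule.coe_smul, inner_smul_left]

/-- The Cauchy–Schwarz inequality of the semidefinite form. -/
theorem norm_inner_sq_le (hs : H.IsFormalAdjoint H) (hp : ∀ f : H.domain, 0 ≤ quadForm H f)
    (x y : H.domain) : ‖⟪(x : E), H y⟫_ℂ‖ ^ 2 ≤ quadForm H x * quadForm H y := by
  have h := @InnerProductSpace.Core.inner_mul_inner_self_le ℂ H.domain _ _ _ (formCore hs hp) x y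
  have h1 : ‖⟪(y : E), H x⟫_ℂ‖ = ‖⟪(x : E), H y⟫_ℂ‖ := by
    rw [← hs x y, ← inner_conj_symm, RCLike.norm_conj]
  calc ‖⟪(x : E), H y⟫_ℂ‖ ^ 2 = ‖⟪(x : E), H y⟫_ℂ‖ * ‖⟪(y : E), H x⟫_ℂ‖ := by rw [h1, sq]
    _ ≤ _ := h

/-- The seminorm `√⟨f, H f⟩`. -/
def formSeminorm (hs : H.IsFormalAdjoint H) (hp : ∀ f : H.domain, 0 ≤ quadForm H f) :
    Seminorm ℂ H.domain :=
  Seminorm.of (fun x => √(quadForm H x))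
    (fun x y => by
      rw [Real.sqrt_le_left (by positivity), quadForm_add hs, add_sq, Real.sq_sqrt (hp x),
        Real.sq_sqrt (hp y)]
      have h1 := norm_inner_sq_le hs hp x y
      have h2 : ‖⟪(x : E), H y⟫_ℂ‖ ≤ √(quadForm H x) * √(quadForm H y) := by
        rw [← Real.sqrt_mul (hp x)]
        exact Real.le_sqrt_of_sq_le h1
      have h3 := (Complex.re_le_norm ⟪(x : E), H y⟫_ℂ)
      linarith)
    (fun c x => by
      rw [quadForm_smul, Real.sqrt_mul (sq_nonneg _), Real.sqrt_sq (norm_nonneg _)])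

theorem formSeminorm_apply (hs : H.IsFormalAdjoint H) (hp : ∀ f : H.domain, 0 ≤ quadForm H f)
    (x : H.domain) : formSeminorm hs hp x = √(quadForm H x) := rfl

theorem formSeminorm_sq (hs : H.IsFormalAdjoint H) (hp : ∀ f : H.domain, 0 ≤ quadForm H f)
    (x : H.domain) : formSeminorm hs hp x ^ 2 = quadForm H x := by
  rw [formSeminorm_apply, Real.sq_sqrt (hp x)]

theorem tendsto_quadForm_iff (hs : H.IsFormalAdjoint H) (hp : ∀ f : H.domain, 0 ≤ quadForm H f)
    {α : Type*} {l : Filter α} {u : α → H.domain} :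
    Tendsto (fun a => quadForm H (u a)) l (𝓝 0) ↔
      Tendsto (fun a => formSeminorm hs hp (u a)) l (𝓝 0) := by
  constructor
  · intro h
    simpa [formSeminorm_apply] using h.sqrt
  · intro h
    simpa [formSeminorm_sq] using h.pow 2

/-- The reverse triangle inequality for the form seminorm. -/
theorem tendsto_quadForm_of_sub (hs : H.IsFormalAdjoint H)
    (hp : ∀ f : H.domain, 0 ≤ quadForm H f) {α : Type*} {l : Filter α} {u v : α → H.domain} {b : ℝ}
    (hu : Tendsto (fun a => quadForm H (u a)) l (𝓝 b))
    (huv : Tendsto (fun a => quadForm H (u a - v a)) l (𝓝 0)) :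
    Tendsto (fun a => quadForm H (v a)) l (𝓝 b) := by
  by_cases hl : l = ⊥
  · simp [hl]
  have : l.NeBot := ⟨hl⟩
  have hb : 0 ≤ b := ge_of_tendsto' hu fun a => hp _
  have h1 : Tendsto (fun a => formSeminorm hs hp (u a)) l (𝓝 √b) := hu.sqrt
  have h2 := (tendsto_quadForm_iff hs hp).1 huv
  have h3 : Tendsto (fun a => formSeminorm hs hp (u a) - formSeminorm hs hp (v a)) l (𝓝 0) :=
    squeeze_zero_norm (fun a => abs_sub_map_le_sub (formSeminorm hs hp) (u a) (v a)) h2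
  have h4 := (h1.sub h3).pow 2
  simp only [sub_sub_cancel, sub_zero, Real.sq_sqrt hb, formSeminorm_sq] at h4
  exact h4

theorem quadForm_eq_of_le {T : E →ₗ.[ℂ] E} (h : S ≤ H) (h' : S ≤ T) {x : H.domain} {y : T.domain}
    (hxy : (x : E) = y) (hx : (x : E) ∈ S.domain) : quadForm H x = quadForm T y := by
  have e1 : S ⟨x, hx⟩ = H x := h.2 rfl
  have e2 : S ⟨x, hx⟩ = T y := h'.2 hxy
  rw [quadForm, quadForm, ← e1.symm.trans e2, hxy]

/-! ### Extremality criteria -/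

/-- If `D(S)` is a form core of `F` then `F` is above every positive extension of `S`. -/
theorem formLE_of_core {F : E →ₗ.[ℂ] E} (hF : S ≤ F) (hH : S ≤ H) (hs : F.IsFormalAdjoint F)
    (hp : ∀ f : F.domain, 0 ≤ quadForm F f)
    (happ : ∀ f : F.domain, ∃ u : ℕ → F.domain, (∀ n, (u n : E) ∈ S.domain) ∧
      Tendsto (fun n => (u n : E)) atTop (𝓝 f) ∧
      Tendsto (fun n => quadForm F (f - u n)) atTop (𝓝 0)) : FormLE H F := by
  rintro f b ⟨x, hx1, hx2, hx3⟩
  refine ⟨b, ?_, le_rfl⟩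
  -- Each `x n` is replaced by an element of `D(S)` that is `1/(n+1)`-close both in norm and in the
  -- form seminorm. On `D(S)` the forms of `F` and `H` agree, so the same sequence realizes the
  -- value `b` for `H`.
  have hch : ∀ n : ℕ, ∃ y : F.domain, (y : E) ∈ S.domain ∧ ‖(y : E) - x n‖ < 1 / ((n : ℝ) + 1) ∧
      formSeminorm hs hp (x n - y) < 1 / ((n : ℝ) + 1) := by
    intro n
    obtain ⟨u, hu, hu1, hu2⟩ := happ (x n)
    have hpos : (0 : ℝ) < 1 / ((n : ℝ) + 1) := Nat.one_div_pos_of_nat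
    have e1 := (tendsto_iff_norm_sub_tendsto_zero.1 hu1).eventually_lt_const hpos
    have e2 := ((tendsto_quadForm_iff hs hp).1 hu2).eventually_lt_const hpos
    obtain ⟨k, hk1, hk2⟩ := (e1.and e2).exists
    exact ⟨u k, hu k, hk1, hk2⟩
  choose y hyS hy1 hy2 using hch
  have t0 := tendsto_one_div_add_atTop_nhds_zero_nat (𝕜 := ℝ)
  have hy1' : Tendsto (fun n => (y n : E) - x n) atTop (𝓝 0) :=
    squeeze_zero_norm (fun n => (hy1 n).le) t0
  have hy2' : Tendsto (fun n => formSeminorm hs hp (x n - y n)) atTop (𝓝 0) :=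
    squeeze_zero (fun n => apply_nonneg _ _) (fun n => (hy2 n).le) t0
  have hyF : Tendsto (fun n => (y n : E)) atTop (𝓝 f) := by
    have := hy1'.add hx1
    simpa using this
  have hc : Tendsto (fun p : ℕ × ℕ => quadForm F (y p.1 - y p.2)) atTop (𝓝 0) := by
    rw [tendsto_quadForm_iff hs hp] at hx2 ⊢
    have tf : Tendsto (fun p : ℕ × ℕ => p.1) atTop atTop := by
      rw [← prod_atTop_atTop_eq]; exact tendsto_fst
    have ts : Tendsto (fun p : ℕ × ℕ => p.2) atTop atTop := by
      rw [← prod_atTop_atTop_eq]; exact tendsto_snd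
    have hsum := ((hy2'.comp tf).add hx2).add (hy2'.comp ts)
    rw [add_zero, add_zero] at hsum
    refine squeeze_zero (fun n => apply_nonneg _ _) (fun p => ?_) hsum
    have e : y p.1 - y p.2 = -(x p.1 - y p.1) + (x p.1 - x p.2) + (x p.2 - y p.2) := by abel
    rw [e]
    refine (map_add_le_add _ _ _).trans (add_le_add ((map_add_le_add _ _ _).trans ?_) le_rfl)
    rw [map_neg_eq_map]
    rfl
  have hq : Tendsto (fun n => quadForm F (y n)) atTop (𝓝 b) :=
    tendsto_quadForm_of_sub hs hp hx3 ((tendsto_quadForm_iff hs hp).2 hy2')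
  refine ⟨fun n => ⟨y n, hH.1 (hyS n)⟩, hyF, ?_, ?_⟩
  · refine hc.congr fun p => ?_
    exact quadForm_eq_of_le hF hH rfl (S.domain.sub_mem (hyS _) (hyS _))
  · exact hq.congr fun n => quadForm_eq_of_le hF hH rfl (hyS n)

/-- Positivity bounds `1 + εK` below on the complete graph, so its range is closed; a vector
orthogonal to the range is an eigenvector for `-1/ε`, which positivity excludes. -/
theorem exists_resolvent {K : E →ₗ.[ℂ] E} (hK : IsSelfAdjoint K)
    (hp : ∀ f : K.domain, 0 ≤ quadForm K f) {ε : ℝ} (hε : 0 < ε) (f : E) :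
    ∃ x : K.domain, (x : E) + (ε : ℂ) • K x = f := by
  have hd := hK.dense_domain
  have hcl : IsClosed (K.graph : Set (E × E)) := hK.isClosed
  have : CompleteSpace K.graph := hcl.completeSpace_coe
  let L : K.graph →L[ℂ] E := (ContinuousLinearMap.fst ℂ E E +
    (ε : ℂ) • ContinuousLinearMap.snd ℂ E E).comp K.graph.subtypeL
  have hLa : ∀ x : K.domain, L ⟨_, K.mem_graph x⟩ = (x : E) + (ε : ℂ) • K x := fun _ => rfl
  have hnorm : ∀ x : K.domain, ‖(x : E)‖ ^ 2 + ε ^ 2 * ‖K x‖ ^ 2 ≤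
      ‖(x : E) + (ε : ℂ) • K x‖ ^ 2 := by
    intro x
    have h := @norm_add_sq ℂ _ _ _ _ (x : E) ((ε : ℂ) • K x)
    rw [inner_smul_right, norm_smul] at h
    have h1 : RCLike.re ((ε : ℂ) * ⟪(x : E), K x⟫_ℂ) = ε * quadForm K x :=
      Complex.re_ofReal_mul _ _
    rw [h, h1, Complex.norm_real, Real.norm_of_nonneg hε.le]
    have := mul_nonneg hε.le (hp x)
    nlinarith
  have hanti : AntilipschitzWith (Real.toNNReal (1 + 1 / ε)) L := by
    refine ContinuousLinearMap.antilipschitz_of_bound L ?_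
    rintro ⟨⟨a, b⟩, hx⟩
    obtain ⟨x, rfl, rfl⟩ := (LinearPMap.mem_graph_iff K).1 hx
    have h := hnorm x
    have e0 : L ⟨((x : E), K x), hx⟩ = (x : E) + (ε : ℂ) • K x := rfl
    rw [e0]
    set N := ‖(x : E) + (ε : ℂ) • K x‖
    have hN : 0 ≤ N := norm_nonneg _
    change max ‖(x : E)‖ ‖K x‖ ≤ _
    rw [Real.coe_toNNReal _ (by positivity)]
    have a1 : ‖(x : E)‖ ≤ N := by
      refine (abs_le_of_sq_le_sq' ?_ hN).2
      nlinarith [sq_nonneg (ε * ‖K x‖)]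
    have a2 : ε * ‖K x‖ ≤ N := by
      refine (abs_le_of_sq_le_sq' ?_ hN).2
      nlinarith [sq_nonneg ‖(x : E)‖]
    have a3 : ‖K x‖ ≤ 1 / ε * N := by
      rw [one_div, ← div_eq_inv_mul, le_div_iff₀ hε]; linarith
    have a4 : 0 ≤ 1 / ε * N := by positivity
    rw [add_mul, one_mul]
    exact max_le (by linarith) (by linarith)
  have hclosed := hanti.isClosed_range L.uniformContinuous
  have hrange : (LinearMap.range L.toLinearMap) = ⊤ := by
    have hc : IsClosed ((LinearMap.range L.toLinearMap : Submodule ℂ E) : Set E) := hclosed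
    have : CompleteSpace (LinearMap.range L.toLinearMap) := hc.completeSpace_coe
    rw [← Submodule.orthogonal_eq_bot_iff, Submodule.eq_bot_iff]
    intro n hn
    have hn' : ∀ x : K.domain, ⟪n, (x : E)⟫_ℂ + (ε : ℂ) * ⟪n, K x⟫_ℂ = 0 := by
      intro x
      have := (Submodule.mem_orthogonal' _ n).1 hn _ ⟨⟨_, K.mem_graph x⟩, rfl⟩
      change ⟪n, (x : E) + (ε : ℂ) • K x⟫_ℂ = 0 at this
      rwa [inner_add_right, inner_smul_right] at this
    have hε' : (ε : ℂ) ≠ 0 := by exact_mod_cast hε.ne'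
    have hg : (n, (-(ε : ℂ)⁻¹) • n) ∈ K.graph := by
      have h : (n, (-(ε : ℂ)⁻¹) • n) ∈ K.adjoint.graph := by
        rw [mem_graph_adjoint_iff hd]
        intro a b hab
        obtain ⟨x, rfl, rfl⟩ := (LinearPMap.mem_graph_iff K).1 hab
        rw [inner_smul_left]
        have := hn' x
        simp only [map_neg, map_inv₀, Complex.conj_ofReal]
        field_simp
        linear_combination -this
      rwa [LinearPMap.isSelfAdjoint_def.1 hK] at h
    obtain ⟨x, hx1, hx2⟩ := (LinearPMap.mem_graph_iff K).1 hg
    have h := hp x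
    simp only at hx1 hx2
    rw [quadForm, hx1, hx2, inner_smul_right, inner_self_eq_norm_sq_to_K] at h
    have e : (-(ε : ℂ)⁻¹ * ((‖n‖ : ℂ)) ^ 2).re = -(ε⁻¹ * ‖n‖ ^ 2) := by
      rw [← Complex.ofReal_inv, ← Complex.ofReal_pow, ← Complex.ofReal_neg, ← Complex.ofReal_mul,
        Complex.ofReal_re]
      ring
    have h' : 0 ≤ (-(ε : ℂ)⁻¹ * ((‖n‖ : ℂ)) ^ 2).re := h
    rw [e] at h'
    have : ‖n‖ ^ 2 ≤ 0 := by
      by_contra hcon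
      push Not at hcon
      have := mul_pos (inv_pos.2 hε) hcon
      linarith
    have : ‖n‖ = 0 := by nlinarith [norm_nonneg n]
    exact norm_eq_zero.1 this
  have hf : f ∈ LinearMap.range L.toLinearMap := hrange ▸ Submodule.mem_top
  obtain ⟨⟨⟨a, b⟩, hab⟩, hx⟩ := hf
  obtain ⟨x, rfl, rfl⟩ := (LinearPMap.mem_graph_iff K).1 hab
  exact ⟨x, hx⟩

/-- A vector `f` with `|⟨f, K k⟩|² ≤ b ⟨k, K k⟩` for all `k` is in the form domain of `K`. -/
theorem exists_isFormValue_of_bound {K : E →ₗ.[ℂ] E} (hK : IsSelfAdjoint K)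
    (hp : ∀ f : K.domain, 0 ≤ quadForm K f) {f : E} {b : ℝ} (hb : 0 ≤ b)
    (hbd : ∀ k : K.domain, ‖⟪f, K k⟫_ℂ‖ ^ 2 ≤ b * quadForm K k) :
    ∃ a, IsFormValue K f a ∧ a ≤ b := by
  have hs : K.IsFormalAdjoint K := by
    have := LinearPMap.adjoint_isFormalAdjoint hK.dense_domain
    rwa [LinearPMap.isSelfAdjoint_def.1 hK] at this
  have hε : ∀ n : ℕ, (0 : ℝ) < 1 / ((n : ℝ) + 1) := fun n => Nat.one_div_pos_of_nat
  -- The regularizations `x n = (1 + εK)⁻¹ f` with `ε = 1/(n+1)` are the sequence that realizes the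
  -- form value; no square root of `K` is needed.
  choose x hx using fun n : ℕ => exists_resolvent hK hp (hε n) f
  have h1 : ∀ n, (⟪f, K (x n)⟫_ℂ).re = quadForm K (x n) + 1 / ((n : ℝ) + 1) * ‖K (x n)‖ ^ 2 := by
    intro n
    conv_lhs => rw [← hx n]
    rw [inner_add_left, inner_smul_left, Complex.conj_ofReal, Complex.add_re,
      Complex.re_ofReal_mul, quadForm]
    congr 2
    exact inner_self_eq_norm_sq (𝕜 := ℂ) (K (x n))
  -- With `Q` the form at `x n` and `R = ε‖K x n‖²`, the real part of `⟨f, K x n⟩` is `Q + R`, and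
  -- the hypothesis gives `(Q + R)² ≤ bQ ≤ b(Q + R)`.
  have h2 : ∀ n, quadForm K (x n) + 1 / ((n : ℝ) + 1) * ‖K (x n)‖ ^ 2 ≤ b := by
    intro n
    have e1 := hbd (x n)
    have e2 := Complex.re_le_norm ⟪f, K (x n)⟫_ℂ
    rw [h1 n] at e2
    set Q := quadForm K (x n)
    have hQ : 0 ≤ Q := hp _
    have hR : 0 ≤ 1 / ((n : ℝ) + 1) * ‖K (x n)‖ ^ 2 := by positivity
    set R := 1 / ((n : ℝ) + 1) * ‖K (x n)‖ ^ 2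
    have e3 : (Q + R) ^ 2 ≤ b * Q := le_trans (by gcongr) e1
    by_contra hcon
    push Not at hcon
    nlinarith
  have hbq : ∀ n, quadForm K (x n) ≤ b := fun n => by
    have := h2 n
    have : 0 ≤ 1 / ((n : ℝ) + 1) * ‖K (x n)‖ ^ 2 := by positivity
    linarith
  -- The form distance is bounded by the increment of the form values. These are then monotone and
  -- bounded by `b`, so the sequence is Cauchy for the form.
  have hcross : ∀ n m, n ≤ m → quadForm K (x n - x m) ≤ quadForm K (x m) - quadForm K (x n) := by
    intro n m hnm
    have hδε : 1 / ((m : ℝ) + 1) ≤ 1 / ((n : ℝ) + 1) := by gcongr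
    have hδ := hε m
    set δ := 1 / ((m : ℝ) + 1)
    set ε := 1 / ((n : ℝ) + 1)
    have e0 : ((x m - x n : K.domain) : E) = (ε : ℂ) • K (x n) - (δ : ℂ) • K (x m) := by
      have a1 := hx n
      have a2 := hx m
      rw [← a1] at a2
      rw [Submodule.coe_sub, sub_eq_sub_iff_add_eq_add]
      rw [a2]; abel
    have eK : K (x m - x n) = K (x m) - K (x n) := K.map_sub _ _
    have hpos := hp (x m - x n)
    rw [quadForm, e0, eK] at hpos
    set y := K (x n)
    set z := K (x m)
    have hC : (⟪z, y⟫_ℂ).re = (⟪y, z⟫_ℂ).re := by rw [← inner_conj_symm, Complex.conj_re]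
    have hyy : (⟪y, y⟫_ℂ).re = ‖y‖ ^ 2 := inner_self_eq_norm_sq (𝕜 := ℂ) y
    have hzz : (⟪z, z⟫_ℂ).re = ‖z‖ ^ 2 := inner_self_eq_norm_sq (𝕜 := ℂ) z
    simp only [inner_sub_left, inner_sub_right, inner_smul_left, Complex.conj_ofReal,
      Complex.sub_re, Complex.re_ofReal_mul, hC, hyy, hzz] at hpos
    have hCle : (⟪y, z⟫_ℂ).re ≤ ‖y‖ * ‖z‖ :=
      (Complex.re_le_norm _).trans (norm_inner_le_norm _ _)
    have hkey : 0 ≤ (⟪(x n : E), z - y⟫_ℂ).re := by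
      have e : ⟪(x n : E), z - y⟫_ℂ = ⟪y, ((x m - x n : K.domain) : E)⟫_ℂ := by
        rw [← eK]; exact (hs _ _).symm
      rw [e, e0, inner_sub_right, inner_smul_right, inner_smul_right, Complex.sub_re,
        Complex.re_ofReal_mul, Complex.re_ofReal_mul, hyy]
      have hεpos : 0 < ε := hε n
      -- Here `ε‖y‖ = ‖f - x n‖` and `δ‖z‖ = ‖f - x m‖`: the distance to `f` decreases with the
      -- parameter. Failure would give `‖y‖ < ‖z‖` and contradict positivity of the form at `x m - x
      -- n`.
      have hab : δ * ‖z‖ ≤ ε * ‖y‖ := by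
        by_contra hcon
        push Not at hcon
        have hlt : ‖y‖ < ‖z‖ := by
          by_contra h'
          push Not at h'
          have := mul_le_mul hδε h' (norm_nonneg z) hεpos.le
          linarith
        have p1 := mul_pos (sub_pos.2 hlt) (sub_pos.2 hcon)
        nlinarith [mul_le_mul_of_nonneg_left hCle (add_pos hεpos hδ).le]
      nlinarith [mul_le_mul_of_nonneg_left hCle hδ.le,
        mul_le_mul_of_nonneg_left hab (norm_nonneg y)]
    rw [quadForm_sub hs]
    have : (⟪(x n : E), z⟫_ℂ).re = (⟪(x n : E), z - y⟫_ℂ).re + quadForm K (x n) := by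
      rw [inner_sub_right, Complex.sub_re, quadForm]; ring
    change quadForm K (x n) + quadForm K (x m) - 2 * (⟪(x n : E), z⟫_ℂ).re ≤ _
    linarith
  have hmono : Monotone fun n => quadForm K (x n) := by
    intro n m hnm
    have := hcross n m hnm
    have := hp (x n - x m)
    simp only
    linarith
  have hbdd : BddAbove (Set.range fun n => quadForm K (x n)) := ⟨b, by
    rintro _ ⟨n, rfl⟩; exact hbq n⟩
  have hlim := tendsto_atTop_ciSup hmono hbdd
  set a := ⨆ n, quadForm K (x n)
  refine ⟨a, ⟨x, ?_, ?_, hlim⟩, ciSup_le hbq⟩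
  · have : Tendsto (fun n => (x n : E) - f) atTop (𝓝 0) := by
      have t0 : Tendsto (fun n : ℕ => √(1 / ((n : ℝ) + 1) * b)) atTop (𝓝 0) := by
        have := (tendsto_one_div_add_atTop_nhds_zero_nat (𝕜 := ℝ)).mul_const b
        rw [zero_mul] at this
        simpa using this.sqrt
      refine squeeze_zero_norm (fun n => ?_) t0
      refine Real.le_sqrt_of_sq_le ?_
      have e : (x n : E) - f = -(((1 / ((n : ℝ) + 1) : ℝ) : ℂ) • K (x n)) := by
        conv_lhs => rw [← hx n]
        abel
      rw [e, norm_neg, norm_smul, Complex.norm_real, Real.norm_of_nonneg (hε n).le, mul_pow, sq,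
        mul_assoc]
      refine mul_le_mul_of_nonneg_left ?_ (hε n).le
      have := h2 n
      have := hp (x n)
      linarith
    have := this.add_const f
    simpa using this
  · have tf : Tendsto (fun p : ℕ × ℕ => p.1) atTop atTop := by
      rw [← prod_atTop_atTop_eq]; exact tendsto_fst
    have ts : Tendsto (fun p : ℕ × ℕ => p.2) atTop atTop := by
      rw [← prod_atTop_atTop_eq]; exact tendsto_snd
    have h := ((hlim.comp tf).sub (hlim.comp ts)).abs
    rw [sub_self, abs_zero] at h
    refine squeeze_zero (fun p => hp _) (fun p => ?_) h
    rcases le_total p.1 p.2 with hle | hle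
    · refine (hcross _ _ hle).trans ?_
      rw [abs_sub_comm]
      exact le_abs_self _
    · have e : x p.1 - x p.2 = -(x p.2 - x p.1) := by abel
      rw [e, quadForm_neg]
      exact (hcross _ _ hle).trans (le_abs_self _)

/-- If `D(S)` is dense in `D(K)` for the form of `K`, with convergence of the images under `K`,
then `K` is below every positive extension of `S`. -/
theorem formLE_of_krein_core {K : E →ₗ.[ℂ] E} (hK : IsSelfAdjoint K)
    (hp : ∀ f : K.domain, 0 ≤ quadForm K f) (hSK : S ≤ K) (hSH : S ≤ H)
    (hs : H.IsFormalAdjoint H) (hpH : ∀ f : H.domain, 0 ≤ quadForm H f)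
    (happ : ∀ k : K.domain, ∃ u : ℕ → K.domain, (∀ n, (u n : E) ∈ S.domain) ∧
      Tendsto (fun n => K (u n)) atTop (𝓝 (K k)) ∧
      Tendsto (fun n => quadForm K (k - u n)) atTop (𝓝 0)) : FormLE K H := by
  rintro f b ⟨x, hx1, -, hx3⟩
  have hsK : K.IsFormalAdjoint K := by
    have := LinearPMap.adjoint_isFormalAdjoint hK.dense_domain
    rwa [LinearPMap.isSelfAdjoint_def.1 hK] at this
  have hb : 0 ≤ b := ge_of_tendsto' hx3 fun n => hpH _
  -- For `k` in `D(S)` the operators `K` and `H` agree, and the bound is the limit of Cauchy–Schwarz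
  -- for the form of `H` along `x m → f`. The approximation hypothesis carries it to every `k` in
  -- `D(K)`.
  refine exists_isFormValue_of_bound hK hp hb fun k => ?_
  obtain ⟨u, hu, hu1, hu2⟩ := happ k
  have hq : Tendsto (fun n => quadForm K (u n)) atTop (𝓝 (quadForm K k)) :=
    tendsto_quadForm_of_sub hsK hp tendsto_const_nhds hu2
  have hl : Tendsto (fun n => ‖⟪f, K (u n)⟫_ℂ‖ ^ 2) atTop (𝓝 (‖⟪f, K k⟫_ℂ‖ ^ 2)) :=
    ((tendsto_const_nhds.inner hu1).norm).pow 2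
  refine le_of_tendsto_of_tendsto' hl (hq.const_mul b) fun n => ?_
  set y : H.domain := ⟨u n, hSH.1 (hu n)⟩
  have e : H y = K (u n) := by
    have e1 : S ⟨u n, hu n⟩ = K (u n) := hSK.2 rfl
    have e2 : S ⟨u n, hu n⟩ = H y := hSH.2 rfl
    rw [← e1, e2]
  have e' : quadForm H y = quadForm K (u n) := by
    rw [quadForm, quadForm, e]
  have hl2 : Tendsto (fun m => ‖⟪(x m : E), K (u n)⟫_ℂ‖ ^ 2) atTop (𝓝 (‖⟪f, K (u n)⟫_ℂ‖ ^ 2)) :=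
    ((hx1.inner tendsto_const_nhds).norm).pow 2
  refine le_of_tendsto_of_tendsto' hl2 (hx3.mul_const _) fun m => ?_
  rw [← e, ← e']
  exact norm_inner_sq_le hs hpH _ _

/-! ### Extensions by finitely many approximable vectors -/

variable {ι : Type*} [Fintype ι]

/-- Induction on the number of extra vectors: replacing `c i • w i` by `c i • (w i - v i n)`, which
lies in `D(S)`, changes the form of `x` by an amount tending to `0`. -/
theorem quadForm_nonneg_of_approx (hs : H.IsFormalAdjoint H) (w : ι → H.domain)
    (v : ι → ℕ → H.domain)
    (hspan : ∀ x : H.domain, ∃ c : ι → ℂ, ((x - ∑ i, c i • w i : H.domain) : E) ∈ S.domain)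
    (hw : ∀ i n, ((w i - v i n : H.domain) : E) ∈ S.domain)
    (hpos : ∀ x : H.domain, (x : E) ∈ S.domain → 0 ≤ quadForm H x)
    (hv1 : ∀ i (x : H.domain), Tendsto (fun n => ⟪(x : E), H (v i n)⟫_ℂ) atTop (𝓝 0))
    (hv2 : ∀ i, Tendsto (fun n => quadForm H (v i n)) atTop (𝓝 0)) (f : H.domain) :
    0 ≤ quadForm H f := by
  classical
  have key : ∀ t : Finset ι, ∀ x : H.domain,
      (∃ c : ι → ℂ, ((x - ∑ i ∈ t, c i • w i : H.domain) : E) ∈ S.domain) → 0 ≤ quadForm H x := by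
    intro t
    induction t using Finset.induction_on with
    | empty =>
      rintro x ⟨c, hc⟩
      rw [Finset.sum_empty, sub_zero] at hc
      exact hpos x hc
    | insert i t hi ih =>
      rintro x ⟨c, hc⟩
      rw [Finset.sum_insert hi] at hc
      have h1 : ∀ n, 0 ≤ quadForm H (x - c i • v i n) := by
        intro n
        refine ih _ ⟨c, ?_⟩
        have e : x - c i • v i n - ∑ j ∈ t, c j • w j =
            (x - (c i • w i + ∑ j ∈ t, c j • w j)) + c i • (w i - v i n) := by
          rw [smul_sub]; abel
        rw [e, Submodule.coe_add]
        exact S.domain.add_mem hc (S.domain.smul_mem (c i) (hw i n))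
      have h2 : Tendsto (fun n => quadForm H (x - c i • v i n)) atTop (𝓝 (quadForm H x)) := by
        have e : ∀ n, quadForm H (x - c i • v i n) = quadForm H x +
            ‖c i‖ ^ 2 * quadForm H (v i n) - 2 * (c i * ⟪(x : E), H (v i n)⟫_ℂ).re := by
          intro n
          rw [quadForm_sub hs, quadForm_smul, LinearPMap.map_smul, inner_smul_right]
        simp only [e]
        have t1 := (hv2 i).const_mul (‖c i‖ ^ 2)
        have t2 := (Complex.continuous_re.tendsto _).comp ((hv1 i x).const_mul (c i))
        have t3 := (t1.const_add (quadForm H x)).sub (t2.const_mul 2)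
        simpa using t3
      exact ge_of_tendsto' h2 h1
  exact key Finset.univ f (hspan f)

theorem tendsto_formSeminorm_sum (hs : H.IsFormalAdjoint H)
    (hp : ∀ f : H.domain, 0 ≤ quadForm H f) (v : ι → ℕ → H.domain)
    (hv2 : ∀ i, Tendsto (fun n => quadForm H (v i n)) atTop (𝓝 0)) (c : ι → ℂ) :
    Tendsto (fun n => quadForm H (∑ i, c i • v i n)) atTop (𝓝 0) := by
  rw [tendsto_quadForm_iff hs hp]
  have h : Tendsto (fun n => ∑ i, ‖c i‖ * formSeminorm hs hp (v i n)) atTop (𝓝 0) := by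
    have := tendsto_finsetSum (Finset.univ : Finset ι)
      fun i _ => ((tendsto_quadForm_iff hs hp).1 (hv2 i)).const_mul ‖c i‖
    simpa using this
  refine squeeze_zero (fun n => apply_nonneg _ _) (fun n => ?_) h
  refine (Finset.le_sum_of_subadditive (formSeminorm hs hp) (map_zero _).le (map_add_le_add _) _ _).trans ?_
  simp only [map_smul_eq_mul]
  rfl

/-- The extra vectors are congruent modulo `D(S)` to vectors that are small in norm and in energy,
which makes `D(S)` a form core. -/
theorem isFriedrichsExtension_of_approx (hSH : S ≤ H) (hsa : IsSelfAdjoint H) (w : ι → H.domain)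
    (v : ι → ℕ → H.domain)
    (hspan : ∀ x : H.domain, ∃ c : ι → ℂ, ((x - ∑ i, c i • w i : H.domain) : E) ∈ S.domain)
    (hw : ∀ i n, ((w i - v i n : H.domain) : E) ∈ S.domain)
    (hpos : ∀ x : S.domain, 0 ≤ quadForm S x)
    (hv1 : ∀ i, Tendsto (fun n => (v i n : E)) atTop (𝓝 0))
    (hv2 : ∀ i, Tendsto (fun n => quadForm H (v i n)) atTop (𝓝 0)) :
    IsFriedrichsExtension S H := by
  have hs : H.IsFormalAdjoint H := by
    have := LinearPMap.adjoint_isFormalAdjoint hsa.dense_domain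
    rwa [LinearPMap.isSelfAdjoint_def.1 hsa] at this
  have hp : ∀ f : H.domain, 0 ≤ quadForm H f := by
    refine quadForm_nonneg_of_approx hs w v hspan hw ?_ ?_ hv2
    · intro x hx
      rw [quadForm_eq_of_le hSH le_rfl (y := ⟨x, hx⟩) rfl hx]
      exact hpos _
    · intro i x
      simp only [← hs x]
      simpa using (tendsto_const_nhds (x := H x)).inner (𝕜 := ℂ) (hv1 i)
  refine ⟨⟨⟨hSH, hsa⟩, hp⟩, fun G hG => formLE_of_core hSH hG.1.1 hs hp fun f => ?_⟩
  obtain ⟨c, hc⟩ := hspan f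
  refine ⟨fun n => f - ∑ i, c i • v i n, fun n => ?_, ?_, ?_⟩
  · have e : f - ∑ i, c i • v i n = (f - ∑ i, c i • w i) + ∑ i, c i • (w i - v i n) := by
      simp only [smul_sub, Finset.sum_sub_distrib]; abel
    change ((f - ∑ i, c i • v i n : H.domain) : E) ∈ S.domain
    rw [e, Submodule.coe_add]
    refine S.domain.add_mem hc ?_
    rw [Submodule.coe_sum]
    exact S.domain.sum_mem fun i _ => S.domain.smul_mem (c i) (hw i n)
  · have h := tendsto_finsetSum (Finset.univ : Finset ι) fun i _ => (hv1 i).const_smul (c i)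
    have h' := (tendsto_const_nhds (x := (f : E))).sub h
    simpa [Submodule.coe_sum] using h'
  · simp only [sub_sub_cancel]
    exact tendsto_formSeminorm_sum hs hp v hv2 c

/-- The counterpart of the Friedrichs criterion, with smallness of the image under `H` in place of
smallness of the vector itself. -/
theorem isKreinExtension_of_approx (hSH : S ≤ H) (hsa : IsSelfAdjoint H) (w : ι → H.domain)
    (v : ι → ℕ → H.domain)
    (hspan : ∀ x : H.domain, ∃ c : ι → ℂ, ((x - ∑ i, c i • w i : H.domain) : E) ∈ S.domain)
    (hw : ∀ i n, ((w i - v i n : H.domain) : E) ∈ S.domain)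
    (hpos : ∀ x : S.domain, 0 ≤ quadForm S x)
    (hv1 : ∀ i, Tendsto (fun n => H (v i n)) atTop (𝓝 0))
    (hv2 : ∀ i, Tendsto (fun n => quadForm H (v i n)) atTop (𝓝 0)) :
    IsKreinExtension S H := by
  have hs : H.IsFormalAdjoint H := by
    have := LinearPMap.adjoint_isFormalAdjoint hsa.dense_domain
    rwa [LinearPMap.isSelfAdjoint_def.1 hsa] at this
  have hp : ∀ f : H.domain, 0 ≤ quadForm H f := by
    refine quadForm_nonneg_of_approx hs w v hspan hw ?_ ?_ hv2
    · intro x hx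
      rw [quadForm_eq_of_le hSH le_rfl (y := ⟨x, hx⟩) rfl hx]
      exact hpos _
    · intro i x
      simpa using (tendsto_const_nhds (x := (x : E))).inner (𝕜 := ℂ) (hv1 i)
  refine ⟨⟨⟨hSH, hsa⟩, hp⟩, fun G hG => ?_⟩
  have hsG : G.IsFormalAdjoint G := by
    have := LinearPMap.adjoint_isFormalAdjoint hG.1.2.dense_domain
    rwa [LinearPMap.isSelfAdjoint_def.1 hG.1.2] at this
  refine formLE_of_krein_core hsa hp hSH hG.1.1 hsG hG.2 fun f => ?_
  obtain ⟨c, hc⟩ := hspan f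
  refine ⟨fun n => f - ∑ i, c i • v i n, fun n => ?_, ?_, ?_⟩
  · have e : f - ∑ i, c i • v i n = (f - ∑ i, c i • w i) + ∑ i, c i • (w i - v i n) := by
      simp only [smul_sub, Finset.sum_sub_distrib]; abel
    change ((f - ∑ i, c i • v i n : H.domain) : E) ∈ S.domain
    rw [e, Submodule.coe_add]
    refine S.domain.add_mem hc ?_
    rw [Submodule.coe_sum]
    exact S.domain.sum_mem fun i _ => S.domain.smul_mem (c i) (hw i n)
  · have h := tendsto_finsetSum (Finset.univ : Finset ι) fun i _ => (hv1 i).const_smul (c i)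
    have h' := (tendsto_const_nhds (x := H f)).sub h
    have e : ∀ n, H (f - ∑ i, c i • v i n) = H f - ∑ i, c i • H (v i n) := by
      intro n
      rw [LinearPMap.map_sub]
      congr 1
      change H.toFun _ = ∑ i, c i • H.toFun _
      rw [map_sum]
      simp only [map_smul]
    simp only [e]
    simpa using h'
  · simp only [sub_sub_cancel]
    exact tendsto_formSeminorm_sum hs hp v hv2 c

end Forms

/-! ### Operators intertwined by isometries -/

section Intertwining

variable {E : Type*} [NormedAddCommGroup E] [InnerProductSpace ℂ E] [CompleteSpace E]

/-- The graph of `T` is invariant under `(a, b) ↦ (U a, c U b)`, that is `T U ⊇ c U T`. -/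
def Intertwines (U : E → E) (c : ℂ) (T : E →ₗ.[ℂ] E) : Prop :=
  ∀ a b, (a, b) ∈ T.graph → (U a, c • U b) ∈ T.graph

theorem Intertwines.closure {U : E → E} {c : ℂ} {T : E →ₗ.[ℂ] E} (hU : Continuous U)
    (hT : T.IsClosable) (h : Intertwines U c T) : Intertwines U c T.closure := by
  intro a b hab
  have hcont : Continuous fun p : E × E => (U p.1, c • U p.2) := by fun_prop
  rw [← hT.graph_closure_eq_closure_graph] at hab ⊢
  exact map_mem_closure (f := fun p : E × E => (U p.1, c • U p.2)) hcont hab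
    fun p hp => h p.1 p.2 hp

theorem Intertwines.adjoint {U V : E →ₗᵢ[ℂ] E} (hUV : ∀ x, U (V x) = x) {c : ℝ} (hc : c ≠ 0)
    {T : E →ₗ.[ℂ] E} (hd : Dense (T.domain : Set E)) (h : Intertwines V (c : ℂ)⁻¹ T) :
    Intertwines U (c : ℂ) T.adjoint := by
  intro y w hyw
  rw [mem_graph_adjoint_iff hd] at hyw ⊢
  intro a b hab
  have hadj : ∀ x z : E, ⟪U x, z⟫_ℂ = ⟪x, V z⟫_ℂ := fun x z => by
    conv_lhs => rw [← hUV z]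
    exact U.inner_map_map _ _
  have h1 := hyw _ _ (h a b hab)
  have hc' : (c : ℂ) ≠ 0 := by exact_mod_cast hc
  rw [inner_smul_left, hadj, hadj, h1, inner_smul_right, Complex.conj_ofReal,
    mul_inv_cancel_left₀ hc']

end Intertwining

/-! ### Test functions -/

theorem inner_toLp (F : L2) {g : ℂ → ℂ} (hg : MemLp g 2 volume) :
    ⟪F, hg.toLp g⟫_ℂ = ∫ z, (starRingEnd ℂ) (F z) * g z := by
  rw [L2.inner_def]
  refine integral_congr_ae ?_
  filter_upwards [hg.coeFn_toLp] with z hz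
  rw [hz, RCLike.inner_apply, mul_comm]

theorem inner_toLp_toLp {f g : ℂ → ℂ} (hf : MemLp f 2 volume) (hg : MemLp g 2 volume) :
    ⟪hf.toLp f, hg.toLp g⟫_ℂ = ∫ z, (starRingEnd ℂ) (f z) * g z := by
  rw [inner_toLp]
  refine integral_congr_ae ?_
  filter_upwards [hf.coeFn_toLp] with z hz
  rw [hz]

theorem inner_testToL2 (φ ψ : testFunctions) :
    ⟪testToL2 φ, testToL2 ψ⟫_ℂ = ∫ z, (starRingEnd ℂ) (φ.1 z) * ψ.1 z :=
  inner_toLp_toLp (memLp_testFunction φ) (memLp_testFunction ψ)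

theorem integrable_conj_mul {f g : ℂ → ℂ} (hf : Continuous f) (hg : Continuous g)
    (hgc : HasCompactSupport g) : Integrable fun z => (starRingEnd ℂ) (f z) * g z :=
  ((Complex.continuous_conj.comp hf).mul hg).integrable_of_hasCompactSupport hgc.mul_left

/-- Integration by parts. The potential is singular only at the origin, away from which the test
functions are supported. -/
theorem inner_covDeriv (v : ℂ) (a : ℂ → ℝ) (ha : ∀ z, z ≠ 0 → ContDiffAt ℝ ∞ a z)
    (φ ψ : testFunctions) :
    ⟪testToL2 (covDerivₗ v a ha φ), testToL2 ψ⟫_ℂ =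
      ⟪testToL2 φ, testToL2 (covDerivₗ v a ha ψ)⟫_ℂ := by
  rw [inner_testToL2, inner_testToL2]
  change ∫ z, (starRingEnd ℂ) (covDeriv v a φ.1 z) * ψ.1 z =
    ∫ z, (starRingEnd ℂ) (φ.1 z) * covDeriv v a ψ.1 z
  have hφ1 : Differentiable ℝ φ.1 := φ.2.1.differentiable (by simp)
  have hψ1 : Differentiable ℝ ψ.1 := ψ.2.1.differentiable (by simp)
  have hconj : ∀ z, fderiv ℝ (fun w => (starRingEnd ℂ) (φ.1 w)) z v =
      (starRingEnd ℂ) (fderiv ℝ φ.1 z v) := by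
    intro z
    have h : HasFDerivAt (fun w => (starRingEnd ℂ) (φ.1 w))
        ((Complex.conjCLE : ℂ →L[ℝ] ℂ).comp (fderiv ℝ φ.1 z)) z :=
      (Complex.conjCLE : ℂ →L[ℝ] ℂ).hasFDerivAt.comp z (hφ1 z).hasFDerivAt
    rw [h.fderiv]
    rfl
  have hcφ : Continuous fun z => fderiv ℝ φ.1 z v :=
    (φ.2.1.continuous_fderiv (by simp)).clm_apply continuous_const
  have hcψ : Continuous fun z => fderiv ℝ ψ.1 z v :=
    (ψ.2.1.continuous_fderiv (by simp)).clm_apply continuous_const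
  have hsψ : HasCompactSupport fun z => fderiv ℝ ψ.1 z v :=
    ψ.2.2.1.fderiv_apply (𝕜 := ℝ) v
  have i1 : Integrable fun z => (starRingEnd ℂ) (fderiv ℝ φ.1 z v) * ψ.1 z :=
    integrable_conj_mul hcφ ψ.2.1.continuous ψ.2.2.1
  have i2 : Integrable fun z => (starRingEnd ℂ) (φ.1 z) * fderiv ℝ ψ.1 z v :=
    integrable_conj_mul φ.2.1.continuous hcψ hsψ
  have i3 : Integrable fun z => (starRingEnd ℂ) (φ.1 z) * ψ.1 z :=
    integrable_conj_mul φ.2.1.continuous ψ.2.1.continuous ψ.2.2.1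
  have hibp := integral_mul_fderiv_eq_neg_fderiv_mul_of_integrable (μ := (volume : Measure ℂ))
    (f := fun w => (starRingEnd ℂ) (φ.1 w)) (g := ψ.1) (v := v)
    (by simpa only [hconj] using i1) i2 i3
    (fun z _ => (Complex.conjCLE : ℂ →L[ℝ] ℂ).differentiableAt.comp z (hφ1 z))
    (fun z _ => hψ1 z)
  simp only [hconj] at hibp
  have i4 : Integrable fun z => (starRingEnd ℂ) (φ.1 z) * covDeriv v a ψ.1 z :=
    integrable_conj_mul φ.2.1.continuous (covDeriv_mem v ha ψ.2).1.continuous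
      (covDeriv_mem v ha ψ.2).2.1
  -- The potential need not be continuous at the origin, so its term is recovered as a difference of
  -- two integrable ones.
  have i5 : Integrable fun z => (starRingEnd ℂ) (φ.1 z) * (a z * ψ.1 z) := by
    have := i4.add (i2.const_mul Complex.I)
    refine this.congr (ae_of_all _ fun z => ?_)
    simp only [covDeriv, Pi.add_apply]
    ring
  have e1 : ∀ z, (starRingEnd ℂ) (covDeriv v a φ.1 z) * ψ.1 z =
      Complex.I * ((starRingEnd ℂ) (fderiv ℝ φ.1 z v) * ψ.1 z) +
        (starRingEnd ℂ) (φ.1 z) * (a z * ψ.1 z) := by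
    intro z
    simp only [covDeriv, map_add, map_mul, map_neg, Complex.conj_I, Complex.conj_ofReal]
    ring
  have e2 : ∀ z, (starRingEnd ℂ) (φ.1 z) * covDeriv v a ψ.1 z =
      -Complex.I * ((starRingEnd ℂ) (φ.1 z) * fderiv ℝ ψ.1 z v) +
        (starRingEnd ℂ) (φ.1 z) * (a z * ψ.1 z) := by
    intro z
    simp only [covDeriv]
    ring
  simp only [e1, e2]
  rw [integral_add (i1.const_mul _) i5, integral_add (i2.const_mul _) i5, integral_const_mul,
    integral_const_mul, hibp]
  ring

/-- `-i ∂_x - λ y / r²` on test functions. -/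
abbrev DX (lam : ℝ) : testFunctions →ₗ[ℂ] testFunctions :=
  covDerivₗ 1 (coeffX lam) (contDiffAt_coeffX lam)

/-- `-i ∂_y + λ x / r²` on test functions. -/
abbrev DY (lam : ℝ) : testFunctions →ₗ[ℂ] testFunctions :=
  covDerivₗ Complex.I (coeffY lam) (contDiffAt_coeffY lam)

theorem formalOperator_apply (lam : ℝ) (φ : testFunctions) :
    formalOperator lam φ = DX lam (DX lam φ) + DY lam (DY lam φ) := rfl

theorem inner_formalOperator (lam : ℝ) (φ ψ : testFunctions) :
    ⟪testToL2 (formalOperator lam φ), testToL2 ψ⟫_ℂ =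
      ⟪testToL2 φ, testToL2 (formalOperator lam ψ)⟫_ℂ := by
  simp only [formalOperator_apply, map_add, inner_add_left, inner_add_right, inner_covDeriv]

theorem inner_formalOperator_self (lam : ℝ) (φ : testFunctions) :
    0 ≤ (⟪testToL2 φ, testToL2 (formalOperator lam φ)⟫_ℂ).re := by
  rw [formalOperator_apply, map_add, inner_add_right, Complex.add_re,
    ← inner_covDeriv _ _ _ φ, ← inner_covDeriv _ _ _ φ]
  exact add_nonneg (inner_self_nonneg (𝕜 := ℂ)) (inner_self_nonneg (𝕜 := ℂ))

theorem mem_preOperator_graph (lam : ℝ) {a b : L2} :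
    (a, b) ∈ (preOperator lam).graph ↔
      ∃ φ, a = testToL2 φ ∧ b = testToL2 (formalOperator lam φ) := by
  rw [LinearPMap.mem_graph_iff]
  have h : ∀ φ (h : testToL2 φ ∈ LinearMap.range testToL2),
      preOperator lam ⟨testToL2 φ, h⟩ = testToL2 (formalOperator lam φ) := by
    intro φ h
    change testToL2 (formalOperator lam ((LinearEquiv.ofInjective testToL2
      testToL2_injective).symm ⟨testToL2 φ, h⟩)) = _
    congr 2
    rw [LinearEquiv.symm_apply_eq]
    rfl
  constructor
  · rintro ⟨⟨_, ⟨φ, rfl⟩⟩, h1, h2⟩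
    exact ⟨φ, h1.symm, by rw [← h φ ⟨φ, rfl⟩]; exact h2.symm⟩
  · rintro ⟨φ, rfl, rfl⟩
    exact ⟨⟨testToL2 φ, ⟨φ, rfl⟩⟩, rfl, h φ _⟩

/-- The fundamental lemma of the calculus of variations on the punctured plane, whose complement is
a null set; real test functions suffice. -/
theorem dense_preOperator (lam : ℝ) : Dense ((preOperator lam).domain : Set L2) := by
  change Dense ((LinearMap.range testToL2 : Submodule ℂ L2) : Set L2)
  rw [Submodule.dense_iff_topologicalClosure_eq_top, Submodule.topologicalClosure_eq_top_iff,
    Submodule.eq_bot_iff]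
  intro f hf
  have hloc : LocallyIntegrable f volume := (Lp.memLp f).locallyIntegrable (by norm_num)
  have h0 : ∀ᵐ z : ℂ, z ∈ ({0}ᶜ : Set ℂ) → (starRingEnd ℂ) (f z) = 0 := by
    have hloc' : LocallyIntegrable (fun z => (starRingEnd ℂ) (f z)) volume := by
      intro z
      obtain ⟨s, hs, hi⟩ := hloc z
      refine ⟨s, hs, ?_⟩
      exact (Complex.conjCLE : ℂ →L[ℝ] ℂ).integrable_comp hi
    refine IsOpen.ae_eq_zero_of_integral_contDiff_smul_eq_zero isOpen_compl_singleton
      (hloc'.locallyIntegrableOn _) fun g hg hgc hgs => ?_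
    have hφ : (fun z => (g z : ℂ)) ∈ testFunctions := by
      have hsupp : tsupport (fun z => (g z : ℂ)) ⊆ tsupport g :=
        closure_mono fun z hz => by
          simp only [Function.mem_support, ne_eq, Complex.ofReal_eq_zero] at hz ⊢
          exact hz
      refine ⟨Complex.ofRealCLM.contDiff.comp hg, ?_, fun h => ?_⟩
      · exact hgc.of_isClosed_subset (isClosed_tsupport _) hsupp
      · exact hgs (hsupp h) rfl
    have h := (Submodule.mem_orthogonal' _ f).1 hf (testToL2 ⟨_, hφ⟩) ⟨_, rfl⟩
    change ⟪f, (memLp_testFunction ⟨_, hφ⟩).toLp _⟫_ℂ = 0 at h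
    rw [inner_toLp] at h
    rw [← h]
    refine integral_congr_ae (ae_of_all _ fun z => ?_)
    simp [mul_comm]
  have hne : ∀ᵐ z : ℂ, z ∈ ({0}ᶜ : Set ℂ) := by
    simp [ae_iff]
  rw [Lp.eq_zero_iff_ae_eq_zero]
  filter_upwards [h0, hne] with z h1 h2
  simpa using h1 h2

theorem preOperator_isFormalAdjoint (lam : ℝ) :
    (preOperator lam).IsFormalAdjoint (preOperator lam) := by
  rw [isFormalAdjoint_iff_graph]
  intro a b c d h1 h2
  obtain ⟨φ, rfl, rfl⟩ := (mem_preOperator_graph lam).1 h1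
  obtain ⟨ψ, rfl, rfl⟩ := (mem_preOperator_graph lam).1 h2
  exact inner_formalOperator lam φ ψ

theorem preOperator_isClosable (lam : ℝ) : (preOperator lam).IsClosable :=
  (LinearPMap.adjoint_isClosed (dense_preOperator lam)).isClosable.leIsClosable
    (LinearPMap.IsFormalAdjoint.le_adjoint (dense_preOperator lam)
      (preOperator_isFormalAdjoint lam))

theorem mem_abOperator_graph (lam : ℝ) {p : L2 × L2} :
    p ∈ (abOperator lam).graph ↔ p ∈ closure ((preOperator lam).graph : Set (L2 × L2)) := by
  unfold abOperator
  rw [← (preOperator_isClosable lam).graph_closure_eq_closure_graph]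
  rfl

theorem test_mem_abOperator (lam : ℝ) (φ : testFunctions) :
    (testToL2 φ, testToL2 (formalOperator lam φ)) ∈ (abOperator lam).graph :=
  (mem_abOperator_graph lam).2
    (subset_closure ((mem_preOperator_graph lam).2 ⟨φ, rfl, rfl⟩))

theorem abOperator_isClosedHermitian (lam : ℝ) : IsClosedHermitian (abOperator lam) where
  dense := (dense_preOperator lam).mono (LinearPMap.le_closure _).1
  closed := (preOperator_isClosable lam).closure_isClosed
  hermitian := by
    rw [isFormalAdjoint_iff_graph]
    have hsym := isFormalAdjoint_iff_graph.1 (preOperator_isFormalAdjoint lam)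
    -- Hermiticity passes to the closure one variable at a time.
    have step : ∀ a b c d, (a, b) ∈ (preOperator lam).graph → (c, d) ∈ (abOperator lam).graph →
        ⟪b, c⟫_ℂ = ⟪a, d⟫_ℂ := by
      intro a b c d h1 h2
      have hcl : IsClosed {p : L2 × L2 | ⟪b, p.1⟫_ℂ = ⟪a, p.2⟫_ℂ} :=
        isClosed_eq (by fun_prop) (by fun_prop)
      exact closure_minimal (fun p hp => hsym a b p.1 p.2 h1 hp) hcl
        ((mem_abOperator_graph lam).1 h2)
    intro a b c d h1 h2
    have hcl : IsClosed {p : L2 × L2 | ⟪p.2, c⟫_ℂ = ⟪p.1, d⟫_ℂ} :=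
      isClosed_eq (by fun_prop) (by fun_prop)
    exact closure_minimal (fun p hp => step p.1 p.2 c d hp h2) hcl
      ((mem_abOperator_graph lam).1 h1)

theorem abOperator_nonneg (lam : ℝ) (f : (abOperator lam).domain) :
    0 ≤ quadForm (abOperator lam) f := by
  have hcl : IsClosed {p : L2 × L2 | 0 ≤ (⟪p.1, p.2⟫_ℂ).re} :=
    isClosed_le continuous_const (by fun_prop)
  refine closure_minimal (fun p hp => ?_) hcl
    ((mem_abOperator_graph lam).1 ((abOperator lam).mem_graph f))
  obtain ⟨φ, h1, h2⟩ := (mem_preOperator_graph lam).1 (show (p.1, p.2) ∈ _ from hp)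
  simp only [Set.mem_ofPred_eq]
  rw [h1, h2]
  exact inner_formalOperator_self lam φ

/-- The adjoint of the Aharonov-Bohm operator, in terms of test functions. -/
theorem mem_adjoint_iff_test (lam : ℝ) {f g : L2} :
    (f, g) ∈ (abOperator lam).adjoint.graph ↔
      ∀ φ, ⟪g, testToL2 φ⟫_ℂ = ⟪f, testToL2 (formalOperator lam φ)⟫_ℂ := by
  rw [mem_graph_adjoint_iff (abOperator_isClosedHermitian lam).dense]
  constructor
  · exact fun h φ => h _ _ (test_mem_abOperator lam φ)
  · intro h a b hab
    have hcl : IsClosed {p : L2 × L2 | ⟪g, p.1⟫_ℂ = ⟪f, p.2⟫_ℂ} :=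
      isClosed_eq (by fun_prop) (by fun_prop)
    refine closure_minimal (fun p hp => ?_) hcl ((mem_abOperator_graph lam).1 hab)
    obtain ⟨φ, h1, h2⟩ := (mem_preOperator_graph lam).1 (show (p.1, p.2) ∈ _ from hp)
    simp only [Set.mem_ofPred_eq]
    rw [h1, h2]
    exact h φ

/-! ### Pullback of test functions under multiplication by a complex number -/

theorem comp_mul_mem {c : ℂ} (hc : c ≠ 0) {φ : ℂ → ℂ} (hφ : φ ∈ testFunctions) :
    (fun z => φ (c * z)) ∈ testFunctions := by
  obtain ⟨h1, h2, h3⟩ := hφ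
  have hs : tsupport (fun z => φ (c * z)) = (fun z => c * z) ⁻¹' tsupport φ :=
    (tsupport_comp_eq_preimage φ (Homeomorph.mulLeft₀ c hc))
  refine ⟨h1.comp (contDiff_const.mul contDiff_id), ?_, ?_⟩
  · exact h2.comp_homeomorph (Homeomorph.mulLeft₀ c hc)
  · rw [hs]
    simpa using h3

/-- The pullback `φ ↦ φ(c ·)` on test functions. -/
def pullback (c : ℂ) (hc : c ≠ 0) : testFunctions →ₗ[ℂ] testFunctions where
  toFun φ := ⟨fun z => φ.1 (c * z), comp_mul_mem hc φ.2⟩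
  map_add' _ _ := rfl
  map_smul' _ _ := rfl

theorem fderiv_comp_mul (c : ℂ) {φ : ℂ → ℂ} (hφ : Differentiable ℝ φ) (z v : ℂ) :
    fderiv ℝ (fun w => φ (c * w)) z v =
      c.re * fderiv ℝ φ (c * z) v + c.im * fderiv ℝ φ (c * z) (Complex.I * v) := by
  have h1 : HasFDerivAt (fun w : ℂ => c * w)
      ((ContinuousLinearMap.mul ℝ ℂ c)) z := (ContinuousLinearMap.mul ℝ ℂ c).hasFDerivAt
  have h2 := (hφ (c * z)).hasFDerivAt.comp z h1
  have h2' : HasFDerivAt (fun w => φ (c * w))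
      ((fderiv ℝ φ (c * z)).comp (ContinuousLinearMap.mul ℝ ℂ c)) z := h2
  rw [h2'.fderiv]
  simp only [ContinuousLinearMap.comp_apply, ContinuousLinearMap.mul_apply']
  have e : c * v = c.re • v + c.im • (Complex.I * v) := by
    conv_lhs => rw [← Complex.re_add_im c]
    simp only [Complex.real_smul]
    ring
  rw [e, map_add, map_smul, map_smul, Complex.real_smul, Complex.real_smul]

/-- Under `z ↦ cz` the potential scales with degree `-1` and turns like a covector, so `(DX, DY)`
transforms by the real matrix of multiplication by `c`. -/
theorem DX_pullback (lam : ℝ) {c : ℂ} (hc : c ≠ 0) (φ : testFunctions) :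
    DX lam (pullback c hc φ) =
      (c.re : ℂ) • pullback c hc (DX lam φ) + (c.im : ℂ) • pullback c hc (DY lam φ) := by
  apply Subtype.ext
  funext z
  change covDeriv 1 (coeffX lam) (fun w => φ.1 (c * w)) z =
    c.re * covDeriv 1 (coeffX lam) φ.1 (c * z) +
      c.im * covDeriv Complex.I (coeffY lam) φ.1 (c * z)
  simp only [covDeriv]
  rw [fderiv_comp_mul c (φ.2.1.differentiable (by simp)), mul_one]
  by_cases hz : z = 0
  · have h0 : φ.1 0 = 0 := image_eq_zero_of_notMem_tsupport φ.2.2.2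
    simp [hz, h0]
    ring
  have hr : z.re ^ 2 + z.im ^ 2 ≠ 0 := re_sq_add_im_sq_ne_zero hz
  have hr' : (c * z).re ^ 2 + (c * z).im ^ 2 ≠ 0 := re_sq_add_im_sq_ne_zero (mul_ne_zero hc hz)
  have e : coeffX lam z = c.re * coeffX lam (c * z) + c.im * coeffY lam (c * z) := by
    simp only [coeffX, coeffY]
    field_simp
    simp only [Complex.mul_re, Complex.mul_im]
    ring
  rw [e]
  push_cast
  ring

theorem DY_pullback (lam : ℝ) {c : ℂ} (hc : c ≠ 0) (φ : testFunctions) :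
    DY lam (pullback c hc φ) =
      (c.re : ℂ) • pullback c hc (DY lam φ) - (c.im : ℂ) • pullback c hc (DX lam φ) := by
  apply Subtype.ext
  funext z
  change covDeriv Complex.I (coeffY lam) (fun w => φ.1 (c * w)) z =
    c.re * covDeriv Complex.I (coeffY lam) φ.1 (c * z) -
      c.im * covDeriv 1 (coeffX lam) φ.1 (c * z)
  simp only [covDeriv]
  rw [fderiv_comp_mul c (φ.2.1.differentiable (by simp)), Complex.I_mul_I, map_neg]
  by_cases hz : z = 0
  · have h0 : φ.1 0 = 0 := image_eq_zero_of_notMem_tsupport φ.2.2.2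
    simp [hz, h0]
    ring
  have hr : z.re ^ 2 + z.im ^ 2 ≠ 0 := re_sq_add_im_sq_ne_zero hz
  have hr' : (c * z).re ^ 2 + (c * z).im ^ 2 ≠ 0 := re_sq_add_im_sq_ne_zero (mul_ne_zero hc hz)
  have e : coeffY lam z = c.re * coeffY lam (c * z) - c.im * coeffX lam (c * z) := by
    simp only [coeffX, coeffY]
    field_simp
    simp only [Complex.mul_re, Complex.mul_im]
    ring
  rw [e]
  push_cast
  ring

/-- The matrix of multiplication by `c` is `‖c‖` times an orthogonal one, so the sum of squares only
acquires `‖c‖²`. Real `c` gives homogeneity and unimodular `c` gives rotation invariance. -/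
theorem formalOperator_pullback (lam : ℝ) {c : ℂ} (hc : c ≠ 0) (φ : testFunctions) :
    formalOperator lam (pullback c hc φ) =
      ((‖c‖ ^ 2 : ℝ) : ℂ) • pullback c hc (formalOperator lam φ) := by
  rw [formalOperator_apply, formalOperator_apply, DX_pullback, DY_pullback]
  simp only [map_add, map_sub, map_smul, DX_pullback, DY_pullback]
  have h : ‖c‖ ^ 2 = c.re ^ 2 + c.im ^ 2 := by
    rw [← Complex.normSq_eq_norm_sq, Complex.normSq_apply]; ring
  rw [h]
  push_cast
  module

/-! ### Dilations -/

theorem dilation_coe (τ : ℝ) (f : L2) :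
    dilation τ f =ᵐ[volume] fun z => (Real.exp τ : ℂ) * f ((Real.exp τ : ℂ) * z) :=
  (memLp_dilation τ f).coeFn_toLp

theorem quasiMeasurePreserving_mul {r : ℝ} (hr : r ≠ 0) :
    Measure.QuasiMeasurePreserving (fun z : ℂ => (r : ℂ) * z) volume volume := by
  refine ⟨by fun_prop, ?_⟩
  have hmap : Measure.map (fun z : ℂ => r • z) (volume : Measure ℂ) =
      ENNReal.ofReal |(r ^ Module.finrank ℝ ℂ)⁻¹| • volume :=
    Measure.map_addHaar_smul volume hr
  have e : (fun z : ℂ => (r : ℂ) * z) = fun z : ℂ => r • z := by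
    funext z; exact (Complex.real_smul).symm
  rw [e, hmap]
  exact Measure.smul_absolutelyContinuous

theorem ae_comp_mul {r : ℝ} (hr : r ≠ 0) {f g : ℂ → ℂ} (h : f =ᵐ[volume] g) :
    (fun z => f ((r : ℂ) * z)) =ᵐ[volume] fun z => g ((r : ℂ) * z) :=
  (quasiMeasurePreserving_mul hr).ae_eq h

theorem inner_dilation_dilation (τ : ℝ) (f g : L2) :
    ⟪dilation τ f, dilation τ g⟫_ℂ = ⟪f, g⟫_ℂ := by
  unfold dilation
  rw [inner_toLp_toLp, L2.inner_def]
  have h := Measure.integral_comp_smul (volume : Measure ℂ)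
    (fun z => (starRingEnd ℂ) (f z) * g z) (Real.exp τ)
  rw [Complex.finrank_real_complex] at h
  have e : ∀ z : ℂ, (starRingEnd ℂ) ((Real.exp τ : ℂ) * f ((Real.exp τ : ℂ) * z)) *
      ((Real.exp τ : ℂ) * g ((Real.exp τ : ℂ) * z)) = ((Real.exp τ) ^ 2 : ℝ) •
        ((starRingEnd ℂ) (f (Real.exp τ • z)) * g (Real.exp τ • z)) := by
    intro z
    rw [map_mul, Complex.conj_ofReal, Complex.real_smul, Complex.real_smul]
    push_cast
    ring
  simp only [e]
  rw [integral_smul, h, smul_smul, abs_of_pos (by positivity), mul_inv_cancel₀ (by positivity),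
    one_smul]
  refine integral_congr_ae (ae_of_all _ fun z => ?_)
  simp only [RCLike.inner_apply]
  ring

theorem dilation_add (τ : ℝ) (f g : L2) : dilation τ (f + g) = dilation τ f + dilation τ g := by
  apply Lp.ext
  have h := ae_comp_mul (Real.exp_pos τ).ne' (Lp.coeFn_add f g)
  filter_upwards [dilation_coe τ (f + g), dilation_coe τ f, dilation_coe τ g,
    Lp.coeFn_add (dilation τ f) (dilation τ g), h] with z h1 h2 h3 h4 h5
  rw [h1, h4, Pi.add_apply, h2, h3, h5, Pi.add_apply]
  ring

theorem dilation_smul (τ : ℝ) (c : ℂ) (f : L2) : dilation τ (c • f) = c • dilation τ f := by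
  apply Lp.ext
  have h := ae_comp_mul (Real.exp_pos τ).ne' (Lp.coeFn_smul c f)
  filter_upwards [dilation_coe τ (c • f), dilation_coe τ f,
    Lp.coeFn_smul c (dilation τ f), h] with z h1 h2 h4 h5
  rw [h1, h4, Pi.smul_apply, h2, h5, Pi.smul_apply, smul_eq_mul, smul_eq_mul]
  ring

theorem dilation_dilation_neg (τ : ℝ) (f : L2) : dilation τ (dilation (-τ) f) = f := by
  apply Lp.ext
  have h := ae_comp_mul (Real.exp_pos τ).ne' (dilation_coe (-τ) f)
  filter_upwards [dilation_coe τ (dilation (-τ) f), h] with z h1 h2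
  rw [h1, h2, ← mul_assoc, ← mul_assoc, ← Complex.ofReal_mul, ← Complex.ofReal_mul, ← Real.exp_add,
    ← Real.exp_add]
  simp

/-- The dilation as a linear isometry. -/
def dilationₗᵢ (τ : ℝ) : L2 →ₗᵢ[ℂ] L2 where
  toFun := dilation τ
  map_add' := dilation_add τ
  map_smul' := dilation_smul τ
  norm_map' f := by
    have h := inner_dilation_dilation τ f f
    rw [inner_self_eq_norm_sq_to_K, inner_self_eq_norm_sq_to_K] at h
    have h' : ‖dilation τ f‖ ^ 2 = ‖f‖ ^ 2 := by exact_mod_cast h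
    exact (sq_eq_sq₀ (norm_nonneg _) (norm_nonneg _)).1 h'

theorem dilation_testToL2 (τ : ℝ) (φ : testFunctions) :
    dilation τ (testToL2 φ) = (Real.exp τ : ℂ) •
      testToL2 (pullback (Real.exp τ) (Complex.ofReal_ne_zero.2 (Real.exp_pos τ).ne') φ) := by
  rw [← map_smul]
  apply Lp.ext
  have h := ae_comp_mul (Real.exp_pos τ).ne' (memLp_testFunction φ).coeFn_toLp
  filter_upwards [dilation_coe τ (testToL2 φ), h, (memLp_testFunction ((Real.exp τ : ℂ) • 
    pullback (Real.exp τ) (Complex.ofReal_ne_zero.2 (Real.exp_pos τ).ne') φ)).coeFn_toLp]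
    with z h1 h2 h3
  rw [h1]
  refine Eq.trans ?_ h3.symm
  change _ * (testToL2 φ) _ = (Real.exp τ : ℂ) * φ.1 (Real.exp τ * z)
  rw [← h2]
  rfl

/-- Moving the scalar across the identity reverses its sign in the exponent: degree `-2` corresponds
to the factor `e^{2τ}`. -/
theorem isHomogeneous_iff {ν : ℝ} {T : L2 →ₗ.[ℂ] L2} :
    IsHomogeneous ν T ↔ ∀ τ : ℝ, Intertwines (dilation τ) (Real.exp (-(ν * τ)) : ℂ) T := by
  have key : ∀ τ : ℝ, ∀ x y : L2, x = (Real.exp (ν * τ) : ℂ) • y ↔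
      (Real.exp (-(ν * τ)) : ℂ) • x = y := by
    intro τ x y
    have h : (Real.exp (-(ν * τ)) : ℂ) * (Real.exp (ν * τ) : ℂ) = 1 := by
      rw [← Complex.ofReal_mul, ← Real.exp_add]; simp
    constructor
    · rintro rfl
      rw [smul_smul, h, one_smul]
    · rintro rfl
      rw [smul_smul, mul_comm, h, one_smul]
  constructor
  · intro h τ a b hab
    obtain ⟨x, rfl, rfl⟩ := (LinearPMap.mem_graph_iff T).1 hab
    obtain ⟨hx, e⟩ := h τ x
    exact (LinearPMap.mem_graph_iff T).2 ⟨⟨_, hx⟩, rfl, ((key _ _ _).1 e).symm⟩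
  · intro h τ f
    obtain ⟨x, h1, h2⟩ := (LinearPMap.mem_graph_iff T).1 (h τ _ _ (T.mem_graph f))
    simp only at h1 h2
    refine ⟨h1 ▸ x.2, (key _ _ _).2 ?_⟩
    rw [← h2]
    congr 1
    exact Subtype.ext h1

theorem abOperator_dilation (lam τ : ℝ) :
    Intertwines (dilation τ) (Real.exp (2 * τ) : ℂ) (abOperator lam) := by
  refine Intertwines.closure (dilationₗᵢ τ).continuous (preOperator_isClosable lam) ?_
  intro a b hab
  obtain ⟨φ, rfl, rfl⟩ := (mem_preOperator_graph lam).1 hab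
  have hc := Complex.ofReal_ne_zero.2 (Real.exp_pos τ).ne'
  refine (mem_preOperator_graph lam).2 ⟨(Real.exp τ : ℂ) • pullback (Real.exp τ) hc φ, ?_, ?_⟩
  · rw [dilation_testToL2, map_smul]
  · rw [dilation_testToL2, map_smul, formalOperator_pullback, map_smul, map_smul, Complex.norm_real,
      Real.norm_of_nonneg (Real.exp_pos τ).le, smul_smul, smul_smul, ← Real.exp_nat_mul, mul_comm]
    norm_num

theorem adjoint_dilation (lam τ : ℝ) :
    Intertwines (dilation τ) (Real.exp (2 * τ) : ℂ) (abOperator lam).adjoint := by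
  refine Intertwines.adjoint (U := dilationₗᵢ τ) (V := dilationₗᵢ (-τ)) (dilation_dilation_neg τ)
    (Real.exp_pos _).ne' (abOperator_isClosedHermitian lam).dense ?_
  have h := abOperator_dilation lam (-τ)
  rw [mul_neg, Real.exp_neg, Complex.ofReal_inv] at h
  exact h

/-! ### Rotations -/

theorem rotate_coe (θ : ℝ) (f : L2) :
    rotate θ f =ᵐ[volume] fun z => f (Complex.exp (θ * Complex.I) * z) := by
  have h := Lp.coeFn_compMeasurePreserving f (rotation (Circle.exp θ)).measurePreserving
  refine h.trans (ae_of_all _ fun z => ?_)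
  simp [rotation_apply]

theorem rotate_rotate (θ θ' : ℝ) (f : L2) : rotate θ (rotate θ' f) = rotate (θ + θ') f := by
  apply Lp.ext
  have h := (rotation (Circle.exp θ)).measurePreserving.quasiMeasurePreserving.ae_eq
    (rotate_coe θ' f)
  filter_upwards [rotate_coe θ (rotate θ' f), h, rotate_coe (θ + θ') f] with z h1 h2 h3
  rw [h1, h3]
  have e : rotation (Circle.exp θ) z = Complex.exp (θ * Complex.I) * z := by
    simp [rotation_apply]
  simp only [Function.comp_apply, e] at h2
  rw [h2, ← mul_assoc, ← Complex.exp_add]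
  congr 3
  push_cast
  ring

theorem rotate_zero (f : L2) : rotate 0 f = f := by
  apply Lp.ext
  filter_upwards [rotate_coe 0 f] with z h1
  rw [h1]
  simp

theorem rotate_rotate_neg (θ : ℝ) (f : L2) : rotate θ (rotate (-θ) f) = f := by
  rw [rotate_rotate, add_neg_cancel, rotate_zero]

theorem rotate_add_two_pi (θ : ℝ) (f : L2) : rotate (θ + 2 * Real.pi) f = rotate θ f := by
  apply Lp.ext
  filter_upwards [rotate_coe (θ + 2 * Real.pi) f, rotate_coe θ f] with z h1 h2
  rw [h1, h2]
  push_cast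
  rw [add_mul, Complex.exp_add, Complex.exp_two_pi_mul_I, mul_one]

theorem rotate_testToL2 (θ : ℝ) (φ : testFunctions) :
    rotate θ (testToL2 φ) =
      testToL2 (pullback (Complex.exp (θ * Complex.I)) (Complex.exp_ne_zero _) φ) := by
  apply Lp.ext
  have h := (rotation (Circle.exp θ)).measurePreserving.quasiMeasurePreserving.ae_eq
    (memLp_testFunction φ).coeFn_toLp
  filter_upwards [rotate_coe θ (testToL2 φ), h, (memLp_testFunction
    (pullback (Complex.exp (θ * Complex.I)) (Complex.exp_ne_zero _) φ)).coeFn_toLp] with z h1 h2 h3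
  rw [h1]
  refine Eq.trans ?_ h3.symm
  have e : rotation (Circle.exp θ) z = Complex.exp (θ * Complex.I) * z := by
    simp [rotation_apply]
  simp only [Function.comp_apply, e] at h2
  exact h2

theorem isRotationSymmetric_iff {T : L2 →ₗ.[ℂ] L2} :
    IsRotationSymmetric T ↔ ∀ θ : ℝ, Intertwines (rotate θ) 1 T := by
  constructor
  · intro h θ a b hab
    obtain ⟨x, rfl, rfl⟩ := (LinearPMap.mem_graph_iff T).1 hab
    obtain ⟨hx, e⟩ := h θ x
    exact (LinearPMap.mem_graph_iff T).2 ⟨⟨_, hx⟩, rfl, by rw [one_smul]; exact e.symm⟩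
  · intro h θ f
    obtain ⟨x, h1, h2⟩ := (LinearPMap.mem_graph_iff T).1 (h θ _ _ (T.mem_graph f))
    simp only at h1 h2
    refine ⟨h1 ▸ x.2, ?_⟩
    rw [one_smul] at h2
    rw [← h2]
    congr 1
    exact Subtype.ext h1

theorem abOperator_rotate (lam θ : ℝ) : Intertwines (rotate θ) 1 (abOperator lam) := by
  refine Intertwines.closure (rotate θ).continuous (preOperator_isClosable lam) ?_
  intro a b hab
  obtain ⟨φ, rfl, rfl⟩ := (mem_preOperator_graph lam).1 hab
  refine (mem_preOperator_graph lam).2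
    ⟨pullback (Complex.exp (θ * Complex.I)) (Complex.exp_ne_zero _) φ, rotate_testToL2 θ φ, ?_⟩
  rw [rotate_testToL2, formalOperator_pullback, Complex.norm_exp_ofReal_mul_I, map_smul]
  norm_num

theorem adjoint_rotate (lam θ : ℝ) : Intertwines (rotate θ) 1 (abOperator lam).adjoint := by
  have h := Intertwines.adjoint (U := rotate θ) (V := rotate (-θ)) (c := 1) (rotate_rotate_neg θ)
    one_ne_zero (abOperator_isClosedHermitian lam).dense
    (by simpa using abOperator_rotate lam (-θ))
  simpa using h

theorem mem_sector_iff {l : ℤ} {f : L2} :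
    f ∈ sector l ↔ ∀ θ : ℝ, rotate θ f = Complex.exp (Complex.I * l * θ) • f := by
  simp only [sector, Submodule.mem_iInf, LinearMap.mem_ker, LinearMap.sub_apply, sub_eq_zero]
  rfl

theorem inner_sector_of_ne {l l' : ℤ} (h : l ≠ l') {f g : L2} (hf : f ∈ sector l)
    (hg : g ∈ sector l') : ⟪f, g⟫_ℂ = 0 := by
  obtain ⟨θ, hθ⟩ : ∃ θ : ℝ, Complex.exp (Complex.I * (l' - l) * θ) ≠ 1 := by
    have h' : ((l' : ℂ) - l) ≠ 0 := by
      rw [sub_ne_zero]; exact_mod_cast h.symm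
    -- At this angle the ratio of the two eigenvalues is `e^{iπ} = -1`.
    refine ⟨Real.pi / ((l' - l : ℤ) : ℝ), ?_⟩
    have : Complex.I * ((l' : ℂ) - l) * ((Real.pi / ((l' - l : ℤ) : ℝ) : ℝ) : ℂ) =
        Real.pi * Complex.I := by
      push_cast
      field_simp
    rw [this, Complex.exp_pi_mul_I]
    norm_num
  have h1 := (rotate θ).inner_map_map f g
  rw [mem_sector_iff.1 hf, mem_sector_iff.1 hg, inner_smul_left, inner_smul_right,
    ← Complex.exp_conj, ← mul_assoc, ← Complex.exp_add] at h1
  have e : (starRingEnd ℂ) (Complex.I * l * θ) + Complex.I * l' * θ =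
      Complex.I * (l' - l) * θ := by
    simp only [map_mul, Complex.conj_I, Complex.conj_ofReal, map_intCast]
    ring
  rw [e] at h1
  have h2 : (Complex.exp (Complex.I * (l' - l) * θ) - 1) * ⟪f, g⟫_ℂ = 0 := by
    rw [sub_mul, one_mul, sub_eq_zero]; exact h1
  exact (mul_eq_zero.1 h2).resolve_left (sub_ne_zero.2 hθ)

/-! ### Functions `a(log |z|) (z / |z|) ^ l` -/

/-- The function `a(log r) e^{i l φ}` in polar coordinates (and `0` at the origin). -/
def polarFun (a : ℝ → ℝ) (l : ℤ) (z : ℂ) : ℂ :=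
  if z = 0 then 0 else (a (Real.log ‖z‖) : ℂ) * (z / ‖z‖) ^ l

theorem polarFun_zero (a : ℝ → ℝ) (l : ℤ) : polarFun a l 0 = 0 := if_pos rfl

theorem polarFun_of_ne (a : ℝ → ℝ) (l : ℤ) {z : ℂ} (hz : z ≠ 0) :
    polarFun a l z = (a (Real.log ‖z‖) : ℂ) * (z / ‖z‖) ^ l := if_neg hz

theorem polarFun_exp (a : ℝ → ℝ) (l : ℤ) (s t : ℝ) :
    polarFun a l (Complex.exp (s + t * Complex.I)) = a s * Complex.exp (l * (t * Complex.I)) := by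
  rw [polarFun_of_ne _ _ (Complex.exp_ne_zero _), Complex.norm_exp]
  have h1 : ((s : ℂ) + t * Complex.I).re = s := by simp
  rw [h1, Real.log_exp, Complex.exp_add, Complex.ofReal_exp, mul_div_cancel_left₀ _
    (Complex.exp_ne_zero _), ← Complex.exp_int_mul]

theorem polarFun_mul (a : ℝ → ℝ) (l : ℤ) {c : ℂ} (hc : c ≠ 0) (z : ℂ) :
    polarFun a l (c * z) = (c / ‖c‖) ^ l * polarFun (fun s => a (s + Real.log ‖c‖)) l z := by
  by_cases hz : z = 0
  · simp [hz, polarFun_zero]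
  rw [polarFun_of_ne _ _ (mul_ne_zero hc hz), polarFun_of_ne _ _ hz, norm_mul,
    Real.log_mul (norm_ne_zero_iff.2 hc) (norm_ne_zero_iff.2 hz), add_comm (Real.log ‖c‖)]
  have : c * z / ((‖c‖ * ‖z‖ : ℝ) : ℂ) = c / ‖c‖ * (z / ‖z‖) := by
    push_cast
    rw [mul_div_mul_comm]
  rw [this, mul_zpow]
  ring

theorem polarFun_congr {a b : ℝ → ℝ} {l : ℤ} {z : ℂ} (h : a (Real.log ‖z‖) = b (Real.log ‖z‖)) :
    polarFun a l z = polarFun b l z := by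
  unfold polarFun; rw [h]

theorem norm_polarFun (a : ℝ → ℝ) (l : ℤ) {z : ℂ} (hz : z ≠ 0) :
    ‖polarFun a l z‖ = |a (Real.log ‖z‖)| := by
  rw [polarFun_of_ne _ _ hz, norm_mul, Complex.norm_real, norm_zpow, norm_div, Complex.norm_real,
    norm_norm, div_self (norm_ne_zero_iff.2 hz), one_zpow, mul_one, Real.norm_eq_abs]

/-- The function `polarFun a l` in the logarithmic coordinate centered at `z₀`. -/
theorem polarFun_eventuallyEq (a : ℝ → ℝ) (l : ℤ) {z₀ : ℂ} (hz₀ : z₀ ≠ 0) :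
    polarFun a l =ᶠ[𝓝 z₀] fun z => (a ((Complex.log (z / z₀)).re + Real.log ‖z₀‖) : ℂ) *
      Complex.exp (l * ((Complex.log (z / z₀)).im * Complex.I)) * (z₀ / ‖z₀‖) ^ l := by
  filter_upwards [isOpen_ne.mem_nhds hz₀] with z hz
  have h1 : z = z₀ * Complex.exp (Complex.log (z / z₀)) := by
    rw [Complex.exp_log (div_ne_zero hz hz₀), mul_div_cancel₀ _ hz₀]
  have h2 := polarFun_mul a l hz₀ (Complex.exp (Complex.log (z / z₀)))
  rw [← h1] at h2
  rw [h2]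
  have h3 := polarFun_exp (fun s => a (s + Real.log ‖z₀‖)) l (Complex.log (z / z₀)).re
    (Complex.log (z / z₀)).im
  rw [Complex.re_add_im] at h3
  rw [h3]
  ring

/-- Using the logarithm of `z / z₀`, which is near `1`, keeps clear of the branch cut at every `z₀ ≠
0`. -/
theorem contDiffAt_polarFun {a : ℝ → ℝ} (ha : ContDiff ℝ ∞ a) (l : ℤ) {z₀ : ℂ} (hz₀ : z₀ ≠ 0) :
    ContDiffAt ℝ ∞ (polarFun a l) z₀ := by
  refine ContDiffAt.congr_of_eventuallyEq ?_ (polarFun_eventuallyEq a l hz₀)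
  have hlog : ContDiffAt ℝ ∞ (fun z : ℂ => Complex.log (z / z₀)) z₀ := by
    have h1 : ContDiffAt ℂ ∞ Complex.log (z₀ / z₀) := by
      refine Complex.contDiffAt_log ?_
      rw [div_self hz₀]; exact Complex.one_mem_slitPlane
    have h2 : ContDiffAt ℝ ∞ (fun z : ℂ => z / z₀) z₀ := contDiffAt_id.div_const z₀
    exact ContDiffAt.comp (f := fun z : ℂ => z / z₀) z₀ (h1.restrict_scalars ℝ) h2
  have hre : ContDiffAt ℝ ∞ (fun z : ℂ => (Complex.log (z / z₀)).re) z₀ :=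
    Complex.reCLM.contDiff.contDiffAt.comp z₀ hlog
  have him : ContDiffAt ℝ ∞ (fun z : ℂ => ((Complex.log (z / z₀)).im : ℂ)) z₀ :=
    (Complex.ofRealCLM.contDiff.comp Complex.imCLM.contDiff).contDiffAt.comp z₀ hlog
  have hA : ContDiffAt ℝ ∞ (fun z : ℂ => (a ((Complex.log (z / z₀)).re + Real.log ‖z₀‖) : ℂ)) z₀ :=
    (Complex.ofRealCLM.contDiff.comp ha).contDiffAt.comp z₀ (hre.add contDiffAt_const)
  have hE : ContDiffAt ℝ ∞
      (fun z : ℂ => Complex.exp (l * ((Complex.log (z / z₀)).im * Complex.I))) z₀ :=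
    (contDiffAt_const.mul (him.mul contDiffAt_const)).cexp
  exact (hA.mul hE).mul contDiffAt_const

/-- The differential of the complex logarithm sends `v` to `v / z`; its real part moves `log r` and
its imaginary part moves the angle. -/
theorem fderiv_polarFun {a : ℝ → ℝ} (ha : ContDiff ℝ ∞ a) (l : ℤ) {z : ℂ} (hz : z ≠ 0) (v : ℂ) :
    fderiv ℝ (polarFun a l) z v = (deriv a (Real.log ‖z‖) * (v / z).re +
      Complex.I * l * a (Real.log ‖z‖) * (v / z).im) * (z / ‖z‖) ^ l := by
  rw [(polarFun_eventuallyEq a l hz).fderiv_eq]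
  have hlog : HasFDerivAt (fun w : ℂ => Complex.log (w / z))
      ((ContinuousLinearMap.mul ℝ ℂ) z⁻¹) z := by
    have h1 : HasDerivAt (fun w : ℂ => Complex.log (w / z)) (1 / z / (z / z)) z :=
      ((hasDerivAt_id z).div_const z).clog (by simp [div_self hz])
    rw [div_self hz, div_one, one_div] at h1
    have h2 := h1.hasFDerivAt.restrictScalars ℝ
    refine h2.congr_fderiv ?_
    ext x
    simp [mul_comm]
  have h0 : Complex.log (z / z) = 0 := by rw [div_self hz, Complex.log_one]
  have hre : HasFDerivAt (fun w : ℂ => (Complex.log (w / z)).re)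
      (Complex.reCLM.comp ((ContinuousLinearMap.mul ℝ ℂ) z⁻¹)) z :=
    Complex.reCLM.hasFDerivAt.comp z hlog
  have him : HasFDerivAt (fun w : ℂ => ((Complex.log (w / z)).im : ℂ))
      ((Complex.ofRealCLM.comp Complex.imCLM).comp ((ContinuousLinearMap.mul ℝ ℂ) z⁻¹)) z :=
    (Complex.ofRealCLM.comp Complex.imCLM).hasFDerivAt.comp z hlog
  have hda : HasDerivAt a (deriv a (Real.log ‖z‖)) ((Complex.log (z / z)).re + Real.log ‖z‖) := by
    rw [h0]
    simpa using (ha.differentiable (by simp) (Real.log ‖z‖)).hasDerivAt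
  have hA := Complex.ofRealCLM.hasFDerivAt.comp z
    (hda.comp_hasFDerivAt z (hre.add_const (Real.log ‖z‖)))
  have hE := (((him.mul_const Complex.I).const_mul (l : ℂ))).cexp
  have h := ((hA.mul hE).mul_const ((z / ‖z‖) ^ l)).fderiv
  have e : (fun w : ℂ => (a ((Complex.log (w / z)).re + Real.log ‖z‖) : ℂ) *
      Complex.exp (l * ((Complex.log (w / z)).im * Complex.I)) * (z / ‖z‖) ^ l) =
      (fun w => ((Complex.ofRealCLM ∘ a ∘ fun w : ℂ =>
        (Complex.log (w / z)).re + Real.log ‖z‖) * fun w : ℂ =>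
        Complex.exp (l * ((Complex.log (w / z)).im * Complex.I))) w * (z / ‖z‖) ^ l) := rfl
  rw [e, h]
  simp only [Function.comp_apply, h0]
  simp [div_eq_inv_mul]
  ring

theorem polarFun_mem {a : ℝ → ℝ} (ha : ContDiff ℝ ∞ a) (hc : HasCompactSupport a) (l : ℤ) :
    polarFun a l ∈ testFunctions := by
  obtain ⟨R, hR⟩ : ∃ R : ℝ, ∀ s, R < |s| → a s = 0 := by
    obtain ⟨R, hR⟩ := hc.isCompact.isBounded.exists_norm_le
    refine ⟨R, fun s hs => ?_⟩
    by_contra h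
    exact absurd (hR s (subset_tsupport _ h)) (not_le.2 hs)
  have hsupp : Function.support (polarFun a l) ⊆
      {z | Real.exp (-R) ≤ ‖z‖} ∩ Metric.closedBall 0 (Real.exp R) := by
    intro z hz
    have hz0 : z ≠ 0 := by
      rintro rfl
      exact hz (polarFun_zero a l)
    have hn : 0 < ‖z‖ := norm_pos_iff.2 hz0
    have h1 : |Real.log ‖z‖| ≤ R := by
      by_contra h
      apply hz
      rw [polarFun_of_ne _ _ hz0, hR _ (not_le.1 h)]
      simp
    rw [abs_le] at h1
    refine ⟨(Real.le_log_iff_exp_le hn).1 h1.1, ?_⟩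
    rw [mem_closedBall_zero_iff]
    exact (Real.log_le_iff_le_exp hn).1 h1.2
  have hcl : IsClosed ({z : ℂ | Real.exp (-R) ≤ ‖z‖} ∩ Metric.closedBall 0 (Real.exp R)) :=
    (isClosed_le continuous_const continuous_norm).inter Metric.isClosed_closedBall
  have hts := closure_minimal hsupp hcl
  have h0 : (0 : ℂ) ∉ tsupport (polarFun a l) := fun h => by
    have h1 : Real.exp (-R) ≤ ‖(0 : ℂ)‖ := (hts h).1
    rw [norm_zero] at h1
    exact absurd h1 (not_le.2 (Real.exp_pos _))
  refine ⟨?_, ?_, h0⟩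
  · rw [contDiff_iff_contDiffAt]
    intro z
    by_cases hz : z = 0
    · subst hz
      exact contDiffAt_const.congr_of_eventuallyEq (notMem_tsupport_iff_eventuallyEq.1 h0)
    · exact contDiffAt_polarFun ha l hz
  · exact (isCompact_closedBall (0 : ℂ) (Real.exp R)).of_isClosed_subset (isClosed_tsupport _)
      (hts.trans Set.inter_subset_right)

/-- `polarFun a l` as a test function. -/
def polarTest (a : ℝ → ℝ) (l : ℤ) (ha : ContDiff ℝ ∞ a) (hc : HasCompactSupport a) :
    testFunctions := ⟨polarFun a l, polarFun_mem ha hc l⟩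

/-- The profile of `((-i∂_x + …) ± i (-i∂_y + …)) (a(log r) e^{i l φ})`, up to a factor `-i`. -/
def ladder (k : ℝ) (a : ℝ → ℝ) (s : ℝ) : ℝ := Real.exp (-s) * (deriv a s + k * a s)

theorem contDiff_deriv {a : ℝ → ℝ} (ha : ContDiff ℝ ∞ a) : ContDiff ℝ ∞ (deriv a) :=
  (contDiff_infty_iff_deriv.1 ha).2

theorem contDiff_ladder (k : ℝ) {a : ℝ → ℝ} (ha : ContDiff ℝ ∞ a) :
    ContDiff ℝ ∞ (ladder k a) :=
  (Real.contDiff_exp.comp contDiff_neg).mul ((contDiff_deriv ha).add (contDiff_const.mul ha))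

theorem hasCompactSupport_ladder (k : ℝ) {a : ℝ → ℝ} (hc : HasCompactSupport a) :
    HasCompactSupport (ladder k a) :=
  (hc.deriv.add (hc.mul_left (f := fun _ => k))).mul_left

theorem div_re_im (z : ℂ) :
    ((1 : ℂ) / z).re = z.re / (z.re ^ 2 + z.im ^ 2) ∧
    ((1 : ℂ) / z).im = -(z.im / (z.re ^ 2 + z.im ^ 2)) ∧
    (Complex.I / z).re = z.im / (z.re ^ 2 + z.im ^ 2) ∧
    (Complex.I / z).im = z.re / (z.re ^ 2 + z.im ^ 2) := by
  have h : Complex.normSq z = z.re ^ 2 + z.im ^ 2 := by rw [Complex.normSq_apply]; ring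
  refine ⟨?_, ?_, ?_, ?_⟩ <;> simp [Complex.div_re, Complex.div_im, h]
  ring

theorem exp_neg_log_norm {z : ℂ} (hz : z ≠ 0) : Real.exp (-Real.log ‖z‖) = ‖z‖⁻¹ := by
  rw [Real.exp_neg, Real.exp_log (norm_pos_iff.2 hz)]

/-- The combination `DX + i DY` is a ladder operator: it raises the angular momentum by one and acts
on the profile by a first-order operator. -/
theorem DX_add_DY_polarTest (lam : ℝ) (a : ℝ → ℝ) (l : ℤ) (ha : ContDiff ℝ ∞ a)
    (hc : HasCompactSupport a) :
    DX lam (polarTest a l ha hc) + Complex.I • DY lam (polarTest a l ha hc) =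
      -Complex.I • polarTest (ladder (-(l + lam)) a) (l + 1) (contDiff_ladder _ ha)
        (hasCompactSupport_ladder _ hc) := by
  apply Subtype.ext
  funext z
  change covDeriv 1 (coeffX lam) (polarFun a l) z +
    Complex.I * covDeriv Complex.I (coeffY lam) (polarFun a l) z =
      -Complex.I * polarFun (ladder (-(l + lam)) a) (l + 1) z
  by_cases hz : z = 0
  · have h0 : (0 : ℂ) ∉ tsupport (polarFun a l) := (polarTest a l ha hc).2.2.2
    have h1 : fderiv ℝ (polarFun a l) 0 = 0 := by
      by_contra h
      exact h0 (support_fderiv_subset ℝ h)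
    simp [hz, covDeriv, h1, polarFun_zero]
  have hn : (‖z‖ : ℂ) ≠ 0 := by exact_mod_cast norm_ne_zero_iff.2 hz
  have hr : ((z.re : ℂ) ^ 2 + (z.im : ℂ) ^ 2) = (‖z‖ : ℂ) ^ 2 := by
    rw [← Complex.ofReal_pow ‖z‖, ← Complex.normSq_eq_norm_sq, Complex.normSq_apply]
    push_cast
    ring
  obtain ⟨e1, e2, e3, e4⟩ := div_re_im z
  have hz' : z / ‖z‖ ≠ 0 := div_ne_zero hz hn
  simp only [covDeriv]
  rw [fderiv_polarFun ha l hz, fderiv_polarFun ha l hz, polarFun_of_ne _ _ hz,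
    polarFun_of_ne _ _ hz, e1, e2, e3, e4, ladder, exp_neg_log_norm hz, zpow_add_one₀ hz']
  simp only [coeffX, coeffY]
  push_cast
  rw [hr]
  have hzz : z = z.re + z.im * Complex.I := (Complex.re_add_im z).symm
  set w := (z / (‖z‖ : ℂ)) ^ l
  have hz2 : z / (‖z‖ : ℂ) = (z.re + z.im * Complex.I) / ‖z‖ := by rw [← hzz]
  rw [hz2]
  field_simp
  linear_combination (-w * z.im * lam * a (Real.log ‖z‖) -
    w * Complex.I * z.re * l * a (Real.log ‖z‖)) * Complex.I_sq

theorem DX_sub_DY_polarTest (lam : ℝ) (a : ℝ → ℝ) (l : ℤ) (ha : ContDiff ℝ ∞ a)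
    (hc : HasCompactSupport a) :
    DX lam (polarTest a l ha hc) - Complex.I • DY lam (polarTest a l ha hc) =
      -Complex.I • polarTest (ladder (l + lam) a) (l - 1) (contDiff_ladder _ ha)
        (hasCompactSupport_ladder _ hc) := by
  apply Subtype.ext
  funext z
  change covDeriv 1 (coeffX lam) (polarFun a l) z -
    Complex.I * covDeriv Complex.I (coeffY lam) (polarFun a l) z =
      -Complex.I * polarFun (ladder (l + lam) a) (l - 1) z
  by_cases hz : z = 0
  · have h0 : (0 : ℂ) ∉ tsupport (polarFun a l) := (polarTest a l ha hc).2.2.2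
    have h1 : fderiv ℝ (polarFun a l) 0 = 0 := by
      by_contra h
      exact h0 (support_fderiv_subset ℝ h)
    simp [hz, covDeriv, h1, polarFun_zero]
  have hn : (‖z‖ : ℂ) ≠ 0 := by exact_mod_cast norm_ne_zero_iff.2 hz
  have hr : ((z.re : ℂ) ^ 2 + (z.im : ℂ) ^ 2) = (‖z‖ : ℂ) ^ 2 := by
    rw [← Complex.ofReal_pow ‖z‖, ← Complex.normSq_eq_norm_sq, Complex.normSq_apply]
    push_cast
    ring
  obtain ⟨e1, e2, e3, e4⟩ := div_re_im z
  have hz' : z / ‖z‖ ≠ 0 := div_ne_zero hz hn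
  simp only [covDeriv]
  rw [fderiv_polarFun ha l hz, fderiv_polarFun ha l hz, polarFun_of_ne _ _ hz,
    polarFun_of_ne _ _ hz, e1, e2, e3, e4, ladder, exp_neg_log_norm hz, zpow_sub_one₀ hz']
  simp only [coeffX, coeffY]
  push_cast
  rw [hr]
  have hzz : z = z.re + z.im * Complex.I := (Complex.re_add_im z).symm
  set w := (z / (‖z‖ : ℂ)) ^ l
  have hz2 : (z / (‖z‖ : ℂ))⁻¹ = (z.re - z.im * Complex.I) / ‖z‖ := by
    rw [inv_div, div_eq_div_iff hz hn]
    have hc : z * (z.re - z.im * Complex.I) = (‖z‖ : ℂ) ^ 2 := by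
      rw [← hr]
      calc z * (z.re - z.im * Complex.I) =
          (z.re + z.im * Complex.I) * (z.re - z.im * Complex.I) := by rw [← hzz]
        _ = _ := by linear_combination (-(z.im : ℂ) ^ 2) * Complex.I_sq
    rw [mul_comm _ z, hc, sq]
  rw [hz2]
  field_simp
  linear_combination (-w * z.im * lam * a (Real.log ‖z‖) +
    w * Complex.I * z.re * l * a (Real.log ‖z‖)) * Complex.I_sq

/-- The radial operator in the logarithmic variable, for the angular momentum `l`. -/
def radialOp (lam : ℝ) (l : ℤ) (a : ℝ → ℝ) (s : ℝ) : ℝ :=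
  Real.exp (-(2 * s)) * (-deriv (deriv a) s + (l + lam) ^ 2 * a s)

/-- The factorization `e^{-s}(∂ + 1 - k) e^{-s}(∂ + k) = e^{-2s}(∂ - k)(∂ + k)`; commuting `∂` past
`e^{-s}` absorbs the `1`. -/
theorem ladder_ladder (k : ℝ) {a : ℝ → ℝ} (ha : ContDiff ℝ ∞ a) (s : ℝ) :
    ladder (1 - k) (ladder k a) s =
      Real.exp (-(2 * s)) * (deriv (deriv a) s - k ^ 2 * a s) := by
  have h1 : HasDerivAt (ladder k a) (-Real.exp (-s) * (deriv a s + k * a s) +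
      Real.exp (-s) * (deriv (deriv a) s + k * deriv a s)) s := by
    have e1 : HasDerivAt (fun s : ℝ => Real.exp (-s)) (-Real.exp (-s)) s := by
      simpa using (hasDerivAt_neg s).exp
    have e2 : HasDerivAt a (deriv a s) s := (ha.differentiable (by simp) s).hasDerivAt
    have e3 : HasDerivAt (deriv a) (deriv (deriv a) s) s :=
      ((contDiff_deriv ha).differentiable (by simp) s).hasDerivAt
    exact e1.mul (e3.add (e2.const_mul k))
  have h2 : ladder (1 - k) (ladder k a) s =
      Real.exp (-s) * (deriv (ladder k a) s + (1 - k) * ladder k a s) := rfl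
  rw [h2, h1.deriv, ladder, show -(2 * s) = -s + -s by ring, Real.exp_add]
  ring

/-- Twice `DX² + DY²` is the sum of the products of the two ladder operators in both orders. The
commutator cancels in this sum, so the magnetic field never has to be computed. -/
theorem formalOperator_polarTest (lam : ℝ) (a : ℝ → ℝ) (l : ℤ) (ha : ContDiff ℝ ∞ a)
    (hc : HasCompactSupport a) :
    (formalOperator lam (polarTest a l ha hc)).1 = polarFun (radialOp lam l a) l := by
  have hsum : (2 : ℂ) • formalOperator lam (polarTest a l ha hc) =
      (DX lam (DX lam (polarTest a l ha hc) + Complex.I • DY lam (polarTest a l ha hc)) -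
        Complex.I • DY lam (DX lam (polarTest a l ha hc) +
          Complex.I • DY lam (polarTest a l ha hc))) +
      (DX lam (DX lam (polarTest a l ha hc) - Complex.I • DY lam (polarTest a l ha hc)) +
        Complex.I • DY lam (DX lam (polarTest a l ha hc) -
          Complex.I • DY lam (polarTest a l ha hc))) := by
    rw [formalOperator_apply]
    simp only [map_add, map_sub, map_smul, smul_add, smul_sub, smul_smul, Complex.I_mul_I]
    module
  have h1 : DX lam (DX lam (polarTest a l ha hc) + Complex.I • DY lam (polarTest a l ha hc)) -
        Complex.I • DY lam (DX lam (polarTest a l ha hc) +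
          Complex.I • DY lam (polarTest a l ha hc)) =
      -Complex.I • (-Complex.I • polarTest _ (l + 1 - 1) (contDiff_ladder ((l + 1 : ℤ) + lam)
        (contDiff_ladder (-(l + lam)) ha)) (hasCompactSupport_ladder _
          (hasCompactSupport_ladder _ hc))) := by
    rw [DX_add_DY_polarTest, ← DX_sub_DY_polarTest]
    · simp only [map_smul, smul_sub, smul_comm Complex.I]
    · exact contDiff_ladder _ ha
    · exact hasCompactSupport_ladder _ hc
  have h2 : DX lam (DX lam (polarTest a l ha hc) - Complex.I • DY lam (polarTest a l ha hc)) +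
        Complex.I • DY lam (DX lam (polarTest a l ha hc) -
          Complex.I • DY lam (polarTest a l ha hc)) =
      -Complex.I • (-Complex.I • polarTest _ (l - 1 + 1) (contDiff_ladder (-((l - 1 : ℤ) + lam))
        (contDiff_ladder (l + lam) ha)) (hasCompactSupport_ladder _
          (hasCompactSupport_ladder _ hc))) := by
    rw [DX_sub_DY_polarTest, ← DX_add_DY_polarTest]
    · simp only [map_smul, smul_add, smul_comm Complex.I]
    · exact contDiff_ladder _ ha
    · exact hasCompactSupport_ladder _ hc
  rw [h1, h2] at hsum
  funext z
  have h3 := congrArg (fun φ : testFunctions => φ.1 z) hsum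
  change (2 : ℂ) * (formalOperator lam (polarTest a l ha hc)).1 z =
    -Complex.I * (-Complex.I * polarFun (ladder _ (ladder _ a)) (l + 1 - 1) z) +
    -Complex.I * (-Complex.I * polarFun (ladder _ (ladder _ a)) (l - 1 + 1) z) at h3
  have e1 : ladder ((l + 1 : ℤ) + lam) (ladder (-(l + lam)) a) =
      fun s => -radialOp lam l a s := by
    funext s
    have := ladder_ladder (-(l + lam)) ha s
    rw [show ((l + 1 : ℤ) + lam : ℝ) = 1 - -(l + lam) by push_cast; ring, this, radialOp]
    ring
  have e2 : ladder (-((l - 1 : ℤ) + lam)) (ladder (l + lam) a) =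
      fun s => -radialOp lam l a s := by
    funext s
    have := ladder_ladder (l + lam) ha s
    rw [show (-((l - 1 : ℤ) + lam) : ℝ) = 1 - (l + lam) by push_cast; ring, this, radialOp]
    ring
  have e3 : polarFun (fun s => -radialOp lam l a s) l z = -polarFun (radialOp lam l a) l z := by
    unfold polarFun
    split_ifs <;> simp
  rw [e1, e2, add_sub_cancel_right, sub_add_cancel, e3] at h3
  have h4 : (2 : ℂ) * (formalOperator lam (polarTest a l ha hc)).1 z =
      2 * polarFun (radialOp lam l a) l z := by
    rw [h3]
    linear_combination (-2 * polarFun (radialOp lam l a) l z) * Complex.I_sq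
  exact mul_left_cancel₀ two_ne_zero h4

/-! ### Logarithmic polar coordinates -/

/-- The map `(s, t) ↦ e^{s + i t}`. -/
def polarExp (p : ℝ × ℝ) : ℂ := Complex.exp (p.1 + p.2 * Complex.I)

/-- The measure `e^{2 s} ds`. -/
def radialMeasure : Measure ℝ := volume.withDensity fun s => ENNReal.ofReal (Real.exp (2 * s))

/-- Lebesgue measure on `(-π, π)`. -/
def angularMeasure : Measure ℝ := volume.restrict (Set.Ioo (-Real.pi) Real.pi)

instance : SigmaFinite radialMeasure :=
  SigmaFinite.withDensity_of_ne_top (ae_of_all _ fun _ => ENNReal.ofReal_ne_top)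

instance : IsFiniteMeasure angularMeasure := by
  unfold angularMeasure
  exact isFiniteMeasure_restrict.2 (by simp)

theorem measurable_polarExp : Measurable polarExp := by
  unfold polarExp; fun_prop

/-- Polar coordinates followed by `r = e^s`, under which `r dr` becomes `e^{2s} ds`. -/
theorem lintegral_polarExp {f : ℂ → ENNReal} (hf : Measurable f) :
    ∫⁻ p, f (polarExp p) ∂(radialMeasure.prod angularMeasure) = ∫⁻ z, f z := by
  rw [← Complex.lintegral_comp_polarCoord_symm, lintegral_prod
    (fun p => f (polarExp p)) (hf.comp measurable_polarExp).aemeasurable, polarCoord_target, Measure.volume_eq_prod,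
    setLIntegral_prod]
  · rw [← Real.range_exp, ← Set.image_univ,
      lintegral_image_eq_lintegral_abs_deriv_mul MeasurableSet.univ
      (fun x _ => (Real.hasDerivAt_exp x).hasDerivWithinAt) Real.exp_injective.injOn,
      Measure.restrict_univ]
    have hm : Measurable fun s => ∫⁻ t, f (polarExp (s, t)) ∂angularMeasure :=
      (hf.comp measurable_polarExp).lintegral_prod_right'
    unfold radialMeasure
    rw [lintegral_withDensity_eq_lintegral_mul _ (by fun_prop) hm]
    refine lintegral_congr fun s => ?_
    simp only [Pi.mul_apply, smul_eq_mul]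
    rw [lintegral_const_mul, ← mul_assoc, abs_of_pos (Real.exp_pos s),
      ← ENNReal.ofReal_mul (Real.exp_pos s).le, ← Real.exp_add, two_mul]
    · congr 1
      unfold angularMeasure
      refine lintegral_congr fun t => ?_
      congr 1
      simp only [polarExp, Complex.polarCoord_symm_apply]
      rw [Complex.exp_add, Complex.ofReal_exp, Complex.exp_mul_I, Complex.ofReal_cos,
        Complex.ofReal_sin]
    · refine hf.comp ?_
      simp only [Complex.polarCoord_symm_apply]
      fun_prop
  · refine Measurable.aemeasurable ?_
    simp only [smul_eq_mul, Complex.polarCoord_symm_apply]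
    refine Measurable.mul (by fun_prop) (hf.comp (by fun_prop))

theorem measurePreserving_polarExp :
    MeasurePreserving polarExp (radialMeasure.prod angularMeasure) volume := by
  refine ⟨measurable_polarExp, Measure.ext fun s hs => ?_⟩
  rw [← lintegral_indicator_one hs, ← lintegral_indicator_one hs,
    lintegral_map (measurable_one.indicator hs) measurable_polarExp,
    lintegral_polarExp (measurable_one.indicator hs)]

theorem integral_polarExp {f : ℂ → ℂ} (hf : AEStronglyMeasurable f volume) :
    ∫ z, f z = ∫ p, f (polarExp p) ∂(radialMeasure.prod angularMeasure) := by
  conv_lhs => rw [← measurePreserving_polarExp.map_eq]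
  rw [integral_map measurable_polarExp.aemeasurable]
  rwa [measurePreserving_polarExp.map_eq]

theorem integrable_polarExp {f : ℂ → ℂ} (hf : Integrable f volume) :
    Integrable (fun p => f (polarExp p)) (radialMeasure.prod angularMeasure) :=
  measurePreserving_polarExp.integrable_comp_of_integrable hf

theorem toReal_ofReal_exp (s : ℝ) :
    (ENNReal.ofReal (Real.exp (2 * s))).toReal = Real.exp (2 * s) :=
  ENNReal.toReal_ofReal (Real.exp_pos _).le

theorem integrable_radialMeasure {F : Type*} [NormedAddCommGroup F] [NormedSpace ℝ F] {g : ℝ → F} :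
    Integrable g radialMeasure ↔ Integrable fun s => Real.exp (2 * s) • g s := by
  unfold radialMeasure
  rw [integrable_withDensity_iff_integrable_smul' (by fun_prop)
    (ae_of_all _ fun _ => ENNReal.ofReal_lt_top)]
  simp only [toReal_ofReal_exp]

theorem integral_radialMeasure {F : Type*} [NormedAddCommGroup F] [NormedSpace ℝ F] (g : ℝ → F) :
    ∫ s, g s ∂radialMeasure = ∫ s, Real.exp (2 * s) • g s := by
  unfold radialMeasure
  rw [integral_withDensity_eq_integral_toReal_smul (by fun_prop)
    (ae_of_all _ fun _ => ENNReal.ofReal_lt_top)]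
  simp only [toReal_ofReal_exp]

theorem ae_radialMeasure {p : ℝ → Prop} : (∀ᵐ s ∂radialMeasure, p s) ↔ ∀ᵐ s, p s := by
  unfold radialMeasure
  rw [ae_withDensity_iff (by fun_prop)]
  have : ∀ s : ℝ, ENNReal.ofReal (Real.exp (2 * s)) ≠ 0 := fun s => by
    simpa using Real.exp_pos _
  simp [Real.exp_pos]

theorem integral_angularMeasure_one : ∫ _t, (1 : ℂ) ∂angularMeasure = 2 * Real.pi := by
  unfold angularMeasure
  rw [integral_const, Measure.real, Measure.restrict_apply MeasurableSet.univ, Set.univ_inter,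
    Real.volume_Ioo, ENNReal.toReal_ofReal (by linarith [Real.pi_pos])]
  simp
  ring

/-! ### Square integrable functions of the form `a(log r) e^{i l φ}` -/

theorem measurable_polarFun {a : ℝ → ℝ} (ha : Measurable a) (l : ℤ) :
    Measurable (polarFun a l) := by
  unfold polarFun
  refine Measurable.ite (measurableSet_singleton 0) measurable_const ?_
  exact (by fun_prop : Measurable fun z : ℂ => (a (Real.log ‖z‖) : ℂ)).mul
    ((by fun_prop : Measurable fun z : ℂ => z / (‖z‖ : ℂ)).pow_const l)

theorem memLp_polarFun {a : ℝ → ℝ} (ha : Measurable a)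
    (hi : Integrable fun s => Real.exp (2 * s) * a s ^ 2) (l : ℤ) :
    MemLp (polarFun a l) 2 volume := by
  have hm := measurable_polarFun ha l
  rw [← measurePreserving_polarExp.map_eq, memLp_map_measure_iff
    hm.aestronglyMeasurable measurable_polarExp.aemeasurable,
    memLp_two_iff_integrable_sq_norm (hm.comp measurable_polarExp).aestronglyMeasurable]
  have h1 : Integrable (fun s => a s ^ 2) radialMeasure := by
    rw [integrable_radialMeasure]
    simpa using hi
  have h2 := h1.mul_prod (integrable_const (1 : ℝ) (μ := angularMeasure))
  refine h2.congr (ae_of_all _ fun p => ?_)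
  simp only [Function.comp_apply, mul_one]
  rw [polarExp, norm_polarFun _ _ (Complex.exp_ne_zero _), Complex.norm_exp, Real.log_exp, sq_abs]
  simp

/-- The `l`-th Fourier coefficient in the angle (not normalized), in logarithmic coordinates. -/
def angCoeff (F : ℂ → ℂ) (l : ℤ) (s : ℝ) : ℂ :=
  ∫ t, F (polarExp (s, t)) * Complex.exp (-(l * (t * Complex.I))) ∂angularMeasure

theorem conj_mul_polarFun (F : ℂ → ℂ) (a : ℝ → ℝ) (l : ℤ) (p : ℝ × ℝ) :
    (starRingEnd ℂ) (F (polarExp p)) * polarFun a l (polarExp p) =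
      a p.1 * (starRingEnd ℂ) (F (polarExp p) * Complex.exp (-(l * (p.2 * Complex.I)))) := by
  rw [polarExp, polarFun_exp, map_mul, ← Complex.exp_conj]
  have : (starRingEnd ℂ) (-(l * (p.2 * Complex.I))) = l * (p.2 * Complex.I) := by
    simp
  rw [this]
  ring

/-- Fubini in logarithmic polar coordinates: the angular integration produces the conjugate of the
Fourier coefficient. -/
theorem inner_polar (F : L2) {a : ℝ → ℝ} {l : ℤ} (h : MemLp (polarFun a l) 2 volume) :
    ⟪F, h.toLp _⟫_ℂ = ∫ s, ((Real.exp (2 * s) * a s : ℝ) : ℂ) * (starRingEnd ℂ) (angCoeff F l s) ∧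
    Integrable fun s => ((Real.exp (2 * s) * a s : ℝ) : ℂ) * (starRingEnd ℂ) (angCoeff F l s) := by
  have hint : Integrable fun z => (starRingEnd ℂ) (F z) * polarFun a l z := by
    have := L2.integrable_inner (𝕜 := ℂ) F (h.toLp _)
    refine this.congr ?_
    filter_upwards [h.coeFn_toLp] with z hz
    rw [hz, RCLike.inner_apply, mul_comm]
  have hp := integrable_polarExp hint
  have hin : ∀ s, ∫ t, (starRingEnd ℂ) (F (polarExp (s, t))) * polarFun a l (polarExp (s, t))
      ∂angularMeasure = a s * (starRingEnd ℂ) (angCoeff F l s) := by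
    intro s
    simp only [conj_mul_polarFun]
    rw [integral_const_mul, integral_conj]
    rfl
  have e : ∀ s, ((Real.exp (2 * s) * a s : ℝ) : ℂ) * (starRingEnd ℂ) (angCoeff F l s) =
      Real.exp (2 * s) • (a s * (starRingEnd ℂ) (angCoeff F l s)) := by
    intro s
    rw [Complex.real_smul]
    push_cast
    ring
  simp only [e]
  constructor
  · rw [inner_toLp, integral_polarExp hint.aestronglyMeasurable, integral_prod _ hp]
    simp only [hin]
    rw [integral_radialMeasure]
  · rw [← integrable_radialMeasure]
    have := hp.integral_prod_left
    simpa only [hin] using this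

theorem angCoeff_congr {F G : ℂ → ℂ} (h : F =ᵐ[volume] G) (l : ℤ) :
    ∀ᵐ s, angCoeff F l s = angCoeff G l s := by
  have h1 := measurePreserving_polarExp.quasiMeasurePreserving.ae_eq h
  have h2 := Measure.ae_ae_of_ae_prod h1
  rw [ae_radialMeasure] at h2
  filter_upwards [h2] with s hs
  refine integral_congr_ae ?_
  filter_upwards [hs] with t ht
  simp only [Function.comp_apply] at ht
  rw [ht]

theorem angCoeff_polarFun (a : ℝ → ℝ) (l : ℤ) (s : ℝ) :
    angCoeff (polarFun a l) l s = 2 * Real.pi * a s := by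
  have : ∀ t : ℝ, polarFun a l (polarExp (s, t)) * Complex.exp (-(l * (t * Complex.I))) =
      a s * 1 := by
    intro t
    rw [polarExp, polarFun_exp, mul_assoc, ← Complex.exp_add]
    simp
  simp only [angCoeff, this]
  rw [integral_const_mul, integral_angularMeasure_one]
  ring

theorem inner_polar_polar {a b : ℝ → ℝ} {l : ℤ} (ha : MemLp (polarFun a l) 2 volume)
    (hb : MemLp (polarFun b l) 2 volume) :
    ⟪ha.toLp _, hb.toLp _⟫_ℂ = ((2 * Real.pi * ∫ s, Real.exp (2 * s) * (a s * b s) : ℝ) : ℂ) := by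
  rw [(inner_polar _ hb).1]
  have h := angCoeff_congr ha.coeFn_toLp l
  rw [← integral_const_mul, ← integral_complex_ofReal]
  refine integral_congr_ae ?_
  filter_upwards [h] with s hs
  rw [hs, angCoeff_polarFun]
  simp only [map_mul, Complex.conj_ofReal, map_ofNat]
  push_cast
  ring

theorem polar_mem_sector {a : ℝ → ℝ} {l : ℤ} (ha : MemLp (polarFun a l) 2 volume) :
    ha.toLp _ ∈ sector l := by
  rw [mem_sector_iff]
  intro θ
  apply Lp.ext
  have h := (rotation (Circle.exp θ)).measurePreserving.quasiMeasurePreserving.ae_eq ha.coeFn_toLp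
  filter_upwards [rotate_coe θ (ha.toLp _), h, ha.coeFn_toLp, Lp.coeFn_smul
    (Complex.exp (Complex.I * l * θ)) (ha.toLp _)] with z h1 h2 h3 h4
  have e : rotation (Circle.exp θ) z = Complex.exp (θ * Complex.I) * z := by
    simp [rotation_apply]
  simp only [Function.comp_apply, e] at h2
  rw [h1, h2, h4, Pi.smul_apply, h3, polarFun_mul _ _ (Complex.exp_ne_zero _),
    Complex.norm_exp_ofReal_mul_I]
  simp only [Real.log_one, add_zero, Complex.ofReal_one, div_one, smul_eq_mul]
  rw [← Complex.exp_int_mul]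
  congr 2
  ring

/-- A smooth profile vanishing for large `s` whose radial image is square integrable gives an
element of the domain of the adjoint. -/
theorem polar_mem_adjoint (lam : ℝ) {a : ℝ → ℝ} {l : ℤ} (ha : ContDiff ℝ ∞ a) {R : ℝ}
    (hR : ∀ s, R ≤ s → a s = 0) (h : MemLp (polarFun a l) 2 volume)
    (h' : MemLp (polarFun (radialOp lam l a) l) 2 volume) :
    (h.toLp _, h'.toLp _) ∈ (abOperator lam).adjoint.graph := by
  rw [mem_adjoint_iff_test]
  intro φ
  have hnear : ∀ ψ : testFunctions, ∃ N : ℝ, ∀ z, ψ.1 z ≠ 0 → N < Real.log ‖z‖ := by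
    intro ψ
    have h0 : ∀ᶠ z in 𝓝 (0 : ℂ), ψ.1 z = 0 := notMem_tsupport_iff_eventuallyEq.1 ψ.2.2.2
    obtain ⟨ε, hε, hball⟩ := Metric.eventually_nhds_iff.1 h0
    refine ⟨Real.log (ε / 2), fun z hz => ?_⟩
    refine Real.log_lt_log (half_pos hε) ?_
    by_contra hcon
    refine hz (hball ?_)
    rw [dist_zero_right]
    linarith
  obtain ⟨N₁, hN₁⟩ := hnear φ
  obtain ⟨N₂, hN₂⟩ := hnear (formalOperator lam φ)
  -- The cutoff `ξ` rises between `N` and `N + 1 = min N₁ N₂`, below which both `φ` and its image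
  -- vanish. So `a` may be replaced by the compactly supported `b = ξ a`, and the claim becomes
  -- symmetry on test functions.
  set N := min N₁ N₂ - 1 with hN
  let ξ : ℝ → ℝ := fun s => Real.smoothTransition (s - N)
  have hξ : ContDiff ℝ ∞ ξ := Real.smoothTransition.contDiff.comp (contDiff_id.sub contDiff_const)
  have hξ0 : ∀ s, s ≤ N → ξ s = 0 := fun s hs =>
    Real.smoothTransition.zero_of_nonpos (by linarith)
  have hξ1 : ∀ s, N + 1 ≤ s → ξ s = 1 := fun s hs =>
    Real.smoothTransition.one_of_one_le (by linarith)
  set b : ℝ → ℝ := fun s => ξ s * a s with hb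
  have hbd : ContDiff ℝ ∞ b := hξ.mul ha
  have hbc : HasCompactSupport b := by
    refine HasCompactSupport.intro (isCompact_Icc (a := N) (b := R)) fun s hs => ?_
    rw [Set.mem_Icc, not_and_or, not_le, not_le] at hs
    rcases hs with hs | hs
    · simp [hb, hξ0 s hs.le]
    · simp [hb, hR s hs.le]
  have hba : ∀ s, N + 1 < s → b =ᶠ[𝓝 s] a := fun s hs => by
    filter_upwards [lt_mem_nhds hs] with u hu
    simp [hb, hξ1 u hu.le]
  have hrad : ∀ s, N + 1 < s → radialOp lam l b s = radialOp lam l a s := fun s hs => by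
    rw [radialOp, radialOp, (hba s hs).deriv.deriv_eq, (hba s hs).eq_of_nhds]
  have key := inner_formalOperator lam (polarTest b l hbd hbc) φ
  rw [inner_testToL2, inner_testToL2, formalOperator_polarTest] at key
  have e1 : ⟪h'.toLp _, testToL2 φ⟫_ℂ =
      ∫ z, (starRingEnd ℂ) (polarFun (radialOp lam l b) l z) * φ.1 z := by
    refine (inner_toLp_toLp h' (memLp_testFunction φ)).trans ?_
    refine integral_congr_ae (ae_of_all _ fun z => ?_)
    by_cases hz : φ.1 z = 0
    · simp [hz]
    · have hz' := hN₁ z hz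
      have : N + 1 < Real.log ‖z‖ := by
        rw [hN, sub_add_cancel]; exact (min_le_left _ _).trans_lt hz'
      simp only
      rw [polarFun_congr (hrad _ this).symm]
  have e2 : ⟪h.toLp _, testToL2 (formalOperator lam φ)⟫_ℂ =
      ∫ z, (starRingEnd ℂ) (polarFun b l z) * (formalOperator lam φ).1 z := by
    refine (inner_toLp_toLp h (memLp_testFunction (formalOperator lam φ))).trans ?_
    refine integral_congr_ae (ae_of_all _ fun z => ?_)
    by_cases hz : (formalOperator lam φ).1 z = 0
    · simp [hz]
    · have hz' := hN₂ z hz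
      have : N + 1 < Real.log ‖z‖ := by
        rw [hN, sub_add_cancel]; exact (min_le_right _ _).trans_lt hz'
      simp only
      rw [polarFun_congr (hba _ this).eq_of_nhds.symm]
  rw [e1, e2]
  exact key

/-! ### Boundary profiles -/

/-- A smooth radial profile which vanishes for large `s`, solves the homogeneous radial equation
for `s` near `-∞`, and gives a square integrable function. -/
structure IsProfile (lam : ℝ) (l : ℤ) (a : ℝ → ℝ) : Prop where
  smooth : ContDiff ℝ ∞ a
  zero : ∃ R, ∀ s, R ≤ s → a s = 0
  harmonic : ∃ r, ∀ s, s < r → deriv (deriv a) s = (l + lam) ^ 2 * a s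
  integrable : Integrable fun s => Real.exp (2 * s) * a s ^ 2

/-- The element `a(log r) e^{i l φ}` of `L²`, with the value `0` if it is not in `L²`. -/
def polarL2 (a : ℝ → ℝ) (l : ℤ) : L2 :=
  open Classical in if h : MemLp (polarFun a l) 2 volume then h.toLp _ else 0

theorem polarL2_eq {a : ℝ → ℝ} {l : ℤ} (h : MemLp (polarFun a l) 2 volume) :
    polarL2 a l = h.toLp _ := dif_pos h

theorem contDiff_radialOp (lam : ℝ) (l : ℤ) {a : ℝ → ℝ} (ha : ContDiff ℝ ∞ a) :
    ContDiff ℝ ∞ (radialOp lam l a) :=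
  (Real.contDiff_exp.comp (contDiff_const.mul contDiff_id).neg).mul
    ((contDiff_deriv (contDiff_deriv ha)).neg.add (contDiff_const.mul ha))

theorem radialOp_congr {lam : ℝ} {l : ℤ} {a b : ℝ → ℝ} {s : ℝ} (h : a =ᶠ[𝓝 s] b) :
    radialOp lam l a s = radialOp lam l b s := by
  rw [radialOp, radialOp, h.deriv.deriv_eq, h.eq_of_nhds]

theorem radialOp_zero_fun (lam : ℝ) (l : ℤ) (s : ℝ) : radialOp lam l (fun _ => 0) s = 0 := by
  simp [radialOp]

namespace IsProfile

variable {lam : ℝ} {l : ℤ} {a b : ℝ → ℝ}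

theorem memLp (h : IsProfile lam l a) (l' : ℤ) : MemLp (polarFun a l') 2 volume :=
  memLp_polarFun h.smooth.continuous.measurable h.integrable l'

theorem hasCompactSupport_radialOp (h : IsProfile lam l a) :
    HasCompactSupport (radialOp lam l a) := by
  obtain ⟨R, hR⟩ := h.zero
  obtain ⟨r, hr⟩ := h.harmonic
  refine HasCompactSupport.intro (isCompact_Icc (a := r) (b := R)) fun s hs => ?_
  rw [Set.mem_Icc, not_and_or, not_le, not_le] at hs
  rcases hs with hs | hs
  · rw [radialOp, hr s hs]; ring
  · rw [radialOp_congr (b := fun _ => 0), radialOp_zero_fun]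
    filter_upwards [lt_mem_nhds hs] with u hu using hR u hu.le

theorem integrable_radialOp (h : IsProfile lam l a) :
    Integrable fun s => Real.exp (2 * s) * radialOp lam l a s ^ 2 := by
  have hc := (contDiff_radialOp lam l h.smooth).continuous
  refine Continuous.integrable_of_hasCompactSupport (by fun_prop) ?_
  have : (fun s => Real.exp (2 * s) * radialOp lam l a s ^ 2) =
      fun s => (Real.exp (2 * s) * radialOp lam l a s) * radialOp lam l a s := by
    funext s; ring
  rw [this]
  exact h.hasCompactSupport_radialOp.mul_left

theorem memLp_radialOp (h : IsProfile lam l a) (l' : ℤ) :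
    MemLp (polarFun (radialOp lam l a) l') 2 volume :=
  memLp_polarFun (contDiff_radialOp lam l h.smooth).continuous.measurable h.integrable_radialOp l'

theorem mem_adjoint (h : IsProfile lam l a) :
    (polarL2 a l, polarL2 (radialOp lam l a) l) ∈ (abOperator lam).adjoint.graph := by
  rw [polarL2_eq (h.memLp l), polarL2_eq (h.memLp_radialOp l)]
  obtain ⟨R, hR⟩ := h.zero
  exact polar_mem_adjoint lam h.smooth hR (h.memLp l) (h.memLp_radialOp l)

end IsProfile

theorem polarL2_mem_sector (a : ℝ → ℝ) (l : ℤ) : polarL2 a l ∈ sector l := by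
  unfold polarL2
  split_ifs with h
  · exact polar_mem_sector h
  · exact (sector l).zero_mem

theorem polarL2_sub {a b : ℝ → ℝ} {l : ℤ} (c : ℝ) (ha : MemLp (polarFun a l) 2 volume)
    (hb : MemLp (polarFun b l) 2 volume) :
    polarL2 (fun s => a s - c * b s) l = polarL2 a l - (c : ℂ) • polarL2 b l := by
  have e : polarFun (fun s => a s - c * b s) l = polarFun a l - (c : ℂ) • polarFun b l := by
    funext z
    simp only [Pi.sub_apply, Pi.smul_apply, smul_eq_mul, polarFun]
    split_ifs
    · simp
    · push_cast; ring
  have h : MemLp (polarFun (fun s => a s - c * b s) l) 2 volume := by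
    rw [e]; exact ha.sub (hb.const_smul _)
  rw [polarL2_eq ha, polarL2_eq hb, polarL2_eq h, ← MemLp.toLp_const_smul, ← MemLp.toLp_sub]
  congr 1

/-- If two profiles are proportional near `-∞`, then the corresponding combination is in the
domain of the minimal operator. -/
theorem polarL2_sub_mem {lam : ℝ} {l : ℤ} {a b : ℝ → ℝ} {c : ℝ} (ha : IsProfile lam l a)
    (hb : IsProfile lam l b) (h : ∃ r, ∀ s, s < r → a s = c * b s) :
    polarL2 a l - (c : ℂ) • polarL2 b l ∈ (abOperator lam).domain := by
  rw [← polarL2_sub c (ha.memLp l) (hb.memLp l)]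
  have hs : ContDiff ℝ ∞ fun s => a s - c * b s := ha.smooth.sub (contDiff_const.mul hb.smooth)
  have hc : HasCompactSupport fun s => a s - c * b s := by
    obtain ⟨r, hr⟩ := h
    obtain ⟨R₁, h₁⟩ := ha.zero
    obtain ⟨R₂, h₂⟩ := hb.zero
    refine HasCompactSupport.intro (isCompact_Icc (a := r) (b := max R₁ R₂)) fun s hs => ?_
    rw [Set.mem_Icc, not_and_or, not_le, not_le] at hs
    rcases hs with hs | hs
    · simp [hr s hs]
    · rw [h₁ s ((le_max_left _ _).trans hs.le), h₂ s ((le_max_right _ _).trans hs.le)]; ring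
  have hm : MemLp (polarFun (fun s => a s - c * b s) l) 2 volume :=
    memLp_testFunction (polarTest _ l hs hc)
  rw [polarL2_eq hm]
  exact mem_domain_of_graph (test_mem_abOperator lam (polarTest _ l hs hc))

theorem inner_polarL2 {a b : ℝ → ℝ} {l : ℤ} (ha : MemLp (polarFun a l) 2 volume)
    (hb : MemLp (polarFun b l) 2 volume) :
    ⟪polarL2 a l, polarL2 b l⟫_ℂ =
      ((2 * Real.pi * ∫ s, Real.exp (2 * s) * (a s * b s) : ℝ) : ℂ) := by
  rw [polarL2_eq ha, polarL2_eq hb, inner_polar_polar]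

theorem norm_sq_polarL2 {a : ℝ → ℝ} {l : ℤ} (ha : MemLp (polarFun a l) 2 volume) :
    ‖polarL2 a l‖ ^ 2 = 2 * Real.pi * ∫ s, Real.exp (2 * s) * (a s * a s) := by
  have h := inner_self_eq_norm_sq_to_K (𝕜 := ℂ) (polarL2 a l)
  rw [inner_polarL2 ha ha] at h
  exact (Complex.ofReal_injective (by rw [h]; push_cast; rfl)).symm

theorem polarL2_symm {lam : ℝ} {l : ℤ} {a : ℝ → ℝ} (ha : IsProfile lam l a) :
    ⟪polarL2 (radialOp lam l a) l, polarL2 a l⟫_ℂ =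
      ⟪polarL2 a l, polarL2 (radialOp lam l a) l⟫_ℂ := by
  rw [inner_polarL2 (ha.memLp l) (ha.memLp_radialOp l),
    inner_polarL2 (ha.memLp_radialOp l) (ha.memLp l)]
  simp only [mul_comm (a _)]

theorem inner_polarL2_of_ne {l l' : ℤ} (h : l ≠ l') (a b : ℝ → ℝ) :
    ⟪polarL2 a l, polarL2 b l'⟫_ℂ = 0 :=
  inner_sector_of_ne h (polarL2_mem_sector a l) (polarL2_mem_sector b l')

/-- The boundary form of two profiles is their Wronskian near `-∞`. -/
theorem polarL2_wronskian {lam : ℝ} {l : ℤ} {a b : ℝ → ℝ} {c : ℝ} (ha : IsProfile lam l a)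
    (hb : IsProfile lam l b)
    (h : ∃ r, ∀ s, s < r → a s * deriv b s - deriv a s * b s = c) (hc : c ≠ 0) :
    ⟪polarL2 (radialOp lam l a) l, polarL2 b l⟫_ℂ ≠
      ⟪polarL2 a l, polarL2 (radialOp lam l b) l⟫_ℂ := by
  rw [inner_polarL2 (ha.memLp_radialOp l) (hb.memLp l),
    inner_polarL2 (ha.memLp l) (hb.memLp_radialOp l)]
  intro heq
  have h1 : ∫ s, Real.exp (2 * s) * (radialOp lam l a s * b s) =
      ∫ s, Real.exp (2 * s) * (a s * radialOp lam l b s) := by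
    have := Complex.ofReal_injective heq
    exact mul_left_cancel₀ (by positivity) this
  have ca := ha.smooth.continuous
  have cb := hb.smooth.continuous
  have cra := (contDiff_radialOp lam l ha.smooth).continuous
  have crb := (contDiff_radialOp lam l hb.smooth).continuous
  have i1 : Integrable fun s => Real.exp (2 * s) * (radialOp lam l a s * b s) :=
    Continuous.integrable_of_hasCompactSupport (by fun_prop)
      (ha.hasCompactSupport_radialOp.mul_right.mul_left)
  have i2 : Integrable fun s => Real.exp (2 * s) * (a s * radialOp lam l b s) :=
    Continuous.integrable_of_hasCompactSupport (by fun_prop)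
      (hb.hasCompactSupport_radialOp.mul_left.mul_left)
  -- The difference of the two integrands is the derivative of the Wronskian `W`, which is `c` near
  -- `-∞` and `0` near `∞`. Equality of the integrals would force `c = 0`.
  set W : ℝ → ℝ := fun s => a s * deriv b s - deriv a s * b s with hW
  have hd : ∀ s, HasDerivAt W (Real.exp (2 * s) * (radialOp lam l a s * b s) -
      Real.exp (2 * s) * (a s * radialOp lam l b s)) s := by
    intro s
    have e1 : HasDerivAt a (deriv a s) s := (ha.smooth.differentiable (by simp) s).hasDerivAt
    have e2 : HasDerivAt b (deriv b s) s := (hb.smooth.differentiable (by simp) s).hasDerivAt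
    have e3 : HasDerivAt (deriv a) (deriv (deriv a) s) s :=
      ((contDiff_deriv ha.smooth).differentiable (by simp) s).hasDerivAt
    have e4 : HasDerivAt (deriv b) (deriv (deriv b) s) s :=
      ((contDiff_deriv hb.smooth).differentiable (by simp) s).hasDerivAt
    refine ((e1.mul e4).sub (e3.mul e2)).congr_deriv ?_
    have : Real.exp (2 * s) * Real.exp (-(2 * s)) = 1 := by rw [← Real.exp_add]; simp
    simp only [radialOp]
    linear_combination (-(deriv (deriv b) s * a s) + deriv (deriv a) s * b s) * this
  have hbot : Tendsto W atBot (𝓝 c) := by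
    obtain ⟨r, hr⟩ := h
    refine tendsto_const_nhds.congr' ?_
    filter_upwards [eventually_lt_atBot r] with s hs using (hr s hs).symm
  have htop : Tendsto W atTop (𝓝 0) := by
    obtain ⟨R, hR⟩ := ha.zero
    refine tendsto_const_nhds.congr' ?_
    filter_upwards [eventually_gt_atTop R] with s hs
    have : a =ᶠ[𝓝 s] fun _ => 0 := by
      filter_upwards [lt_mem_nhds hs] with u hu using hR u hu.le
    simp only [hW, this.deriv_eq, this.eq_of_nhds]
    simp
  have := integral_of_hasDerivAt_of_tendsto hd (i1.sub i2) hbot htop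
  rw [integral_sub i1 i2, h1, sub_self] at this
  apply hc
  linarith

/-! ### Cutoffs, powers and the logarithm -/

/-- A smooth cutoff, equal to `1` near `-∞` and to `0` near `∞`. -/
structure IsCutoff (χ : ℝ → ℝ) : Prop where
  smooth : ContDiff ℝ ∞ χ
  bound : ∀ s, |χ s| ≤ 1
  one : ∃ r, ∀ s, s < r → χ s = 1
  zero : ∃ R, ∀ s, R ≤ s → χ s = 0

/-- The standard cutoff. -/
def cut (s : ℝ) : ℝ := Real.smoothTransition (1 - s)

theorem cut_of_nonpos {s : ℝ} (hs : s ≤ 0) : cut s = 1 :=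
  Real.smoothTransition.one_of_one_le (by linarith)

theorem cut_of_one_le {s : ℝ} (hs : 1 ≤ s) : cut s = 0 :=
  Real.smoothTransition.zero_of_nonpos (by linarith)

theorem abs_cut_le (s : ℝ) : |cut s| ≤ 1 := by
  unfold cut
  rw [abs_of_nonneg (Real.smoothTransition.nonneg _)]
  exact Real.smoothTransition.le_one _

theorem contDiff_cut : ContDiff ℝ ∞ cut :=
  Real.smoothTransition.contDiff.comp (contDiff_const.sub contDiff_id)

theorem isCutoff_cut_comp {p : ℝ} (hp : 0 < p) (q : ℝ) : IsCutoff fun s => cut (p * s + q) where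
  smooth := contDiff_cut.comp ((contDiff_const.mul contDiff_id).add contDiff_const)
  bound s := abs_cut_le _
  one := ⟨-q / p, fun s hs => cut_of_nonpos (by rw [lt_div_iff₀ hp] at hs; linarith)⟩
  zero := ⟨(1 - q) / p, fun s hs => cut_of_one_le (by rw [div_le_iff₀ hp] at hs; linarith)⟩

theorem isCutoff_cut : IsCutoff cut := by
  simpa using isCutoff_cut_comp one_pos 0

/-- The profile of `r ^ k` near the origin. -/
def powProfile (χ : ℝ → ℝ) (k s : ℝ) : ℝ := χ s * Real.exp (k * s)

/-- The profile of `log r` near the origin. -/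
def logProfile (s : ℝ) : ℝ := cut s * s

/-- Square integrability at the origin amounts to `2 + 2k > 0`; near infinity the profile vanishes.
-/
theorem isProfile_of_bound {lam : ℝ} {l : ℤ} {a : ℝ → ℝ} (hs : ContDiff ℝ ∞ a)
    (hz : ∃ R, ∀ s, R ≤ s → a s = 0)
    (hh : ∃ r, ∀ s, s < r → deriv (deriv a) s = (l + lam) ^ 2 * a s) {k C : ℝ} (hk : -1 < k)
    (hb : ∀ s, |a s| ≤ C * Real.exp (k * s)) : IsProfile lam l a := by
  refine ⟨hs, hz, hh, ?_⟩
  obtain ⟨R, hR⟩ := hz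
  have h1 : IntegrableOn (fun s => Real.exp ((2 + 2 * k) * s)) (Set.Iic R) :=
    integrableOn_exp_mul_Iic (by linarith) R
  have h2 : Integrable ((Set.Iic R).indicator fun s => C ^ 2 * Real.exp ((2 + 2 * k) * s)) :=
    IntegrableOn.integrable_indicator (h1.const_mul (C ^ 2)) measurableSet_Iic
  have hc := hs.continuous
  refine h2.mono' (by fun_prop) (ae_of_all _ fun s => ?_)
  rw [Real.norm_eq_abs, abs_of_nonneg (by positivity)]
  by_cases h : s ≤ R
  · rw [Set.indicator_of_mem (by exact h)]
    have h3 := pow_le_pow_left₀ (abs_nonneg _) (hb s) 2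
    rw [sq_abs] at h3
    calc Real.exp (2 * s) * a s ^ 2 ≤ Real.exp (2 * s) * (C * Real.exp (k * s)) ^ 2 := by gcongr
      _ = C ^ 2 * Real.exp ((2 + 2 * k) * s) := by
        rw [mul_pow, ← Real.exp_nat_mul, mul_left_comm, ← Real.exp_add]
        congr 2
        push_cast; ring
  · rw [hR s (not_le.1 h).le, Set.indicator_of_notMem (by exact h)]
    simp

theorem deriv_exp_mul (k s : ℝ) :
    deriv (fun s => Real.exp (k * s)) s = k * Real.exp (k * s) := by
  have := ((hasDerivAt_id s).const_mul k).exp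
  simpa [mul_comm] using this.deriv

theorem powProfile_eventuallyEq {χ : ℝ → ℝ} (h : IsCutoff χ) (k : ℝ) :
    ∃ r, ∀ s, s < r → powProfile χ k =ᶠ[𝓝 s] fun s => Real.exp (k * s) := by
  obtain ⟨r, hr⟩ := h.one
  refine ⟨r, fun s hs => ?_⟩
  filter_upwards [gt_mem_nhds hs] with u hu
  rw [powProfile, hr u hu, one_mul]

theorem isProfile_powProfile {χ : ℝ → ℝ} (h : IsCutoff χ) {lam k : ℝ} {l : ℤ} (hk : -1 < k)
    (hkl : k ^ 2 = (l + lam) ^ 2) : IsProfile lam l (powProfile χ k) := by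
  obtain ⟨r, hr⟩ := powProfile_eventuallyEq h k
  obtain ⟨R, hR⟩ := h.zero
  refine isProfile_of_bound (k := k) (C := 1) ?_ ⟨R, fun s hs => ?_⟩ ⟨r, fun s hs => ?_⟩ hk
    fun s => ?_
  · exact h.smooth.mul (Real.contDiff_exp.comp (contDiff_const.mul contDiff_id))
  · rw [powProfile, hR s hs, zero_mul]
  · rw [(hr s hs).deriv.deriv_eq, (hr s hs).eq_of_nhds]
    have : deriv (fun s => Real.exp (k * s)) = fun s => k * Real.exp (k * s) :=
      funext fun s => deriv_exp_mul k s
    rw [this, deriv_const_mul_field, deriv_exp_mul, ← hkl]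
    ring
  · rw [powProfile, abs_mul, abs_of_pos (Real.exp_pos _)]
    exact mul_le_mul_of_nonneg_right (h.bound s) (Real.exp_pos _).le

theorem logProfile_eventuallyEq {s : ℝ} (hs : s < 0) : logProfile =ᶠ[𝓝 s] id := by
  filter_upwards [gt_mem_nhds hs] with u hu
  rw [logProfile, cut_of_nonpos (le_of_lt hu), one_mul, id]

theorem isProfile_logProfile {lam : ℝ} {l : ℤ} (hl : l + lam = 0) :
    IsProfile lam l logProfile := by
  -- Any exponent strictly between `-1` and `0` dominates the logarithm at the origin. With `-1/2`
  -- the constant `2` works, since `2 e^{-s/2} ≥ 2 - s ≥ |s|` for `s ≤ 1`.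
  refine isProfile_of_bound (k := -(1 / 2)) (C := 2) (contDiff_cut.mul contDiff_id)
    ⟨1, fun s hs => ?_⟩ ⟨0, fun s hs => ?_⟩ (by norm_num) fun s => ?_
  · rw [logProfile, cut_of_one_le hs, zero_mul]
  · rw [(logProfile_eventuallyEq hs).deriv.deriv_eq, hl]
    have : deriv (id : ℝ → ℝ) = fun _ => 1 := funext fun s => deriv_id s
    rw [this]
    simp
  · rw [logProfile, abs_mul]
    have hexp := Real.add_one_le_exp (-(1 / 2) * s)
    rcases le_or_gt s 1 with h | h
    · have : |s| ≤ 2 * Real.exp (-(1 / 2) * s) := by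
        rw [abs_le]; constructor <;> linarith
      calc |cut s| * |s| ≤ 1 * |s| := by gcongr; exact abs_cut_le s
        _ ≤ _ := by linarith
    · rw [cut_of_one_le h.le]
      simp [Real.exp_nonneg]

theorem wronskian_pow {k : ℝ} : ∃ r, ∀ s, s < r →
    powProfile cut k s * deriv (powProfile cut (-k)) s -
      deriv (powProfile cut k) s * powProfile cut (-k) s = -2 * k := by
  obtain ⟨r₁, h₁⟩ := powProfile_eventuallyEq isCutoff_cut k
  obtain ⟨r₂, h₂⟩ := powProfile_eventuallyEq isCutoff_cut (-k)
  refine ⟨min r₁ r₂, fun s hs => ?_⟩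
  have e1 := h₁ s (hs.trans_le (min_le_left _ _))
  have e2 := h₂ s (hs.trans_le (min_le_right _ _))
  rw [e1.deriv_eq, e2.deriv_eq, e1.eq_of_nhds, e2.eq_of_nhds, deriv_exp_mul, deriv_exp_mul]
  have : Real.exp (k * s) * Real.exp (-k * s) = 1 := by rw [← Real.exp_add]; simp
  linear_combination (-2 * k) * this

theorem wronskian_log : ∃ r, ∀ s, s < r →
    powProfile cut 0 s * deriv logProfile s - deriv (powProfile cut 0) s * logProfile s = 1 := by
  obtain ⟨r₁, h₁⟩ := powProfile_eventuallyEq isCutoff_cut 0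
  refine ⟨min r₁ 0, fun s hs => ?_⟩
  have e1 := h₁ s (hs.trans_le (min_le_left _ _))
  have e2 := logProfile_eventuallyEq (hs.trans_le (min_le_right _ _))
  rw [e1.deriv_eq, e2.deriv_eq, e1.eq_of_nhds, e2.eq_of_nhds, deriv_exp_mul]
  simp

/-! ### Approximation of the boundary profiles -/

/-- Homogeneity of degree `-2`, as dilations are translations in `s`. -/
theorem radialOp_shift (lam : ℝ) (l : ℤ) (a : ℝ → ℝ) (c τ s : ℝ) :
    radialOp lam l (fun s => c * a (s + τ)) s =
      c * Real.exp (2 * τ) * radialOp lam l a (s + τ) := by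
  have h1 : deriv (fun s => c * a (s + τ)) = fun s => c * deriv a (s + τ) := by
    funext s
    rw [deriv_const_mul_field, deriv_comp_add_const]
  have h2 : Real.exp (-(2 * s)) = Real.exp (2 * τ) * Real.exp (-(2 * (s + τ))) := by
    rw [← Real.exp_add]; congr 1; ring
  rw [radialOp, radialOp, h1, deriv_const_mul_field, deriv_comp_add_const, h2]
  ring

theorem integral_exp_mul_shift (f : ℝ → ℝ) (τ : ℝ) :
    ∫ s, Real.exp (2 * s) * f (s + τ) = Real.exp (-(2 * τ)) * ∫ s, Real.exp (2 * s) * f s := by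
  rw [← integral_const_mul, 
    ← integral_add_right_eq_self (fun s => Real.exp (-(2 * τ)) * (Real.exp (2 * s) * f s)) τ]
  congr 1
  funext s
  rw [← mul_assoc, ← Real.exp_add]
  congr 2
  ring

/-- Moving the cutoff of `r^k` is the same as dilating the profile, up to a factor; norms and
energies then scale explicitly. -/
theorem powProfile_shift (k τ : ℝ) :
    powProfile (fun s => cut (1 * s + τ)) k =
      fun s => Real.exp (-(k * τ)) * powProfile cut k (s + τ) := by
  funext s
  rw [powProfile, powProfile, one_mul, mul_left_comm, ← Real.exp_add]
  congr 2
  ring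

theorem tendsto_exp_neg_mul {c : ℝ} (hc : 0 < c) :
    Tendsto (fun n : ℕ => Real.exp (-(c * n))) atTop (𝓝 0) :=
  Real.tendsto_exp_neg_atTop_nhds_zero.comp
    (tendsto_natCast_atTop_atTop.const_mul_atTop hc)

theorem deriv_deriv_cut_of_neg {s : ℝ} (hs : s < 0) : deriv (deriv cut) s = 0 := by
  have : cut =ᶠ[𝓝 s] fun _ => 1 := by
    filter_upwards [gt_mem_nhds hs] with u hu using cut_of_nonpos (le_of_lt hu)
  rw [this.deriv.deriv_eq]; simp

theorem exists_deriv_deriv_cut_bound : ∃ C, ∀ s, |deriv (deriv cut) s| ≤ C := by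
  have hc : Continuous (deriv (deriv cut)) :=
    (contDiff_deriv (contDiff_deriv contDiff_cut)).continuous
  have hcs : HasCompactSupport (deriv (deriv cut)) := by
    refine HasCompactSupport.intro (isCompact_Icc (a := 0) (b := 1)) fun s hs => ?_
    rw [Set.mem_Icc, not_and_or, not_le, not_le] at hs
    rcases hs with hs | hs
    · exact deriv_deriv_cut_of_neg hs
    · have : cut =ᶠ[𝓝 s] fun _ => 0 := by
        filter_upwards [lt_mem_nhds hs] with u hu using cut_of_one_le (le_of_lt hu)
      rw [this.deriv.deriv_eq]; simp
  obtain ⟨C, hC⟩ := hcs.exists_bound_of_continuous hc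
  exact ⟨C, hC⟩

theorem radialOp_powProfile_zero {lam : ℝ} {l : ℤ} (hl : (l : ℝ) + lam = 0) (p q s : ℝ) :
    radialOp lam l (powProfile (fun s => cut (p * s + q)) 0) s =
      -(p ^ 2 * Real.exp (-(2 * s)) * deriv (deriv cut) (p * s + q)) := by
  have hp : ∀ f : ℝ → ℝ, Differentiable ℝ f →
      deriv (fun s => f (p * s + q)) = fun s => p * deriv f (p * s + q) := fun f hf => by
    funext s
    have h1 : HasDerivAt (fun s : ℝ => p * s + q) p s := by
      simpa using ((hasDerivAt_id s).const_mul p).add_const q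
    have h2 := (hf (p * s + q)).hasDerivAt.comp s h1
    rw [mul_comm]
    exact h2.deriv
  have e : powProfile (fun s => cut (p * s + q)) 0 = fun s => cut (p * s + q) := by
    funext s; simp [powProfile]
  rw [radialOp, e, hl, hp _ (contDiff_cut.differentiable (by simp)), deriv_const_mul_field,
    hp _ ((contDiff_deriv contDiff_cut).differentiable (by simp))]
  ring

/-- The logarithmic cutoff. For exponent `0` the weights `e^{2s}` and `e^{-2s}` cancel, and
stretching the cutoff by `n + 1` divides the Dirichlet energy by `n + 1`: points have zero capacity
in the plane. -/
theorem tendsto_energy_zero {lam : ℝ} {l : ℤ} (hl : (l : ℝ) + lam = 0) (q : ℝ) :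
    Tendsto (fun n : ℕ => ∫ s, Real.exp (2 * s) *
      (powProfile (fun s => cut ((n + 1 : ℝ)⁻¹ * s + q)) 0 s *
        radialOp lam l (powProfile (fun s => cut ((n + 1 : ℝ)⁻¹ * s + q)) 0) s)) atTop (𝓝 0) := by
  have h : ∀ n : ℕ, ∫ s, Real.exp (2 * s) *
      (powProfile (fun s => cut ((n + 1 : ℝ)⁻¹ * s + q)) 0 s *
        radialOp lam l (powProfile (fun s => cut ((n + 1 : ℝ)⁻¹ * s + q)) 0) s) =
      (1 / (n + 1 : ℝ)) * ∫ s, -(cut (s + q) * deriv (deriv cut) (s + q)) := by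
    intro n
    have hn : (0 : ℝ) < n + 1 := by positivity
    have e : ∀ s, Real.exp (2 * s) * (powProfile (fun s => cut ((n + 1 : ℝ)⁻¹ * s + q)) 0 s *
        radialOp lam l (powProfile (fun s => cut ((n + 1 : ℝ)⁻¹ * s + q)) 0) s) =
        ((n + 1 : ℝ)⁻¹) ^ 2 * (fun s => -(cut (s + q) * deriv (deriv cut) (s + q)))
          ((n + 1 : ℝ)⁻¹ * s) := by
      intro s
      rw [radialOp_powProfile_zero hl]
      have : Real.exp (2 * s) * Real.exp (-(2 * s)) = 1 := by rw [← Real.exp_add]; simp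
      simp only [powProfile, zero_mul, Real.exp_zero, mul_one]
      linear_combination (-(cut ((n + 1 : ℝ)⁻¹ * s + q) * ((n + 1 : ℝ)⁻¹) ^ 2 *
        deriv (deriv cut) ((n + 1 : ℝ)⁻¹ * s + q))) * this
    simp only [e]
    rw [integral_const_mul, Measure.integral_comp_mul_left
      (fun s => -(cut (s + q) * deriv (deriv cut) (s + q))), inv_inv, abs_of_pos hn, smul_eq_mul]
    field_simp
  simp only [h]
  simpa using tendsto_one_div_add_atTop_nhds_zero_nat.mul_const
    (∫ s, -(cut (s + q) * deriv (deriv cut) (s + q)))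

theorem integral_exp_mul_of_shift {f g : ℝ → ℝ} {c τ : ℝ}
    (h : ∀ s, f s = Real.exp c * g (s + τ)) :
    ∫ s, Real.exp (2 * s) * f s = Real.exp (c - 2 * τ) * ∫ s, Real.exp (2 * s) * g s := by
  have e : ∀ s, Real.exp (2 * s) * f s = Real.exp c * (Real.exp (2 * s) * g (s + τ)) := by
    intro s; rw [h]; ring
  simp only [e]
  rw [integral_const_mul, integral_exp_mul_shift, ← mul_assoc, ← Real.exp_add, ← sub_eq_add_neg]

theorem integral_mul_powProfile_shift (k τ : ℝ) :
    ∫ s, Real.exp (2 * s) * (powProfile (fun s => cut (1 * s + τ)) k s *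
      powProfile (fun s => cut (1 * s + τ)) k s) = Real.exp (-((2 * k + 2) * τ)) *
      ∫ s, Real.exp (2 * s) * (powProfile cut k s * powProfile cut k s) := by
  rw [show -((2 * k + 2) * τ) = (-(k * τ) + -(k * τ)) - 2 * τ by ring]
  refine integral_exp_mul_of_shift (g := fun s => powProfile cut k s * powProfile cut k s)
    fun s => ?_
  rw [powProfile_shift, Real.exp_add]
  ring

theorem integral_energy_powProfile_shift (lam : ℝ) (l : ℤ) (k τ : ℝ) :
    ∫ s, Real.exp (2 * s) * (powProfile (fun s => cut (1 * s + τ)) k s *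
      radialOp lam l (powProfile (fun s => cut (1 * s + τ)) k) s) =
      Real.exp (-((2 * k) * τ)) *
      ∫ s, Real.exp (2 * s) * (powProfile cut k s * radialOp lam l (powProfile cut k) s) := by
  rw [show -((2 * k) * τ) = (-(k * τ) + -(k * τ) + 2 * τ) - 2 * τ by ring]
  refine integral_exp_mul_of_shift
    (g := fun s => powProfile cut k s * radialOp lam l (powProfile cut k) s) fun s => ?_
  rw [powProfile_shift, radialOp_shift, Real.exp_add, Real.exp_add]
  ring

theorem integral_image_powProfile_shift (lam : ℝ) (l : ℤ) (k τ : ℝ) :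
    ∫ s, Real.exp (2 * s) * (radialOp lam l (powProfile (fun s => cut (1 * s + τ)) k) s *
      radialOp lam l (powProfile (fun s => cut (1 * s + τ)) k) s) =
      Real.exp ((2 - 2 * k) * τ) *
      ∫ s, Real.exp (2 * s) * (radialOp lam l (powProfile cut k) s *
        radialOp lam l (powProfile cut k) s) := by
  rw [show (2 - 2 * k) * τ = (-(k * τ) + -(k * τ) + 2 * τ + 2 * τ) - 2 * τ by ring]
  refine integral_exp_mul_of_shift (g := fun s => radialOp lam l (powProfile cut k) s *
    radialOp lam l (powProfile cut k) s) fun s => ?_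
  rw [powProfile_shift, radialOp_shift, Real.exp_add, Real.exp_add, Real.exp_add]
  ring

/-- The cutoff is moved towards the origin. For `k > 0` a translation by `n` scales the squared norm
by `e^{-(2k+2)n}` and the energy by `e^{-2kn}`. For `k = 0` translation preserves the energy, so the
cutoff is stretched as well. -/
theorem exists_friedrichs_approx {lam k : ℝ} {l : ℤ} (hk : 0 ≤ k) (hkl : k ^ 2 = (l + lam) ^ 2) :
    ∃ χ : ℕ → ℝ → ℝ, (∀ n, IsCutoff (χ n)) ∧
      Tendsto (fun n => ∫ s, Real.exp (2 * s) *
        (powProfile (χ n) k s * powProfile (χ n) k s)) atTop (𝓝 0) ∧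
      Tendsto (fun n => ∫ s, Real.exp (2 * s) *
        (powProfile (χ n) k s * radialOp lam l (powProfile (χ n) k) s)) atTop (𝓝 0) := by
  rcases hk.eq_or_lt with rfl | hk
  · have hl : (l : ℝ) + lam = 0 := by
      rw [zero_pow two_ne_zero] at hkl
      exact pow_eq_zero_iff two_ne_zero |>.1 hkl.symm
    -- The shift `2` puts the support in `s ≤ -(n+1)`, so that the norm also tends to `0`.
    refine ⟨fun n s => cut ((n + 1 : ℝ)⁻¹ * s + 2), fun n => isCutoff_cut_comp (by positivity) 2,
      ?_, tendsto_energy_zero hl 2⟩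
    have hlim : Tendsto (fun n : ℕ => Real.exp (-(2 * n)) / 2) atTop (𝓝 0) := by
      simpa using (tendsto_exp_neg_mul two_pos).div_const 2
    refine squeeze_zero (fun n => integral_nonneg fun s => by
      have := mul_self_nonneg (powProfile (fun s => cut ((n + 1 : ℝ)⁻¹ * s + 2)) 0 s)
      positivity) (fun n => ?_) hlim
    have hn : (0 : ℝ) < n + 1 := by positivity
    have h1 : IntegrableOn (fun s : ℝ => Real.exp (2 * s)) (Set.Iic (-(n : ℝ))) :=
      integrableOn_exp_mul_Iic two_pos _
    have h2 : ∫ s in Set.Iic (-(n : ℝ)), Real.exp (2 * s) = Real.exp (-(2 * n)) / 2 := by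
      rw [integral_exp_mul_Iic two_pos]
      congr 2
      ring
    rw [← h2, ← integral_indicator measurableSet_Iic]
    refine integral_mono_of_nonneg (ae_of_all _ fun s => ?_)
      (h1.integrable_indicator measurableSet_Iic) (ae_of_all _ fun s => ?_)
    · have := mul_self_nonneg (powProfile (fun s => cut ((n + 1 : ℝ)⁻¹ * s + 2)) 0 s)
      simp only [Pi.zero_apply]
      positivity
    · simp only [powProfile, zero_mul, Real.exp_zero, mul_one]
      by_cases hs : s ≤ -(n : ℝ)
      · rw [Set.indicator_of_mem (by exact hs)]
        have := abs_cut_le ((n + 1 : ℝ)⁻¹ * s + 2)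
        have h3 : cut ((n + 1 : ℝ)⁻¹ * s + 2) * cut ((n + 1 : ℝ)⁻¹ * s + 2) ≤ 1 := by
          rw [← abs_mul_abs_self]
          exact mul_le_one₀ this (abs_nonneg _) this
        calc _ ≤ Real.exp (2 * s) * 1 := by gcongr
          _ = _ := mul_one _
      · rw [Set.indicator_of_notMem (by exact hs), cut_of_one_le, mul_zero, mul_zero]
        have h3 : -1 ≤ (n + 1 : ℝ)⁻¹ * s := by
          rw [inv_mul_eq_div, le_div_iff₀ hn]
          linarith [not_le.1 hs]
        linarith
  · refine ⟨fun n s => cut (1 * s + n), fun n => isCutoff_cut_comp one_pos _, ?_, ?_⟩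
    · simp only [integral_mul_powProfile_shift]
      simpa using (tendsto_exp_neg_mul (by linarith : 0 < 2 * k + 2)).mul_const
        (∫ s, Real.exp (2 * s) * (powProfile cut k s * powProfile cut k s))
    · simp only [integral_energy_powProfile_shift]
      simpa using (tendsto_exp_neg_mul (by linarith : 0 < 2 * k)).mul_const
        (∫ s, Real.exp (2 * s) * (powProfile cut k s * radialOp lam l (powProfile cut k) s))

/-- The cutoff is moved out to infinity. For `k < 0` a translation by `-n` scales the squared norm
of the image by `e^{-(2-2k)n}` and the energy by `e^{2kn}`; for `k = 0` the cutoff is stretched. -/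
theorem exists_krein_approx {lam k : ℝ} {l : ℤ} (hk : k ≤ 0) (hkl : k ^ 2 = (l + lam) ^ 2) :
    ∃ χ : ℕ → ℝ → ℝ, (∀ n, IsCutoff (χ n)) ∧
      Tendsto (fun n => ∫ s, Real.exp (2 * s) *
        (radialOp lam l (powProfile (χ n) k) s * radialOp lam l (powProfile (χ n) k) s))
        atTop (𝓝 0) ∧
      Tendsto (fun n => ∫ s, Real.exp (2 * s) *
        (powProfile (χ n) k s * radialOp lam l (powProfile (χ n) k) s)) atTop (𝓝 0) := by
  rcases hk.eq_or_lt with rfl | hk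
  · have hl : (l : ℝ) + lam = 0 := by
      rw [zero_pow two_ne_zero] at hkl
      exact pow_eq_zero_iff two_ne_zero |>.1 hkl.symm
    -- The shift `-1` places the transition in `n + 1 ≤ s ≤ 2(n + 1)`, where the factor `e^{-2s}`
    -- makes the image small.
    refine ⟨fun n s => cut ((n + 1 : ℝ)⁻¹ * s + (-1)),
      fun n => isCutoff_cut_comp (by positivity) (-1), ?_, tendsto_energy_zero hl (-1)⟩
    obtain ⟨C, hC⟩ := exists_deriv_deriv_cut_bound
    have hlim : Tendsto (fun n : ℕ => C ^ 2 * (Real.exp (-(2 * n)) / 2)) atTop (𝓝 0) := by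
      simpa using ((tendsto_exp_neg_mul two_pos).div_const 2).const_mul (C ^ 2)
    simp only [radialOp_powProfile_zero hl]
    refine squeeze_zero (fun n => integral_nonneg fun s =>
      mul_nonneg (Real.exp_pos _).le (mul_self_nonneg _)) (fun n => ?_) hlim
    have hn : (0 : ℝ) < n + 1 := by positivity
    have h1 : IntegrableOn (fun s : ℝ => Real.exp ((-2) * s)) (Set.Ioi (n : ℝ)) :=
      integrableOn_exp_mul_Ioi (by norm_num) _
    have h2 : ∫ s in Set.Ioi (n : ℝ), Real.exp ((-2) * s) = Real.exp (-(2 * n)) / 2 := by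
      rw [integral_exp_mul_Ioi (by norm_num)]
      rw [neg_mul]
      ring
    rw [← h2, ← integral_indicator measurableSet_Ioi, ← integral_const_mul]
    refine integral_mono_of_nonneg (ae_of_all _ fun s =>
      mul_nonneg (Real.exp_pos _).le (mul_self_nonneg _))
      ((h1.integrable_indicator measurableSet_Ioi).const_mul _) (ae_of_all _ fun s => ?_)
    simp only
    by_cases hs : (n : ℝ) < s
    · rw [Set.indicator_of_mem (by exact hs)]
      set D := deriv (deriv cut) ((n + 1 : ℝ)⁻¹ * s + -1) with hD
      have h3 : D ^ 2 ≤ C ^ 2 := by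
        rw [← sq_abs]
        exact pow_le_pow_left₀ (abs_nonneg _) (hC _) 2
      have h4 : ((n + 1 : ℝ)⁻¹) ^ 4 ≤ 1 := pow_le_one₀ (by positivity) (inv_le_one_of_one_le₀ (by linarith [n.cast_nonneg (α := ℝ)]))
      have h5 : Real.exp (2 * s) * Real.exp (-(2 * s)) = 1 := by rw [← Real.exp_add]; simp
      have h6 : Real.exp ((-2) * s) = Real.exp (-(2 * s)) := by congr 1; ring
      rw [h6]
      calc _ = ((n + 1 : ℝ)⁻¹) ^ 4 * (D ^ 2 * Real.exp (-(2 * s))) := by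
            linear_combination (((n + 1 : ℝ)⁻¹) ^ 4 * (D ^ 2 * Real.exp (-(2 * s)))) * h5
        _ ≤ 1 * (C ^ 2 * Real.exp (-(2 * s))) := by gcongr
        _ = _ := one_mul _
    · rw [Set.indicator_of_notMem (by exact hs), deriv_deriv_cut_of_neg, mul_zero]
      · simp
      · have : (n + 1 : ℝ)⁻¹ * s < 1 := by
          rw [inv_mul_eq_div, div_lt_one hn]
          linarith [not_lt.1 hs]
        linarith
  · refine ⟨fun n s => cut (1 * s + -n), fun n => isCutoff_cut_comp one_pos _, ?_, ?_⟩
    · simp only [integral_image_powProfile_shift]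
      simpa [mul_comm, neg_mul, sub_mul] using
        (tendsto_exp_neg_mul (by linarith : 0 < 2 - 2 * k)).mul_const
        (∫ s, Real.exp (2 * s) * (radialOp lam l (powProfile cut k) s *
          radialOp lam l (powProfile cut k) s))
    · simp only [integral_energy_powProfile_shift]
      simpa using (tendsto_exp_neg_mul (by linarith : 0 < -(2 * k))).mul_const
        (∫ s, Real.exp (2 * s) * (powProfile cut k s * radialOp lam l (powProfile cut k) s))

/-! ### Weak solutions of second order equations -/

theorem exists_Ioo_of_hasCompactSupport {η : ℝ → ℝ} (hc : HasCompactSupport η) :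
    ∃ N : ℝ, 0 < N ∧ ∀ s, N ≤ |s| → η s = 0 := by
  obtain ⟨R, hR⟩ := hc.isCompact.isBounded.exists_norm_le
  refine ⟨max R 0 + 1, by positivity, fun s hs => ?_⟩
  by_contra h
  have := hR s (subset_tsupport _ h)
  rw [Real.norm_eq_abs] at this
  linarith [le_max_left R 0]

theorem integral_eq_interval {f : ℝ → ℝ} {N : ℝ} (h0 : 0 < N) (h : ∀ s, N ≤ |s| → f s = 0) :
    ∫ s, f s = ∫ s in (-N)..N, f s := by
  rw [intervalIntegral.integral_of_le (by linarith)]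
  refine (setIntegral_eq_integral_of_forall_compl_eq_zero fun s hs => h s ?_).symm
  rw [Set.mem_Ioc, not_and_or, not_lt, not_le] at hs
  rcases hs with hs | hs
  · exact le_abs.2 (Or.inr (by linarith))
  · exact le_abs.2 (Or.inl hs.le)

/-- Integration by parts for a primitive that is only absolutely continuous, with Lebesgue
differentiation supplying its derivative almost everywhere. -/
theorem integral_primitive_mul_deriv {g : ℝ → ℝ} (hg : LocallyIntegrable g) {η : ℝ → ℝ}
    (hη : ContDiff ℝ ∞ η) (hc : HasCompactSupport η) :
    ∫ s, (∫ x in (0 : ℝ)..s, g x) * deriv η s = -∫ s, g s * η s := by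
  obtain ⟨N, hN0, hN⟩ := exists_Ioo_of_hasCompactSupport hc
  obtain ⟨M, hM0, hM⟩ := exists_Ioo_of_hasCompactSupport hc.deriv
  set R := max N M with hR
  have hR0 : 0 < R := hN0.trans_le (le_max_left _ _)
  have hi : IntervalIntegrable g volume (-R) R :=
    (hg.integrableOn_isCompact isCompact_uIcc).intervalIntegrable
  have hmem : (0 : ℝ) ∈ Set.uIcc (-R) R := by
    rw [Set.uIcc_of_le (by linarith)]; constructor <;> linarith
  have hac := hi.absolutelyContinuousOnInterval_intervalIntegral hmem
  have hηac : AbsolutelyContinuousOnInterval η (-R) R :=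
    ((hη.of_le (by simp)).contDiffOn).absolutelyContinuousOnInterval
  rw [integral_eq_interval hR0 fun s hs => by rw [hM s ((le_max_right _ _).trans hs), mul_zero],
    integral_eq_interval hR0 fun s hs => by rw [hN s ((le_max_left _ _).trans hs), mul_zero],
    hac.integral_mul_deriv_eq_deriv_mul hηac,
    hN R ((le_max_left _ _).trans (le_abs_self _)),
    hN (-R) ((le_max_left _ _).trans (by rw [abs_neg]; exact le_abs_self _))]
  simp only [mul_zero, sub_zero, zero_sub]
  congr 1
  refine intervalIntegral.integral_congr_ae ?_
  filter_upwards [LocallyIntegrable.ae_hasDerivAt_integral hg] with s hs _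
  rw [(hs 0).deriv]

theorem exists_primitive {ψ : ℝ → ℝ} (hψ : ContDiff ℝ ∞ ψ) (hc : HasCompactSupport ψ)
    (h0 : ∫ s, ψ s = 0) : ∃ η : ℝ → ℝ, ContDiff ℝ ∞ η ∧ HasCompactSupport η ∧ deriv η = ψ := by
  obtain ⟨N, hN0, hN⟩ := exists_Ioo_of_hasCompactSupport hc
  have hd : ∀ s, HasDerivAt (fun s => ∫ x in (-N)..s, ψ x) (ψ s) s := fun s =>
    intervalIntegral.integral_hasDerivAt_right (hψ.continuous.intervalIntegrable _ _)
      (hψ.continuous.stronglyMeasurableAtFilter _ _) hψ.continuous.continuousAt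
  have hde : deriv (fun s => ∫ x in (-N)..s, ψ x) = ψ := funext fun s => (hd s).deriv
  refine ⟨fun s => ∫ x in (-N)..s, ψ x, ?_, ?_, hde⟩
  · rw [contDiff_infty_iff_deriv, hde]
    exact ⟨fun s => (hd s).differentiableAt, hψ⟩
  · refine HasCompactSupport.intro (isCompact_Icc (a := -N) (b := N)) fun s hs => ?_
    rw [Set.mem_Icc, not_and_or, not_le, not_le] at hs
    rcases hs with hs | hs
    · rw [intervalIntegral.integral_zero_ae]
      refine ae_of_all _ fun x hx => hN x ?_
      rw [Set.uIoc_of_ge hs.le] at hx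
      exact le_abs.2 (Or.inr (by linarith [hx.2]))
    · rw [← intervalIntegral.integral_add_adjacent_intervals (b := N)
        (hψ.continuous.intervalIntegrable _ _) (hψ.continuous.intervalIntegrable _ _),
        ← integral_eq_interval hN0 hN, h0, zero_add, intervalIntegral.integral_zero_ae]
      refine ae_of_all _ fun x hx => hN x ?_
      rw [Set.uIoc_of_le hs.le] at hx
      exact le_abs.2 (Or.inl hx.1.le)

theorem integrable_mul_test {h ψ : ℝ → ℝ} (hh : LocallyIntegrable h) (hψ : Continuous ψ)
    (hc : HasCompactSupport ψ) : Integrable fun s => h s * ψ s := by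
  have := hh.integrable_smul_left_of_hasCompactSupport hψ hc
  simpa only [smul_eq_mul, mul_comm] using this

/-- A weak solution of `h'' = 0` is affine. -/
theorem ae_affine_of_weak {h : ℝ → ℝ} (hh : LocallyIntegrable h)
    (H : ∀ η : ℝ → ℝ, ContDiff ℝ ∞ η → HasCompactSupport η →
      ∫ s, h s * deriv (deriv η) s = 0) : ∃ A B : ℝ, ∀ᵐ s, h s = A + B * s := by
  let f : ContDiffBump (0 : ℝ) := ⟨1, 2, one_pos, one_lt_two⟩
  set ρ : ℝ → ℝ := f.normed volume with hρ
  have ρs : ContDiff ℝ ∞ ρ := f.contDiff_normed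
  have ρc : HasCompactSupport ρ := f.hasCompactSupport_normed
  have ρ1 : ∫ s, ρ s = 1 := f.integral_normed
  have ρi : Integrable ρ := ρs.continuous.integrable_of_hasCompactSupport ρc
  -- Subtracting multiples of the bump twice gives `ψ = η₂'' + α ρ + β ρ'`, so `∫ h ψ = α a + β b`.
  -- Integrating `s` by parts gives `β = α m - ∫ s ψ`, which identifies `h` with `a + m b - b s`.
  set a := ∫ s, h s * ρ s with ha
  set b := ∫ s, h s * deriv ρ s with hb
  set m := ∫ s, s * ρ s with hm
  refine ⟨a + m * b, -b, ?_⟩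
  refine ae_eq_of_integral_contDiff_smul_eq hh
    (by exact (by fun_prop : Continuous fun s : ℝ => a + m * b + -b * s).locallyIntegrable) ?_
  intro ψ ψs ψc
  have ψi : Integrable ψ := ψs.continuous.integrable_of_hasCompactSupport ψc
  set α := ∫ s, ψ s with hα
  obtain ⟨η₁, s₁, c₁, d₁⟩ := exists_primitive (ψ := fun s => ψ s - α * ρ s)
    (ψs.sub (contDiff_const.mul ρs)) (ψc.sub (ρc.mul_left (f := fun _ => α)))
    (by rw [integral_sub ψi (ρi.const_mul α), integral_const_mul, ρ1]; ring)
  have η₁i : Integrable η₁ := s₁.continuous.integrable_of_hasCompactSupport c₁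
  set β := ∫ s, η₁ s with hβ
  obtain ⟨η₂, s₂, c₂, d₂⟩ := exists_primitive (ψ := fun s => η₁ s - β * ρ s)
    (s₁.sub (contDiff_const.mul ρs)) (c₁.sub (ρc.mul_left (f := fun _ => β)))
    (by rw [integral_sub η₁i (ρi.const_mul β), integral_const_mul, ρ1]; ring)
  have hid : LocallyIntegrable fun s : ℝ => s := continuous_id.locallyIntegrable
  have e1 : β = -(∫ s, s * ψ s) + α * m := by
    have h1 := integral_primitive_mul_deriv (g := fun _ => 1)
      (continuous_const.locallyIntegrable) s₁ c₁
    simp only [intervalIntegral.integral_const, sub_zero, smul_eq_mul, mul_one, one_mul, d₁] at h1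
    have h2 : ∀ s, s * (ψ s - α * ρ s) = s * ψ s - α * (s * ρ s) := fun s => by ring
    simp only [h2] at h1
    rw [integral_sub (integrable_mul_test hid ψs.continuous ψc)
      ((integrable_mul_test hid ρs.continuous ρc).const_mul α), integral_const_mul] at h1
    linarith
  have e2 := H η₂ s₂ c₂
  have h3 : ∀ s, h s * deriv (deriv η₂) s =
      h s * ψ s - α * (h s * ρ s) - β * (h s * deriv ρ s) := by
    intro s
    have h4 : HasDerivAt (fun s => η₁ s - β * ρ s) (deriv η₁ s - β * deriv ρ s) s :=
      (s₁.differentiable (by simp) s).hasDerivAt.sub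
        ((ρs.differentiable (by simp) s).hasDerivAt.const_mul β)
    rw [d₂, h4.deriv, d₁]
    ring
  have i1 := integrable_mul_test hh ψs.continuous ψc
  have i2 := integrable_mul_test hh ρs.continuous ρc
  have i3 := integrable_mul_test hh (contDiff_deriv ρs).continuous ρc.deriv
  have e5 : ∫ s, (h s * ψ s - α * (h s * ρ s) - β * (h s * deriv ρ s)) =
      (∫ s, h s * ψ s) - α * a - β * b := by
    rw [← integral_const_mul, ← integral_const_mul, ← integral_sub i1 (i2.const_mul α),
      ← integral_sub]
    · exact i1.sub (i2.const_mul α)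
    · exact i3.const_mul β
  simp only [h3] at e2
  rw [e5] at e2
  have e3 : ∫ s, ψ s • (a + m * b + -b * s) = (a + m * b) * α + -b * ∫ s, s * ψ s := by
    have : ∀ s, ψ s • (a + m * b + -b * s) = (a + m * b) * ψ s + -b * (s * ψ s) := by
      intro s; rw [smul_eq_mul]; ring
    simp only [this]
    rw [integral_add (ψi.const_mul _) ((integrable_mul_test hid ψs.continuous ψc).const_mul _),
      integral_const_mul, integral_const_mul]
  have e4 : ∫ s, ψ s • h s = ∫ s, h s * ψ s := by simp only [smul_eq_mul, mul_comm]
  rw [e3, e4]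
  rw [e1] at e2
  linarith

theorem continuous_primitive {g : ℝ → ℝ} (hg : LocallyIntegrable g) :
    Continuous fun s => ∫ x in (0 : ℝ)..s, g x :=
  intervalIntegral.continuous_primitive
    (fun _ _ => (hg.integrableOn_isCompact isCompact_uIcc).intervalIntegrable) 0

/-- A weak solution of `u'' = g` is a double primitive of `g`, up to an affine function. -/
theorem ae_eq_of_weak {u g : ℝ → ℝ} (hu : LocallyIntegrable u) (hg : LocallyIntegrable g)
    (H : ∀ η : ℝ → ℝ, ContDiff ℝ ∞ η → HasCompactSupport η →
      ∫ s, u s * deriv (deriv η) s = ∫ s, g s * η s) :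
    ∃ A B : ℝ, ∀ᵐ s, u s = A + B * s + ∫ x in (0 : ℝ)..s, ∫ y in (0 : ℝ)..x, g y := by
  have c1 := continuous_primitive hg
  have c2 := continuous_primitive c1.locallyIntegrable
  obtain ⟨A, B, h⟩ := ae_affine_of_weak (hu.sub c2.locallyIntegrable) fun η hs hc => by
    have i1 := integrable_mul_test hu (contDiff_deriv (contDiff_deriv hs)).continuous hc.deriv.deriv
    have i2 := integrable_mul_test c2.locallyIntegrable
      (contDiff_deriv (contDiff_deriv hs)).continuous hc.deriv.deriv
    simp only [Pi.sub_apply, sub_mul]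
    rw [integral_sub i1 i2, H η hs hc,
      integral_primitive_mul_deriv c1.locallyIntegrable (contDiff_deriv hs) hc.deriv,
      integral_primitive_mul_deriv hg hs hc]
    ring
  refine ⟨A, B, h.mono fun s hs => ?_⟩
  rw [← hs]
  simp

/-- A weak solution of `u'' = c u` is almost everywhere equal to a classical one. -/
theorem exists_classical_of_weak {u c : ℝ → ℂ} (hu : LocallyIntegrable u) (hc : Continuous c)
    (H : ∀ η : ℝ → ℝ, ContDiff ℝ ∞ η → HasCompactSupport η →
      ∫ s, deriv (deriv η) s • u s = ∫ s, η s • (c s * u s)) :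
    ∃ p q : ℝ → ℂ, (∀ s, HasDerivAt p (q s) s) ∧ (∀ s, HasDerivAt q (c s * p s) s) ∧
      ∀ᵐ s, u s = p s := by
  have hg : LocallyIntegrable fun s => c s * u s := hu.continuous_mul hc
  -- The real and imaginary parts are treated separately, but the multiplication by `c` mixes them.
  -- The second derivative is therefore expressed through a continuous representative `v` of `u`,
  -- available once both parts are known.
  have part : ∀ L : ℂ →L[ℝ] ℝ, ∃ P Q : ℝ → ℝ, Continuous P ∧ (∀ᵐ s, L (u s) = P s) ∧
      (∀ s, HasDerivAt P (Q s) s) ∧ ∀ v : ℝ → ℂ, Continuous v → (∀ᵐ s, u s = v s) →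
        ∀ s, HasDerivAt Q (L (c s * v s)) s := by
    intro L
    have hLu : LocallyIntegrable fun s => L (u s) := fun s => by
      obtain ⟨t, ht, hi⟩ := hu s
      exact ⟨t, ht, L.integrable_comp hi⟩
    have hLg : LocallyIntegrable fun s => L (c s * u s) := fun s => by
      obtain ⟨t, ht, hi⟩ := hg s
      exact ⟨t, ht, L.integrable_comp hi⟩
    obtain ⟨A, B, hAB⟩ := ae_eq_of_weak hLu hLg fun η hs hcs => by
      have h1 := L.integral_comp_comm (hu.integrable_smul_left_of_hasCompactSupport
        (contDiff_deriv (contDiff_deriv hs)).continuous hcs.deriv.deriv)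
      have h2 := L.integral_comp_comm (hg.integrable_smul_left_of_hasCompactSupport
        hs.continuous hcs)
      rw [← H η hs hcs, ] at h2
      simp only [map_smul, smul_eq_mul] at h1 h2
      simp only [mul_comm (L _)]
      rw [h1, h2]
    have c1 := continuous_primitive hLg
    have c2 := continuous_primitive c1.locallyIntegrable
    refine ⟨_, fun s => B + ∫ x in (0 : ℝ)..s, L (c x * u x), ?_, hAB, fun s => ?_,
      fun v hv huv s => ?_⟩
    · fun_prop
    · have h1 := intervalIntegral.integral_hasDerivAt_right (c1.intervalIntegrable 0 s)
        (c1.stronglyMeasurableAtFilter _ _) c1.continuousAt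
      have h2 : HasDerivAt (fun s => A + B * s) B s := by
        simpa using ((hasDerivAt_id s).const_mul B).const_add A
      exact h2.add h1
    · have hcv : Continuous fun s => L (c s * v s) := L.continuous.comp (hc.mul hv)
      have h1 : (fun s => B + ∫ x in (0 : ℝ)..s, L (c x * u x)) =
          fun s => B + ∫ x in (0 : ℝ)..s, L (c x * v x) := by
        funext s
        congr 1
        refine intervalIntegral.integral_congr_ae ?_
        filter_upwards [huv] with x hx _
        rw [hx]
      rw [h1]
      exact (intervalIntegral.integral_hasDerivAt_right (hcv.intervalIntegrable 0 s)
        (hcv.stronglyMeasurableAtFilter _ _) hcv.continuousAt).const_add B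
  obtain ⟨P₁, Q₁, cP₁, hP₁, dP₁, dQ₁⟩ := part Complex.reCLM
  obtain ⟨P₂, Q₂, cP₂, hP₂, dP₂, dQ₂⟩ := part Complex.imCLM
  have hup : ∀ᵐ s, u s = P₁ s + P₂ s * Complex.I := by
    filter_upwards [hP₁, hP₂] with s h1 h2
    rw [← h1, ← h2]
    exact (Complex.re_add_im _).symm
  have hcont : Continuous fun s => (P₁ s + P₂ s * Complex.I : ℂ) := by fun_prop
  refine ⟨fun s => P₁ s + P₂ s * Complex.I, fun s => Q₁ s + Q₂ s * Complex.I, fun s => ?_,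
    fun s => ?_, hup⟩
  · exact (dP₁ s).ofReal_comp.add ((dP₂ s).ofReal_comp.mul_const _)
  · refine ((dQ₁ _ hcont hup s).ofReal_comp.add
      ((dQ₂ _ hcont hup s).ofReal_comp.mul_const _)).congr_deriv ?_
    exact Complex.re_add_im _

/-! ### Square integrable solutions -/

theorem not_integrable_of_le_Ioi {G : ℝ → ℝ} {δ r : ℝ} (hδ : 0 < δ) (h : ∀ s, r < s → δ ≤ G s) :
    ¬ Integrable G := by
  intro hi
  have h1 : IntegrableOn (fun _ : ℝ => δ) (Set.Ioi r) := by
    refine hi.integrableOn.mono' aestronglyMeasurable_const ?_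
    refine (ae_restrict_iff' measurableSet_Ioi).2 (ae_of_all _ fun s hs => ?_)
    rw [Real.norm_eq_abs, abs_of_pos hδ]
    exact h s hs
  rw [integrableOn_const_iff (by simp)] at h1
  simp [hδ.ne'] at h1

theorem not_integrable_of_le_Iio {G : ℝ → ℝ} {δ r : ℝ} (hδ : 0 < δ) (h : ∀ s, s < r → δ ≤ G s) :
    ¬ Integrable G := by
  intro hi
  refine not_integrable_of_le_Ioi (r := -r) (G := fun s => G (-s)) hδ
    (fun s hs => h _ (by linarith)) hi.comp_neg

/-- Solutions of `p'' = (m² + iκ(s)) p` with `|p|² e^{2s}` integrable. -/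
structure IsDecayingSolution (m : ℝ) (κ : ℝ → ℝ) (p q : ℝ → ℂ) : Prop where
  deriv_fst : ∀ s, HasDerivAt p (q s) s
  deriv_snd : ∀ s, HasDerivAt q (((m ^ 2 : ℝ) + Complex.I * κ s) * p s) s
  integrable : Integrable fun s => Real.exp (2 * s) * ‖p s‖ ^ 2

namespace IsDecayingSolution

variable {m : ℝ} {κ : ℝ → ℝ} {p q : ℝ → ℂ}

theorem hasDerivAt_normSq (h : IsDecayingSolution m κ p q) (s : ℝ) :
    HasDerivAt (fun s => Complex.normSq (p s))
      (2 * ((p s).re * (q s).re + (p s).im * (q s).im)) s := by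
  have h1 := Complex.reCLM.hasFDerivAt.comp_hasDerivAt s (h.deriv_fst s)
  have h2 := Complex.imCLM.hasFDerivAt.comp_hasDerivAt s (h.deriv_fst s)
  refine ((h1.mul h1).add (h2.mul h2)).congr_deriv ?_
  simp
  ring

/-- The term `iκ|p|²` has zero real part, so `κ` disappears and `|p|²` is convex. -/
theorem hasDerivAt_cross (h : IsDecayingSolution m κ p q) (s : ℝ) :
    HasDerivAt (fun s => 2 * ((p s).re * (q s).re + (p s).im * (q s).im))
      (2 * Complex.normSq (q s) + 2 * m ^ 2 * Complex.normSq (p s)) s := by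
  have h1 := Complex.reCLM.hasFDerivAt.comp_hasDerivAt s (h.deriv_fst s)
  have h2 := Complex.imCLM.hasFDerivAt.comp_hasDerivAt s (h.deriv_fst s)
  have h3 := Complex.reCLM.hasFDerivAt.comp_hasDerivAt s (h.deriv_snd s)
  have h4 := Complex.imCLM.hasFDerivAt.comp_hasDerivAt s (h.deriv_snd s)
  refine (((h1.mul h3).add (h2.mul h4)).const_mul 2).congr_deriv ?_
  simp [Complex.normSq_apply]
  have hm : ((m : ℂ) ^ 2).re = m ^ 2 ∧ ((m : ℂ) ^ 2).im = 0 := by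
    rw [← Complex.ofReal_pow]
    exact ⟨Complex.ofReal_re _, Complex.ofReal_im _⟩
  rw [hm.1, hm.2]
  ring

theorem integrable_normSq (h : IsDecayingSolution m κ p q) :
    Integrable fun s => Real.exp (2 * s) * Complex.normSq (p s) := by
  simpa only [Complex.normSq_eq_norm_sq] using h.integrable

/-- If the convex function `|p|²` had positive slope somewhere it would increase from there on, and
`e^{2s}|p|²` would not be integrable at `∞`. -/
theorem cross_nonpos (h : IsDecayingSolution m κ p q) (r : ℝ) :
    2 * ((p r).re * (q r).re + (p r).im * (q r).im) ≤ 0 := by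
  by_contra! hr
  set φ₁ := fun s => 2 * ((p s).re * (q s).re + (p s).im * (q s).im) with hφ₁
  have hmono : Monotone φ₁ := monotone_of_hasDerivAt_nonneg h.hasDerivAt_cross fun s => by
    have := Complex.normSq_nonneg (q s)
    have := Complex.normSq_nonneg (p s)
    positivity
  have hstrict : StrictMonoOn (fun s => Complex.normSq (p s)) (Set.Ici r) := by
    refine strictMonoOn_of_hasDerivWithinAt_pos (convex_Ici r)
      (fun s _ => (h.hasDerivAt_normSq s).continuousAt.continuousWithinAt)
      (fun s _ => (h.hasDerivAt_normSq s).hasDerivWithinAt) fun s hs => ?_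
    rw [interior_Ici] at hs
    exact lt_of_lt_of_le hr (hmono (le_of_lt hs))
  have h0 : 0 < Complex.normSq (p (r + 1)) :=
    (Complex.normSq_nonneg (p r)).trans_lt
      (hstrict Set.self_mem_Ici (by simp) (by linarith))
  refine not_integrable_of_le_Ioi (r := r + 1)
    (mul_pos (Real.exp_pos (2 * (r + 1))) h0) (fun s hs => ?_) h.integrable_normSq
  have : Complex.normSq (p (r + 1)) ≤ Complex.normSq (p s) :=
    hstrict.monotoneOn (by simp) (by simp; linarith) hs.le
  gcongr

/-- A decaying solution with `p(0) = 0` vanishes. -/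
theorem eq_zero_of_apply_zero (h : IsDecayingSolution m κ p q) (hκ : Continuous κ)
    (h0 : p 0 = 0) (s : ℝ) : p s = 0 := by
  have hanti : Antitone fun s => Complex.normSq (p s) :=
    antitone_of_hasDerivAt_nonpos h.hasDerivAt_normSq h.cross_nonpos
  have hpos : ∀ s, 0 ≤ s → p s = 0 := fun s hs => by
    have h1 := hanti hs
    simp only [h0, map_zero] at h1
    exact Complex.normSq_eq_zero.1 (le_antisymm h1 (Complex.normSq_nonneg _))
  -- Since `|p|²` is nonincreasing, `p` vanishes on `[0, ∞)`; thus the Cauchy data at `1` are zero,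
  -- and uniqueness for the linear system carries this to negative `s`.
  have hq1 : q 1 = 0 := by
    have h1 : p =ᶠ[𝓝 1] fun _ => 0 := by
      filter_upwards [lt_mem_nhds (zero_lt_one' ℝ)] with u hu using hpos u hu.le
    rw [← (h.deriv_fst 1).deriv, h1.deriv_eq]
    simp
  rcases le_total 0 s with hs | hs
  · exact hpos s hs
  set c : ℝ → ℂ := fun s => (m ^ 2 : ℝ) + Complex.I * κ s with hc
  have hcc : Continuous c := by fun_prop
  obtain ⟨C, hC⟩ := (isCompact_Icc (a := s) (b := (1 : ℝ))).exists_bound_of_continuousOn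
    hcc.continuousOn
  let K : NNReal := ⟨max C 1, le_trans zero_le_one (le_max_right _ _)⟩
  have huniq := ODE_solution_unique_of_mem_Icc_left (a := s) (b := 1) (K := K)
    (v := fun t x => ((x.2, c t * x.1) : ℂ × ℂ)) (s := fun _ => Set.univ)
    (f := fun t => (p t, q t)) (g := fun _ => 0) (fun t ht => ?_)
    (fun t _ => ((h.deriv_fst t).continuousAt.prodMk
      (h.deriv_snd t).continuousAt).continuousWithinAt)
    (fun t _ => ((h.deriv_fst t).prodMk (h.deriv_snd t)).hasDerivWithinAt)
    (fun _ _ => trivial) continuousOn_const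
    (fun t _ => by
      refine (hasDerivWithinAt_const _ _ (0 : ℂ × ℂ)).congr_deriv ?_
      simp only [Prod.fst_zero, Prod.snd_zero, mul_zero]
      rfl)
    (fun _ _ => trivial) (by simp [hpos 1 zero_le_one, hq1])
  · have := huniq (Set.left_mem_Icc.2 (by linarith))
    exact congrArg Prod.fst this
  · refine LipschitzOnWith.of_dist_le_mul fun x _ y _ => ?_
    have hK : (K : ℝ) = max C 1 := rfl
    rw [Prod.dist_eq, Prod.dist_eq, hK]
    have hCt : ‖c t‖ ≤ max C 1 := (hC t ⟨ht.1.le, ht.2⟩).trans (le_max_left _ _)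
    refine max_le ?_ ?_
    · calc dist x.2 y.2 ≤ 1 * max (dist x.1 y.1) (dist x.2 y.2) := by
            rw [one_mul]; exact le_max_right _ _
        _ ≤ _ := by gcongr; exact le_max_right _ _
    · rw [dist_eq_norm, ← mul_sub, norm_mul, ← dist_eq_norm]
      gcongr
      exact le_max_left _ _

/-- For `|m| ≥ 1` there are no decaying solutions. -/
theorem eq_zero_of_one_le (h : IsDecayingSolution m κ p q) (hm : 1 ≤ m ^ 2) (s : ℝ) :
    p s = 0 := by
  -- The function `Θ` is `e^{-2s}` times the derivative of `G = e^{2s}|p|²`, and `Θ' = 2|p + q|² +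
  -- 2(m² - 1)|p|² ≥ 0`. If `Θ` is positive somewhere, `G` is not integrable at `∞`; otherwise `G`
  -- is nonincreasing, and a nonzero value spoils integrability at `-∞`.
  set Θ := fun s => 2 * ((p s).re * (q s).re + (p s).im * (q s).im) +
    2 * Complex.normSq (p s) with hΘ
  have hΘd : ∀ s, HasDerivAt Θ ((2 * Complex.normSq (q s) + 2 * m ^ 2 * Complex.normSq (p s)) +
      2 * (2 * ((p s).re * (q s).re + (p s).im * (q s).im))) s := fun s =>
    (h.hasDerivAt_cross s).add ((h.hasDerivAt_normSq s).const_mul 2)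
  have hmono : Monotone Θ := monotone_of_hasDerivAt_nonneg hΘd fun s => by
    have h1 : 0 ≤ (m ^ 2 - 1) * Complex.normSq (p s) :=
      mul_nonneg (by linarith) (Complex.normSq_nonneg _)
    simp only [Complex.normSq_apply, Pi.zero_apply] at h1 ⊢
    nlinarith [sq_nonneg ((p s).re + (q s).re), sq_nonneg ((p s).im + (q s).im)]
  set G := fun s => Real.exp (2 * s) * Complex.normSq (p s) with hG
  have hGd : ∀ s, HasDerivAt G (Real.exp (2 * s) * Θ s) s := fun s => by
    have h1 : HasDerivAt (fun s : ℝ => Real.exp (2 * s)) (Real.exp (2 * s) * 2) s := by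
      simpa using ((hasDerivAt_id s).const_mul 2).exp
    refine (h1.mul (h.hasDerivAt_normSq s)).congr_deriv ?_
    simp only [hΘ]
    ring
  have hG0 : ∀ s, 0 ≤ G s := fun s => mul_nonneg (Real.exp_pos _).le (Complex.normSq_nonneg _)
  have hΘ0 : ∀ r, Θ r ≤ 0 := by
    intro r
    by_contra! hr
    have hstrict : StrictMonoOn G (Set.Ici r) := by
      refine strictMonoOn_of_hasDerivWithinAt_pos (convex_Ici r)
        (fun s _ => (hGd s).continuousAt.continuousWithinAt)
        (fun s _ => (hGd s).hasDerivWithinAt) fun s hs => ?_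
      rw [interior_Ici] at hs
      exact mul_pos (Real.exp_pos _) (lt_of_lt_of_le hr (hmono (le_of_lt hs)))
    have h0 : 0 < G (r + 1) :=
      (hG0 r).trans_lt (hstrict Set.self_mem_Ici (by simp) (by linarith))
    exact not_integrable_of_le_Ioi (r := r + 1) h0 (fun s hs =>
      hstrict.monotoneOn (by simp) (by simp; linarith) (le_of_lt hs)) h.integrable_normSq
  have hanti : Antitone G := antitone_of_hasDerivAt_nonpos hGd fun s =>
    mul_nonpos_of_nonneg_of_nonpos (Real.exp_pos _).le (hΘ0 s)
  by_contra hs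
  have h0 : 0 < G s := mul_pos (Real.exp_pos _) (Complex.normSq_pos.2 hs)
  exact not_integrable_of_le_Iio (r := s) h0 (fun r hr => hanti hr.le) h.integrable_normSq

end IsDecayingSolution

/-! ### Angular Fourier coefficients -/

theorem sq_integral_norm_le {g : ℝ → ℂ} (hm : AEStronglyMeasurable g angularMeasure)
    (hg : Integrable (fun t => ‖g t‖ ^ 2) angularMeasure) :
    Integrable g angularMeasure ∧
      ‖∫ t, g t ∂angularMeasure‖ ^ 2 ≤ 2 * Real.pi * ∫ t, ‖g t‖ ^ 2 ∂angularMeasure := by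
  have hi : Integrable g angularMeasure :=
    (memLp_two_iff_integrable_sq_norm hm |>.2 hg).integrable (by norm_num)
  refine ⟨hi, ?_⟩
  set N := ∫ t, ‖g t‖ ∂angularMeasure with hN
  have hπ := Real.pi_pos
  have h1 : ∫ _t, (1 : ℝ) ∂angularMeasure = 2 * Real.pi := by
    have h := integral_angularMeasure_one
    have h2 := integral_complex_ofReal (μ := angularMeasure) (f := fun _ => (1 : ℝ))
    simp only [Complex.ofReal_one] at h2
    rw [h] at h2
    exact_mod_cast h2.symm
  -- Cauchy–Schwarz against the constant `1`, obtained by expanding this square on an interval of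
  -- length `2π`.
  have h2 : 0 ≤ ∫ t, (2 * Real.pi * ‖g t‖ - N) ^ 2 ∂angularMeasure :=
    integral_nonneg fun t => sq_nonneg _
  have h3 : ∀ t, (2 * Real.pi * ‖g t‖ - N) ^ 2 =
      (2 * Real.pi) ^ 2 * ‖g t‖ ^ 2 - 4 * Real.pi * N * ‖g t‖ + N ^ 2 * 1 := fun t => by ring
  have i1 := hg.const_mul ((2 * Real.pi) ^ 2)
  have i2 := hi.norm.const_mul (4 * Real.pi * N)
  have h7 : ∫ t, ((2 * Real.pi) ^ 2 * ‖g t‖ ^ 2 - 4 * Real.pi * N * ‖g t‖ + N ^ 2 * 1)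
      ∂angularMeasure = (2 * Real.pi) ^ 2 * (∫ t, ‖g t‖ ^ 2 ∂angularMeasure) -
        4 * Real.pi * N * N + N ^ 2 * (2 * Real.pi) := by
    rw [integral_add (by exact i1.sub i2) ((integrable_const 1).const_mul _),
      integral_sub i1 i2, integral_const_mul, integral_const_mul, integral_const_mul, h1]
  simp only [h3] at h2
  rw [h7] at h2
  have h4 : ‖∫ t, g t ∂angularMeasure‖ ≤ N := norm_integral_le_integral_norm _
  have h5 : ‖∫ t, g t ∂angularMeasure‖ ^ 2 ≤ N ^ 2 := by gcongr
  refine h5.trans ?_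
  have h6 : 0 ≤ (2 * Real.pi) * (2 * Real.pi * ∫ t, ‖g t‖ ^ 2 ∂angularMeasure - N ^ 2) := by
    linarith
  linarith [nonneg_of_mul_nonneg_right h6 (by positivity)]

theorem measurable_slice (f : L2) (s : ℝ) : Measurable fun t => f (polarExp (s, t)) :=
  (Lp.stronglyMeasurable f).measurable.comp (measurable_polarExp.comp (by fun_prop))

theorem integrable_norm_sq_polarExp (f : L2) :
    Integrable (fun p => ‖f (polarExp p)‖ ^ 2) (radialMeasure.prod angularMeasure) := by
  have h := (memLp_two_iff_integrable_sq_norm (Lp.memLp f).1).1 (Lp.memLp f)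
  exact measurePreserving_polarExp.integrable_comp_of_integrable h

theorem norm_exp_int_mul_I (l : ℤ) (t : ℝ) :
    ‖Complex.exp (-(l * (t * Complex.I)))‖ = 1 := by
  rw [Complex.norm_exp]
  simp

theorem norm_sq_angCoeff_le (f : L2) (l : ℤ) :
    ∀ᵐ s ∂radialMeasure, Integrable (fun t => f (polarExp (s, t))) angularMeasure ∧
      ‖angCoeff f l s‖ ^ 2 ≤ 2 * Real.pi * ∫ t, ‖f (polarExp (s, t))‖ ^ 2 ∂angularMeasure := by
  filter_upwards [(integrable_norm_sq_polarExp f).prod_right_ae] with s hs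
  have hm := measurable_slice f s
  refine ⟨(sq_integral_norm_le hm.aestronglyMeasurable hs).1, ?_⟩
  have h1 : ∀ t : ℝ, ‖f (polarExp (s, t)) * Complex.exp (-(l * (t * Complex.I)))‖ ^ 2 =
      ‖f (polarExp (s, t))‖ ^ 2 := fun t => by
    rw [norm_mul, norm_exp_int_mul_I, mul_one]
  have h2 := sq_integral_norm_le
    (g := fun t => f (polarExp (s, t)) * Complex.exp (-(l * (t * Complex.I))))
    (hm.mul (by fun_prop)).aestronglyMeasurable (by simpa only [h1] using hs)
  simp only [h1] at h2
  exact h2.2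

theorem stronglyMeasurable_angCoeff (f : L2) (l : ℤ) : StronglyMeasurable (angCoeff f l) := by
  have : StronglyMeasurable fun p : ℝ × ℝ =>
      f (polarExp p) * Complex.exp (-(l * (p.2 * Complex.I))) :=
    (((Lp.stronglyMeasurable f).measurable.comp measurable_polarExp).mul
      (by fun_prop)).stronglyMeasurable
  exact this.integral_prod_right (ν := angularMeasure)

theorem integrable_norm_sq_angCoeff (f : L2) (l : ℤ) :
    Integrable fun s => Real.exp (2 * s) * ‖angCoeff f l s‖ ^ 2 := by
  have h1 := ((integrable_norm_sq_polarExp f).integral_prod_left).const_mul (2 * Real.pi)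
  have h2 : Integrable (fun s => ‖angCoeff f l s‖ ^ 2) radialMeasure := by
    refine h1.mono' ((stronglyMeasurable_angCoeff f l).norm.pow 2).aestronglyMeasurable ?_
    filter_upwards [norm_sq_angCoeff_le f l] with s hs
    rw [Real.norm_eq_abs, abs_of_nonneg (by positivity)]
    exact hs.2
  simpa using integrable_radialMeasure.1 h2

/-- On compact sets the weight is bounded below, and `|x| ≤ |x|² + 1`. -/
theorem locallyIntegrable_angCoeff (f : L2) (l : ℤ) : LocallyIntegrable (angCoeff f l) := by
  rw [locallyIntegrable_iff]
  intro K hK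
  have h1 := (integrable_norm_sq_angCoeff f l).integrableOn (s := K)
  have h2 : ContinuousOn (fun s : ℝ => Real.exp (-(2 * s))) K := by fun_prop
  have h3 := h1.continuousOn_mul h2 hK
  have h4 : IntegrableOn (fun _ : ℝ => (1 : ℝ)) K := integrableOn_const hK.measure_lt_top.ne
  refine (h3.add h4).mono' (stronglyMeasurable_angCoeff f l).aestronglyMeasurable
    (ae_of_all _ fun s => ?_)
  have : Real.exp (-(2 * s)) * (Real.exp (2 * s) * ‖angCoeff f l s‖ ^ 2) =
      ‖angCoeff f l s‖ ^ 2 := by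
    rw [← mul_assoc, ← Real.exp_add]; simp
  simp only [Pi.add_apply, this]
  nlinarith [sq_nonneg (‖angCoeff f l s‖ - 1 / 2)]

/-- An integrable function on `(-π, π)` with vanishing Fourier coefficients vanishes. -/
theorem ae_eq_zero_of_fourier {g : ℝ → ℂ} (hg : Integrable g angularMeasure)
    (h : ∀ l : ℤ, ∫ t, g t * Complex.exp (-(l * (t * Complex.I))) ∂angularMeasure = 0) :
    ∀ᵐ t ∂angularMeasure, g t = 0 := by
  have hπ : Fact ((0 : ℝ) < 2 * Real.pi) := ⟨by positivity⟩
  have hint : ∀ F : C(AddCircle (2 * Real.pi), ℂ),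
      Integrable (fun t : ℝ => g t * F (t : AddCircle (2 * Real.pi))) angularMeasure := fun F => by
    refine hg.mul_bdd (c := ‖F‖) ?_ (ae_of_all _ fun t => F.norm_coe_le_norm _)
    exact (F.continuous.comp (AddCircle.continuous_mk' _)).aestronglyMeasurable
  -- Integration against `g` is a bounded functional on continuous functions on the circle; it kills
  -- the characters, whose span is dense, hence it is zero.
  let Λ : C(AddCircle (2 * Real.pi), ℂ) →L[ℂ] ℂ := LinearMap.mkContinuous
    { toFun := fun F => ∫ t : ℝ, g t * F (t : AddCircle (2 * Real.pi)) ∂angularMeasure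
      map_add' := fun F G => by
        simp only [ContinuousMap.add_apply, mul_add]
        exact integral_add (hint F) (hint G)
      map_smul' := fun c F => by
        simp only [ContinuousMap.smul_apply, smul_eq_mul, RingHom.id_apply]
        rw [← integral_const_mul]
        congr 1
        funext t
        ring }
    (∫ t, ‖g t‖ ∂angularMeasure) (fun F => by
      simp only [LinearMap.coe_mk, AddHom.coe_mk]
      rw [← integral_mul_const]
      refine norm_integral_le_of_norm_le (hg.norm.mul_const _) (ae_of_all _ fun t => ?_)
      rw [norm_mul]
      exact mul_le_mul_of_nonneg_left (F.norm_coe_le_norm _) (norm_nonneg _))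
  have hΛ : ∀ F, Λ F = ∫ t : ℝ, g t * F (t : AddCircle (2 * Real.pi)) ∂angularMeasure :=
    fun F => rfl
  have hker : Λ = 0 := by
    have h1 : (⊤ : Submodule ℂ C(AddCircle (2 * Real.pi), ℂ)) ≤ LinearMap.ker Λ.toLinearMap := by
      rw [← span_fourier_closure_eq_top]
      refine Submodule.topologicalClosure_minimal _ (Submodule.span_le.2 ?_) Λ.isClosed_ker
      rintro _ ⟨n, rfl⟩
      change Λ (fourier n) = 0
      rw [hΛ, ← h (-n)]
      congr 1
      funext t
      rw [fourier_coe_apply]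
      congr 2
      push_cast
      have : (Real.pi : ℂ) ≠ 0 := by exact_mod_cast Real.pi_ne_zero
      field_simp
    ext F
    exact h1 trivial
  have hloc : LocallyIntegrableOn g (Set.Ioo (-Real.pi) Real.pi) volume :=
    IntegrableOn.locallyIntegrableOn hg
  have key := isOpen_Ioo.ae_eq_zero_of_integral_contDiff_smul_eq_zero hloc fun η hs hc ht => by
    have hz : ∀ t, t ∉ Set.Ioo (-Real.pi) Real.pi → η t = 0 := fun t ht' =>
      image_eq_zero_of_notMem_tsupport fun hh => ht' (ht hh)
    -- A test function supported in `(-π, π)` vanishes at both ends, so it descends to the circle.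
    let F : C(AddCircle (2 * Real.pi), ℂ) :=
      ⟨AddCircle.liftIoc (2 * Real.pi) (-Real.pi) fun t => (η t : ℂ),
        AddCircle.liftIoc_continuous (by
          rw [hz _ (by simp), hz (-Real.pi + 2 * Real.pi) fun h => by linarith [h.2]])
          (by exact (Complex.continuous_ofReal.comp hs.continuous).continuousOn)⟩
    have h1 : Λ F = 0 := by rw [hker]; rfl
    rw [hΛ] at h1
    rw [← setIntegral_eq_integral_of_forall_compl_eq_zero
      (s := Set.Ioo (-Real.pi) Real.pi) (fun t ht' => by rw [hz t ht', zero_smul]), ← h1]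
    refine setIntegral_congr_fun measurableSet_Ioo fun t ht' => ?_
    have : F (t : AddCircle (2 * Real.pi)) = η t :=
      AddCircle.liftIoc_coe_apply (p := 2 * Real.pi) (a := -Real.pi) (f := fun t => (η t : ℂ))
        ⟨ht'.1, by linarith [ht'.2]⟩
    simp only [this, Complex.real_smul]
    ring
  exact (ae_restrict_iff' measurableSet_Ioo).2 key

theorem eq_zero_of_angCoeff (f : L2) (h : ∀ l : ℤ, ∀ᵐ s, angCoeff f l s = 0) : f = 0 := by
  have h1 : ∀ᵐ s ∂radialMeasure, ∀ l : ℤ, angCoeff f l s = 0 :=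
    ae_all_iff.2 fun l => ae_radialMeasure.2 (h l)
  have h2 : ∀ᵐ s ∂radialMeasure, ∀ᵐ t ∂angularMeasure, f (polarExp (s, t)) = 0 := by
    filter_upwards [h1, norm_sq_angCoeff_le f 0] with s hs hi
    exact ae_eq_zero_of_fourier hi.1 hs
  have hm : MeasurableSet {z : ℂ | f z = 0} :=
    (Lp.stronglyMeasurable f).measurable (measurableSet_singleton 0)
  have h3 : ∀ᵐ p ∂(radialMeasure.prod angularMeasure), f (polarExp p) = 0 :=
    (Measure.ae_prod_iff_ae_ae (measurable_polarExp hm)).2 h2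
  have h4 : ∀ᵐ z, f z = 0 := by
    have h5 := (ae_map_iff measurable_polarExp.aemeasurable hm).2 h3
    rwa [measurePreserving_polarExp.map_eq] at h5
  rw [Lp.eq_zero_iff_ae_eq_zero]
  exact h4

/-! ### The deficiency spaces -/

theorem integrable_slice_mul_exp {f : L2} {s : ℝ} (l : ℤ)
    (h : Integrable (fun t => f (polarExp (s, t))) angularMeasure) :
    Integrable (fun t : ℝ => f (polarExp (s, t)) * Complex.exp (-(l * (t * Complex.I))))
      angularMeasure := by
  refine h.mul_bdd (c := 1) ?_ (ae_of_all _ fun t => (norm_exp_int_mul_I l t).le)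
  exact (by fun_prop : Continuous fun t : ℝ =>
    Complex.exp (-(l * (t * Complex.I)))).aestronglyMeasurable

theorem angCoeff_add (f g : L2) (l : ℤ) :
    ∀ᵐ s, angCoeff (f + g : L2) l s = angCoeff f l s + angCoeff g l s := by
  filter_upwards [angCoeff_congr (Lp.coeFn_add f g) l, ae_radialMeasure.1 (norm_sq_angCoeff_le f l),
    ae_radialMeasure.1 (norm_sq_angCoeff_le g l)] with s h1 h2 h3
  rw [h1]
  simp only [angCoeff, Pi.add_apply, add_mul]
  exact integral_add (integrable_slice_mul_exp l h2.1) (integrable_slice_mul_exp l h3.1)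

theorem angCoeff_smul (c : ℂ) (f : L2) (l : ℤ) :
    ∀ᵐ s, angCoeff (c • f : L2) l s = c * angCoeff f l s := by
  filter_upwards [angCoeff_congr (Lp.coeFn_smul c f) l] with s h1
  rw [h1]
  simp only [angCoeff, Pi.smul_apply, smul_eq_mul, mul_assoc]
  rw [integral_const_mul]

/-- The adjoint relation is tested on `η(log r) e^{ilφ}`. The conjugate coefficient appears because
the inner product is antilinear in its first slot; the weight turns the eigenvalue into `iκ e^{2s}`.
-/
theorem continuous_conj_angCoeff_weak {lam κ : ℝ} {f : L2}
    (hf : (f, (Complex.I * κ) • f) ∈ (abOperator lam).adjoint.graph) (l : ℤ) {η : ℝ → ℝ}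
    (hη : ContDiff ℝ ∞ η) (hc : HasCompactSupport η) :
    ∫ s, deriv (deriv η) s • (starRingEnd ℂ) (angCoeff f l s) =
      ∫ s, η s • ((((l + lam) ^ 2 : ℝ) + Complex.I * ((κ * Real.exp (2 * s) : ℝ) : ℂ)) *
        (starRingEnd ℂ) (angCoeff f l s)) := by
  have h := (mem_adjoint_iff_test lam).1 hf (polarTest η l hη hc)
  have hm : MemLp (polarFun η l) 2 volume := memLp_testFunction (polarTest η l hη hc)
  have hm' : MemLp (polarFun (radialOp lam l η) l) 2 volume := by
    have := memLp_testFunction (formalOperator lam (polarTest η l hη hc))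
    rwa [formalOperator_polarTest] at this
  have e1 : testToL2 (polarTest η l hη hc) = hm.toLp _ := rfl
  have e2 : testToL2 (formalOperator lam (polarTest η l hη hc)) = hm'.toLp _ :=
    MemLp.toLp_congr (memLp_testFunction _) hm' (by rw [formalOperator_polarTest])
  obtain ⟨i1, j1⟩ := inner_polar f hm
  obtain ⟨i2, j2⟩ := inner_polar f hm'
  rw [e1, e2, inner_smul_left, i1, i2] at h
  have j3 := j1.const_mul (Complex.I * κ)
  have key : ∫ s, (deriv (deriv η) s • (starRingEnd ℂ) (angCoeff f l s) -
      η s • ((((l + lam) ^ 2 : ℝ) + Complex.I * ((κ * Real.exp (2 * s) : ℝ) : ℂ)) *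
        (starRingEnd ℂ) (angCoeff f l s))) = 0 := by
    have e3 : ∀ s, deriv (deriv η) s • (starRingEnd ℂ) (angCoeff f l s) -
        η s • ((((l + lam) ^ 2 : ℝ) + Complex.I * ((κ * Real.exp (2 * s) : ℝ) : ℂ)) *
        (starRingEnd ℂ) (angCoeff f l s)) =
        -(((Real.exp (2 * s) * radialOp lam l η s : ℝ) : ℂ) * (starRingEnd ℂ) (angCoeff f l s)) -
        Complex.I * κ *
          (((Real.exp (2 * s) * η s : ℝ) : ℂ) * (starRingEnd ℂ) (angCoeff f l s)) := by
      intro s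
      have e4 : Real.exp (2 * s) * radialOp lam l η s = -deriv (deriv η) s + (l + lam) ^ 2 * η s := by
        rw [radialOp, ← mul_assoc, ← Real.exp_add]
        simp
      rw [e4, Complex.real_smul, Complex.real_smul]
      push_cast
      ring
    simp only [e3]
    rw [integral_sub (by exact j2.neg) j3, integral_neg, integral_const_mul, ← h]
    simp
  have u1 := (locallyIntegrable_angCoeff f l)
  have u2 : LocallyIntegrable fun s => (starRingEnd ℂ) (angCoeff f l s) := fun s => by
    obtain ⟨t, ht, hi⟩ := u1 s
    exact ⟨t, ht, (Complex.conjLIE.toContinuousLinearEquiv.toContinuousLinearMap).integrable_comp hi⟩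
  have u3 : LocallyIntegrable fun s => ((((l + lam) ^ 2 : ℝ) : ℂ) + Complex.I *
      ((κ * Real.exp (2 * s) : ℝ) : ℂ)) * (starRingEnd ℂ) (angCoeff f l s) :=
    u2.continuous_mul (by fun_prop)
  rw [integral_sub] at key
  · exact sub_eq_zero.1 key
  · exact u2.integrable_smul_left_of_hasCompactSupport
      (contDiff_deriv (contDiff_deriv hη)).continuous hc.deriv.deriv
  · exact u3.integrable_smul_left_of_hasCompactSupport hη.continuous hc

/-- The angular Fourier coefficients of an element of a deficiency space. -/
theorem exists_continuous_angCoeff {lam κ : ℝ} {f : L2}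
    (hf : (f, (Complex.I * κ) • f) ∈ (abOperator lam).adjoint.graph) (l : ℤ) :
    ∃ P : ℝ → ℂ, Continuous P ∧ (∀ᵐ s, angCoeff f l s = P s) ∧ (P 0 = 0 → ∀ s, P s = 0) ∧
      (1 ≤ ((l : ℝ) + lam) ^ 2 → ∀ s, P s = 0) := by
  have u1 := (locallyIntegrable_angCoeff f l)
  have u2 : LocallyIntegrable fun s => (starRingEnd ℂ) (angCoeff f l s) := fun s => by
    obtain ⟨t, ht, hi⟩ := u1 s
    exact ⟨t, ht, (Complex.conjLIE.toContinuousLinearEquiv.toContinuousLinearMap).integrable_comp hi⟩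
  obtain ⟨p, q, hp, hq, hup⟩ := exists_classical_of_weak u2
    (c := fun s => ((((l + lam) ^ 2 : ℝ) : ℂ) + Complex.I * ((κ * Real.exp (2 * s) : ℝ) : ℂ)))
    (by fun_prop) fun η hη hc => continuous_conj_angCoeff_weak hf l hη hc
  have hsol : IsDecayingSolution (l + lam) (fun s => κ * Real.exp (2 * s)) p q := by
    refine ⟨hp, hq, (integrable_norm_sq_angCoeff f l).congr ?_⟩
    filter_upwards [hup] with s hs
    rw [← hs, RCLike.norm_conj]
  have hpc : Continuous p := continuous_iff_continuousAt.2 fun s => (hp s).continuousAt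
  refine ⟨fun s => (starRingEnd ℂ) (p s), Complex.continuous_conj.comp hpc, ?_, fun h0 s => ?_,
    fun h1 s => ?_⟩
  · filter_upwards [hup] with s hs
    rw [← hs, Complex.conj_conj]
  · have h2 : p 0 = 0 := (map_eq_zero _).1 h0
    simp [hsol.eq_zero_of_apply_zero (by fun_prop) h2 s]
  · simp [hsol.eq_zero_of_one_le h1 s]

/-- A deficiency vector is determined by the values at `s = 0` of its Fourier coefficients in the
critical modes, since all other coefficients vanish. This bounds the deficiency index by the number
of critical modes. -/
theorem exists_injective_deficiencySpace {ι : Type*} {lam : ℝ} (l : ι → ℤ)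
    (hl : ∀ k : ℤ, k ∉ Set.range l → 1 ≤ ((k : ℝ) + lam) ^ 2) (κ : ℝ) :
    ∃ φ : deficiencySpace (abOperator lam) (Complex.I * κ) →ₗ[ℂ] (ι → ℂ),
      Function.Injective φ := by
  have hex : ∀ (f : deficiencySpace (abOperator lam) (Complex.I * κ)) (k : ℤ), _ := fun f k =>
    exists_continuous_angCoeff (mem_deficiencySpace.1 f.2) k
  choose P hPc hP hP0 hP1 using hex
  -- Continuous representatives are unique, so the chosen `P` depends linearly on the vector,
  -- although it comes from an arbitrary choice.
  have huniq : ∀ (Q R : ℝ → ℂ), Continuous Q → Continuous R → (∀ᵐ s, Q s = R s) → Q = R :=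
    fun Q R hQ hR h => (Continuous.ae_eq_iff_eq volume hQ hR).1 h
  have hadd : ∀ f g k, P (f + g) k = fun s => P f k s + P g k s := fun f g k => by
    refine huniq _ _ (hPc _ _) ((hPc _ _).add (hPc _ _)) ?_
    filter_upwards [hP (f + g) k, hP f k, hP g k, angCoeff_add (f : L2) (g : L2) k]
      with s h1 h2 h3 h4
    rw [← h1, ← h2, ← h3]
    exact h4
  have hsmul : ∀ (c : ℂ) f k, P (c • f) k = fun s => c * P f k s := fun c f k => by
    refine huniq _ _ (hPc _ _) (continuous_const.mul (hPc _ _)) ?_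
    filter_upwards [hP (c • f) k, hP f k, angCoeff_smul c (f : L2) k] with s h1 h2 h3
    rw [← h1, ← h2]
    exact h3
  let φ : deficiencySpace (abOperator lam) (Complex.I * κ) →ₗ[ℂ] (ι → ℂ) :=
    { toFun := fun f i => P f (l i) 0
      map_add' := fun f g => by funext i; simp only [hadd, Pi.add_apply]
      map_smul' := fun c f => by
        funext i; simp only [hsmul, Pi.smul_apply, smul_eq_mul, RingHom.id_apply] }
  refine ⟨φ, (injective_iff_map_eq_zero φ).2 fun f hf => ?_⟩
  have h0 : (f : L2) = 0 := by
    refine eq_zero_of_angCoeff _ fun k => ?_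
    have hz : ∀ s, P f k s = 0 := by
      by_cases hk : k ∈ Set.range l
      · obtain ⟨i, rfl⟩ := hk
        exact hP0 f (l i) (congrFun hf i)
      · exact hP1 f k (hl k hk)
    filter_upwards [hP f k] with s hs
    rw [hs, hz]
  exact Subtype.ext h0

/-! ### The projections onto the sectors -/

theorem continuous_rotate (f : L2) : Continuous fun θ : ℝ => rotate θ f := by
  let g : ℝ → C(ℂ, ℂ) := fun θ =>
    ⟨rotation (Circle.exp θ), (rotation (Circle.exp θ)).continuous⟩
  have hg : Continuous g := by
    refine ContinuousMap.continuous_of_continuous_uncurry _ ?_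
    have : Function.uncurry (fun x y => g x y) =
        fun p : ℝ × ℂ => Complex.exp (p.1 * Complex.I) * p.2 := by
      funext p
      simp [g, Function.uncurry, rotation_apply]
    rw [this]
    fun_prop
  exact continuous_const.compMeasurePreservingLp hg
    (fun θ => (rotation (Circle.exp θ)).measurePreserving) (by simp)

theorem intervalIntegral_mem {V : Type*} [NormedAddCommGroup V] [NormedSpace ℂ V] [CompleteSpace V]
    (K : Submodule ℂ V) (hK : IsClosed (K : Set V)) {g : ℝ → V} (hg : Continuous g)
    (h : ∀ θ, g θ ∈ K) (a b : ℝ) : ∫ θ in a..b, g θ ∈ K := by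
  have : CompleteSpace K := hK.completeSpace_coe
  let g' : ℝ → K := fun θ => ⟨g θ, h θ⟩
  have hg' : Continuous g' := hg.subtype_mk h
  have h1 := K.subtypeL.intervalIntegral_comp_comm (μ := volume) (hg'.intervalIntegrable a b)
  have h2 : ∫ θ in a..b, g θ = K.subtypeL (∫ θ in a..b, g' θ) := h1
  rw [h2]
  exact Subtype.property _

/-- The integrand in the definition of the projection onto a sector. -/
def sectorIntegrand (l : ℤ) (f : L2) (θ : ℝ) : L2 :=
  Complex.exp (-(Complex.I * l * θ)) • rotate θ f

/-- The orthogonal projection onto the sector `l`. -/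
def sectorProj (l : ℤ) (f : L2) : L2 :=
  (2 * Real.pi : ℂ)⁻¹ • ∫ θ in (-Real.pi)..Real.pi, sectorIntegrand l f θ

theorem continuous_sectorIntegrand (l : ℤ) (f : L2) : Continuous (sectorIntegrand l f) :=
  (by fun_prop : Continuous fun θ : ℝ => Complex.exp (-(Complex.I * l * θ))).smul
    (continuous_rotate f)

theorem two_pi_ne_zero : (2 * Real.pi : ℂ) ≠ 0 := by
  have : (Real.pi : ℂ) ≠ 0 := by exact_mod_cast Real.pi_ne_zero
  simp [this]

theorem sectorProj_mem (l : ℤ) (f : L2) : sectorProj l f ∈ sector l := by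
  rw [mem_sector_iff]
  intro θ
  have hper : Function.Periodic (sectorIntegrand l f) (2 * Real.pi) := by
    intro t
    unfold sectorIntegrand
    rw [rotate_add_two_pi]
    congr 1
    rw [Complex.exp_eq_exp_iff_exists_int]
    refine ⟨-l, ?_⟩
    push_cast
    ring
  have h1 : ∀ t, rotate θ (sectorIntegrand l f t) =
      Complex.exp (Complex.I * l * θ) • sectorIntegrand l f (t + θ) := by
    intro t
    unfold sectorIntegrand
    rw [map_smul, rotate_rotate, smul_smul, ← Complex.exp_add, add_comm θ t]
    congr 2
    push_cast
    ring
  have h2 := (rotate θ).toContinuousLinearMap.intervalIntegral_comp_comm (μ := volume)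
    ((continuous_sectorIntegrand l f).intervalIntegrable (-Real.pi) Real.pi)
  simp only [LinearIsometry.coe_toContinuousLinearMap, h1] at h2
  have h3 := hper.intervalIntegral_add_eq (-Real.pi) (-Real.pi + θ)
  unfold sectorProj
  rw [map_smul, ← h2, intervalIntegral.integral_smul, smul_comm,
    intervalIntegral.integral_comp_add_right]
  congr 2
  rw [show -Real.pi + 2 * Real.pi = Real.pi by ring,
    show -Real.pi + θ + 2 * Real.pi = Real.pi + θ by ring] at h3
  exact h3.symm

/-- Together with membership in the sector, this characterizes the average over rotations as the
orthogonal projection. -/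
theorem inner_sectorProj {l : ℤ} {g : L2} (hg : g ∈ sector l) (f : L2) :
    ⟪g, sectorProj l f⟫_ℂ = ⟪g, f⟫_ℂ := by
  have h : ∀ θ, ⟪g, sectorIntegrand l f θ⟫_ℂ = ⟪g, f⟫_ℂ := by
    intro θ
    have h1 := (rotate θ).inner_map_map g f
    rw [mem_sector_iff.1 hg, inner_smul_left, ← Complex.exp_conj] at h1
    rw [sectorIntegrand, inner_smul_right, ← h1]
    congr 2
    simp
  have h2 := (innerSL ℂ g).intervalIntegral_comp_comm (μ := volume)
    ((continuous_sectorIntegrand l f).intervalIntegrable (-Real.pi) Real.pi)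
  simp only [innerSL_apply_apply, h] at h2
  rw [sectorProj, inner_smul_right, ← h2, intervalIntegral.integral_const, ← Complex.coe_smul,
    smul_eq_mul, ← mul_assoc]
  have : (2 * Real.pi : ℂ)⁻¹ * ((Real.pi - -Real.pi : ℝ) : ℂ) = 1 := by
    push_cast
    rw [sub_neg_eq_add, ← two_mul]
    exact inv_mul_cancel₀ two_pi_ne_zero
  rw [this, one_mul]

theorem sectorProj_of_mem {l : ℤ} {f : L2} (hf : f ∈ sector l) : sectorProj l f = f := by
  have h := (sector l).sub_mem (sectorProj_mem l f) hf
  rw [← sub_eq_zero, ← inner_self_eq_zero (𝕜 := ℂ)]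
  nth_rewrite 2 [sub_eq_add_neg]
  rw [inner_add_right, inner_neg_right, inner_sectorProj h, add_neg_cancel]

theorem sectorProj_add (l : ℤ) (f g : L2) :
    sectorProj l (f + g) = sectorProj l f + sectorProj l g := by
  have : ∀ θ, sectorIntegrand l (f + g) θ = sectorIntegrand l f θ + sectorIntegrand l g θ :=
    fun θ => by simp [sectorIntegrand]
  simp only [sectorProj, this]
  rw [intervalIntegral.integral_add ((continuous_sectorIntegrand l f).intervalIntegrable _ _)
    ((continuous_sectorIntegrand l g).intervalIntegrable _ _), smul_add]

theorem sectorProj_eq_zero {l l' : ℤ} (h : l ≠ l') {f : L2} (hf : f ∈ sector l') :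
    sectorProj l f = 0 := by
  have h1 := inner_sectorProj (sectorProj_mem l f) f
  rw [inner_sector_of_ne h (sectorProj_mem l f) hf] at h1
  exact inner_self_eq_zero.1 h1

/-- The projected pair is an average of rotated graph elements, and a closed invariant subspace
contains its averages. -/
theorem sectorProj_mem_graph {T : L2 →ₗ.[ℂ] L2} (hT : T.IsClosed)
    (hrot : ∀ θ, Intertwines (rotate θ) 1 T) (l : ℤ) {a b : L2} (h : (a, b) ∈ T.graph) :
    (sectorProj l a, sectorProj l b) ∈ T.graph := by
  have ca := continuous_sectorIntegrand l a
  have cb := continuous_sectorIntegrand l b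
  have h1 := intervalIntegral_mem T.graph hT (ca.prodMk cb) (fun θ => by
    have h2 := T.graph.smul_mem (Complex.exp (-(Complex.I * l * θ))) (hrot θ a b h)
    simpa [sectorIntegrand] using h2) (-Real.pi) Real.pi
  have i := (ca.prodMk cb).intervalIntegrable (μ := volume) (-Real.pi) Real.pi
  have e1 := (ContinuousLinearMap.fst ℂ L2 L2).intervalIntegral_comp_comm i
  have e2 := (ContinuousLinearMap.snd ℂ L2 L2).intervalIntegral_comp_comm i
  have e : (sectorProj l a, sectorProj l b) = (2 * Real.pi : ℂ)⁻¹ •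
      ∫ θ in (-Real.pi)..Real.pi, (sectorIntegrand l a θ, sectorIntegrand l b θ) := by
    refine Prod.ext ?_ ?_
    · exact congrArg (fun x => (2 * Real.pi : ℂ)⁻¹ • x) e1
    · exact congrArg (fun x => (2 * Real.pi : ℂ)⁻¹ • x) e2
  rw [e]
  exact T.graph.smul_mem _ h1

/-! ### Parts in the sectors -/

theorem mem_sectorPart_graph {T : L2 →ₗ.[ℂ] L2} {l : ℤ} {x y : sector l} :
    (x, y) ∈ (sectorPart T l).graph ↔ ((x : L2), (y : L2)) ∈ T.graph := by
  constructor
  · intro h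
    obtain ⟨u, h1, h2⟩ := (LinearPMap.mem_graph_iff _).1 h
    simp only at h1 h2
    rw [← h1, ← h2]
    exact T.mem_graph ⟨(u : sector l), u.2.1⟩
  · intro h
    obtain ⟨u, h1, h2⟩ := (LinearPMap.mem_graph_iff _).1 h
    simp only at h1 h2
    have hx : (x : L2) ∈ T.domain := h1 ▸ u.2
    have hu : u = ⟨x, hx⟩ := Subtype.ext h1
    have hy : T ⟨x, hx⟩ ∈ sector l := by rw [← hu, h2]; exact y.2
    refine (LinearPMap.mem_graph_iff _).2 ⟨⟨x, hx, hy⟩, rfl, Subtype.ext ?_⟩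
    change T ⟨x, hx⟩ = y
    rw [← hu, h2]

theorem mem_sector_of_graph {T : L2 →ₗ.[ℂ] L2} (hrot : ∀ θ, Intertwines (rotate θ) 1 T) {l : ℤ}
    {x y : L2} (h : (x, y) ∈ T.graph) (hx : x ∈ sector l) : y ∈ sector l := by
  rw [mem_sector_iff]
  intro θ
  have h1 := hrot θ x y h
  rw [mem_sector_iff.1 hx, one_smul] at h1
  exact graph_unique h1 (T.graph.smul_mem (Complex.exp (Complex.I * l * θ)) h)

theorem mem_sectorPart_domain {T : L2 →ₗ.[ℂ] L2} (hrot : ∀ θ, Intertwines (rotate θ) 1 T) {l : ℤ}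
    {x : sector l} (hx : (x : L2) ∈ T.domain) : x ∈ (sectorPart T l).domain := by
  obtain ⟨y, hy⟩ := exists_graph hx
  exact ⟨hx, mem_sector_of_graph hrot (T.mem_graph ⟨x, hx⟩) x.2⟩

theorem sectorPart_le {S T : L2 →ₗ.[ℂ] L2} (h : S ≤ T) (l : ℤ) :
    sectorPart S l ≤ sectorPart T l := by
  refine LinearPMap.le_graph_iff.1 ?_
  rintro ⟨x, y⟩ hxy
  exact mem_sectorPart_graph.2 (graph_le h (mem_sectorPart_graph.1 hxy))

theorem dense_sectorPart {T : L2 →ₗ.[ℂ] L2} (hT : T.IsClosed) (hd : Dense (T.domain : Set L2))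
    (hrot : ∀ θ, Intertwines (rotate θ) 1 T) (l : ℤ) :
    Dense ((sectorPart T l).domain : Set (sector l)) := by
  rw [Submodule.dense_iff_topologicalClosure_eq_top, Submodule.topologicalClosure_eq_top_iff,
    Submodule.eq_bot_iff]
  intro g hg
  rw [Submodule.mem_orthogonal'] at hg
  have h0 : (g : L2) = 0 := by
    refine hd.eq_zero_of_inner_left ℂ fun a ha => ?_
    obtain ⟨b, hb⟩ := exists_graph ha
    have h1 := sectorProj_mem_graph hT hrot l hb
    have h2 := hg ⟨sectorProj l a, sectorProj_mem l a⟩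
      (mem_sectorPart_domain hrot (mem_domain_of_graph h1))
    rw [Submodule.coe_inner] at h2
    rw [← inner_sectorProj g.2]
    exact h2
  exact Subtype.ext h0

/-- The sector reduces `T`: a vector of the sector sees a test pair only through its projection, so
the adjoint relation in the sector implies the one in the whole space. -/
theorem isSelfAdjoint_sectorPart {T : L2 →ₗ.[ℂ] L2} (hT : IsSelfAdjoint T)
    (hrot : ∀ θ, Intertwines (rotate θ) 1 T) (l : ℤ) : IsSelfAdjoint (sectorPart T l) := by
  have hd := hT.dense_domain
  have hcl : T.IsClosed := by
    rw [← LinearPMap.isSelfAdjoint_def.1 hT]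
    exact LinearPMap.adjoint_isClosed hd
  have hsd := dense_sectorPart hcl hd hrot l
  have hs : T.IsFormalAdjoint T := by
    have := LinearPMap.adjoint_isFormalAdjoint hd
    rwa [LinearPMap.isSelfAdjoint_def.1 hT] at this
  have hs' : (sectorPart T l).IsFormalAdjoint (sectorPart T l) := by
    rw [isFormalAdjoint_iff_graph] at hs ⊢
    intro a b c d hab hcd
    exact hs _ _ _ _ (mem_sectorPart_graph.1 hab) (mem_sectorPart_graph.1 hcd)
  rw [LinearPMap.isSelfAdjoint_def]
  refine le_antisymm ?_ (LinearPMap.IsFormalAdjoint.le_adjoint hsd hs')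
  refine LinearPMap.le_graph_iff.1 ?_
  rintro ⟨y, w⟩ h
  have h' := (mem_graph_adjoint_iff hsd).1 h
  rw [mem_sectorPart_graph, ← LinearPMap.isSelfAdjoint_def.1 hT, mem_graph_adjoint_iff hd]
  intro a b hab
  have h1 := h' ⟨sectorProj l a, sectorProj_mem l a⟩ ⟨sectorProj l b, sectorProj_mem l b⟩
    (mem_sectorPart_graph.2 (sectorProj_mem_graph hcl hrot l hab))
  rw [Submodule.coe_inner, Submodule.coe_inner] at h1
  rw [← inner_sectorProj w.2, ← inner_sectorProj y.2]
  exact h1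

/-! ### Symmetries of the boundary profiles -/

/-- For restrictions of a common symmetric operator, symmetry is a property of the domain alone. -/
theorem Intertwines.of_domain {U : L2 → L2} {c : ℂ} {T R : L2 →ₗ.[ℂ] L2} (hTR : T ≤ R)
    (hR : Intertwines U c R) (h : ∀ a ∈ T.domain, U a ∈ T.domain) : Intertwines U c T := by
  intro a b hab
  obtain ⟨y, hy⟩ := exists_graph (h a (mem_domain_of_graph hab))
  have := graph_unique (graph_le hTR hy) (hR a b (graph_le hTR hab))
  rwa [← this]

theorem Intertwines.mem_domain {U : L2 → L2} {c : ℂ} {T : L2 →ₗ.[ℂ] L2}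
    (h : Intertwines U c T) {a : L2} (ha : a ∈ T.domain) : U a ∈ T.domain := by
  obtain ⟨b, hb⟩ := exists_graph ha
  exact mem_domain_of_graph (h a b hb)

theorem IsProfile.shift {lam : ℝ} {l : ℤ} {a : ℝ → ℝ} (h : IsProfile lam l a) (τ : ℝ) :
    IsProfile lam l fun s => a (s + τ) where
  smooth := h.smooth.comp (contDiff_id.add contDiff_const)
  zero := by
    obtain ⟨R, hR⟩ := h.zero
    exact ⟨R - τ, fun s hs => hR _ (by linarith)⟩
  harmonic := by
    obtain ⟨r, hr⟩ := h.harmonic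
    refine ⟨r - τ, fun s hs => ?_⟩
    have h1 : deriv (fun s => a (s + τ)) = fun s => deriv a (s + τ) := by
      funext s
      rw [deriv_comp_add_const]
    rw [h1, deriv_comp_add_const, hr _ (by linarith)]
  integrable := by
    refine ((h.integrable.comp_add_right τ).const_mul (Real.exp (-(2 * τ)))).congr
      (ae_of_all _ fun s => ?_)
    simp only
    rw [← mul_assoc, ← Real.exp_add]
    congr 2
    ring

theorem dilation_polarL2 {lam : ℝ} {l : ℤ} {a : ℝ → ℝ} (h : IsProfile lam l a) (τ : ℝ) :
    dilation τ (polarL2 a l) = (Real.exp τ : ℂ) • polarL2 (fun s => a (s + τ)) l := by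
  rw [polarL2_eq (h.memLp l), polarL2_eq ((h.shift τ).memLp l)]
  apply Lp.ext
  filter_upwards [dilation_coe τ ((h.memLp l).toLp _), ((h.shift τ).memLp l).coeFn_toLp,
    ae_comp_mul (Real.exp_pos τ).ne' (h.memLp l).coeFn_toLp,
    Lp.coeFn_smul (Real.exp τ : ℂ) (((h.shift τ).memLp l).toLp _)] with z h1 h2 h3 h4
  have hn : ‖(Real.exp τ : ℂ)‖ = Real.exp τ := by
    rw [Complex.norm_real, Real.norm_eq_abs, abs_of_pos (Real.exp_pos τ)]
  have hne : (Real.exp τ : ℂ) ≠ 0 := by exact_mod_cast (Real.exp_pos τ).ne'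
  rw [h1, h4, Pi.smul_apply, h2, smul_eq_mul, h3, polarFun_mul _ _ hne, hn, Real.log_exp,
    div_self hne, one_zpow, one_mul]

/-- A profile which is an approximate eigenvector of the dilations near `-∞`. -/
theorem dilation_polarL2_sub_mem {lam : ℝ} {l : ℤ} {a : ℝ → ℝ} (h : IsProfile lam l a) {τ c : ℝ}
    (hc : ∃ r, ∀ s, s < r → a (s + τ) = c * a s) :
    dilation τ (polarL2 a l) - ((Real.exp τ * c : ℝ) : ℂ) • polarL2 a l ∈
      (abOperator lam).domain := by
  rw [dilation_polarL2 h]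
  have := (abOperator lam).domain.smul_mem (Real.exp τ : ℂ) (polarL2_sub_mem (h.shift τ) h hc)
  rwa [smul_sub, smul_smul, ← Complex.ofReal_mul] at this

theorem powProfile_cut_shift (k τ : ℝ) :
    ∃ r, ∀ s, s < r → powProfile cut k (s + τ) = Real.exp (k * τ) * powProfile cut k s := by
  refine ⟨min 0 (-τ), fun s hs => ?_⟩
  rw [powProfile, powProfile, cut_of_nonpos (hs.le.trans (min_le_left _ _)),
    cut_of_nonpos (by linarith [hs.le.trans (min_le_right _ _)]), one_mul, one_mul, ← Real.exp_add]
  congr 1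
  ring

/-- Since `log(e^τ r) = log r + τ`, the dilations act modulo the minimal domain by a Jordan block
whose off-diagonal entry is the constant profile. -/
theorem dilation_logProfile_sub_mem {lam : ℝ} {l : ℤ} (hl : (l : ℝ) + lam = 0) (τ : ℝ) :
    dilation τ (polarL2 logProfile l) - (Real.exp τ : ℂ) • polarL2 logProfile l -
      ((Real.exp τ * τ : ℝ) : ℂ) • polarL2 (powProfile cut 0) l ∈ (abOperator lam).domain := by
  have hL := isProfile_logProfile hl
  have hC : IsProfile lam l (powProfile cut 0) :=
    isProfile_powProfile isCutoff_cut (by norm_num) (by rw [hl])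
  rw [dilation_polarL2 hL]
  -- The difference equals the constant `τ` near `-∞`, so it is itself a profile and can be compared
  -- with the constant one.
  have hD : IsProfile lam l fun s => logProfile (s + τ) - 1 * logProfile s := by
    refine ⟨(hL.shift τ).smooth.sub (contDiff_const.mul hL.smooth), ?_, ?_, ?_⟩
    · obtain ⟨R₁, h₁⟩ := (hL.shift τ).zero
      obtain ⟨R₂, h₂⟩ := hL.zero
      refine ⟨max R₁ R₂, fun s hs => ?_⟩
      rw [h₁ s ((le_max_left _ _).trans hs), h₂ s ((le_max_right _ _).trans hs)]
      ring
    · refine ⟨min 0 (-τ), fun s hs => ?_⟩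
      have e : (fun s => logProfile (s + τ) - 1 * logProfile s) =ᶠ[𝓝 s] fun _ => τ := by
        filter_upwards [gt_mem_nhds hs] with u hu
        rw [logProfile, logProfile, cut_of_nonpos (hu.le.trans (min_le_left _ _)),
          cut_of_nonpos (by linarith [hu.le.trans (min_le_right _ _)])]
        ring
      rw [e.deriv.deriv_eq, hl]
      simp
    · have h1 := ((hL.shift τ).integrable.add hL.integrable).const_mul 2
      have c1 := hL.smooth.continuous
      refine h1.mono' (by fun_prop) (ae_of_all _ fun s => ?_)
      rw [Real.norm_eq_abs, abs_of_nonneg (by positivity)]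
      have := Real.exp_pos (2 * s)
      have h2 : (logProfile (s + τ) - 1 * logProfile s) ^ 2 ≤
          2 * (logProfile (s + τ) ^ 2 + logProfile s ^ 2) := by
        nlinarith [sq_nonneg (logProfile (s + τ) + logProfile s)]
      calc _ ≤ Real.exp (2 * s) * (2 * (logProfile (s + τ) ^ 2 + logProfile s ^ 2)) := by gcongr
        _ = _ := by simp only [Pi.add_apply]; ring
  have h1 := polarL2_sub_mem (c := τ) hD hC ⟨min 0 (-τ), fun s hs => by
    rw [logProfile, logProfile, powProfile, cut_of_nonpos (hs.le.trans (min_le_left _ _)),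
      cut_of_nonpos (by linarith [hs.le.trans (min_le_right _ _)])]
    simp⟩
  rw [polarL2_sub 1 ((hL.shift τ).memLp l) (hL.memLp l)] at h1
  have h2 := (abOperator lam).domain.smul_mem (Real.exp τ : ℂ) h1
  rw [Complex.ofReal_one, one_smul, smul_sub, smul_sub, smul_smul, ← Complex.ofReal_mul] at h2
  exact h2

/-! ### The boundary vectors of the Aharonov–Bohm operator -/

/-- The boundary profiles for the exponent `k`: the regular one for `true` and the singular one
for `false`. -/
def profile (k : ℝ) (b : Bool) : ℝ → ℝ :=
  bif b then powProfile cut k else if k = 0 then logProfile else powProfile cut (-k)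

theorem isProfile_profile {lam k : ℝ} {l : ℤ} (hk : k = |(l : ℝ) + lam|) (hk1 : k < 1) (b : Bool) :
    IsProfile lam l (profile k b) := by
  have h0 : 0 ≤ k := hk ▸ abs_nonneg _
  have hsq : k ^ 2 = (l + lam) ^ 2 := by rw [hk, sq_abs]
  unfold profile
  cases b
  · simp only [cond_false]
    split_ifs with h
    · refine isProfile_logProfile ?_
      rw [← abs_eq_zero, ← hk, h]
    · exact isProfile_powProfile isCutoff_cut (by linarith) (by rw [neg_sq, hsq])
  · exact isProfile_powProfile isCutoff_cut (by linarith) hsq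

theorem wronskian_profile {k : ℝ} : ∃ c : ℝ, c ≠ 0 ∧ ∃ r, ∀ s, s < r →
    profile k true s * deriv (profile k false) s -
      deriv (profile k true) s * profile k false s = c := by
  unfold profile
  simp only [cond_true, cond_false]
  split_ifs with h
  · subst h
    exact ⟨1, one_ne_zero, wronskian_log⟩
  · exact ⟨-2 * k, by simpa using h, wronskian_pow⟩

/-- The angular momenta for which the radial operator has boundary values at the origin. -/
structure CriticalModes (lam : ℝ) (ι : Type) where
  mode : ι → ℤ
  injective : Function.Injective mode
  lt_one : ∀ i, |(mode i : ℝ) + lam| < 1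
  complete : ∀ n : ℤ, n ∉ Set.range mode → 1 ≤ ((n : ℝ) + lam) ^ 2

namespace CriticalModes

variable {lam : ℝ} {ι : Type} (M : CriticalModes lam ι)

/-- The exponent of the regular solution. -/
def expo (i : ι) : ℝ := |(M.mode i : ℝ) + lam|

/-- The boundary vectors. -/
def vec (i : ι) (b : Bool) : L2 := polarL2 (profile (M.expo i) b) (M.mode i)

theorem isProfile (i : ι) (b : Bool) : IsProfile lam (M.mode i) (profile (M.expo i) b) :=
  isProfile_profile rfl (M.lt_one i) b

/-- The boundary pairs of the Aharonov–Bohm operator. -/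
def pairs : BoundaryPairs (abOperator lam) ι where
  vec := M.vec
  img i b := polarL2 (radialOp lam (M.mode i) (profile (M.expo i) b)) (M.mode i)
  mem_graph i b := (M.isProfile i b).mem_adjoint
  symm i j b c h := by
    by_cases hij : i = j
    · subst hij
      have hbc : b = c := h.resolve_left (fun h => h rfl)
      subst hbc
      exact polarL2_symm (M.isProfile i b)
    · have hne : M.mode i ≠ M.mode j := fun h => hij (M.injective h)
      rw [vec, vec, inner_polarL2_of_ne hne, inner_polarL2_of_ne hne]
  ne i := by
    obtain ⟨c, hc, h⟩ := wronskian_profile (k := M.expo i)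
    exact polarL2_wronskian (M.isProfile i true) (M.isProfile i false) h hc

variable [Fintype ι]

theorem deficiency : HasDeficiencyIndices (abOperator lam) (Fintype.card ι) (Fintype.card ι) ∧
    ∀ f ∈ (abOperator lam).adjoint.domain, ∃ s ∈ (abOperator lam).domain, ∃ c : ι → Bool → ℂ,
      f = s + ∑ j, ∑ d, c j d • M.pairs.vec j d := by
  refine M.pairs.finrank_deficiency (abOperator_isClosedHermitian lam) ?_ ?_
  · have h := exists_injective_deficiencySpace (lam := lam) M.mode M.complete 1
    rwa [Complex.ofReal_one, mul_one] at h
  · have h := exists_injective_deficiencySpace (lam := lam) M.mode M.complete (-1)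
    rwa [Complex.ofReal_neg, Complex.ofReal_one, mul_neg, mul_one] at h

/-- The self-adjoint extension with the boundary conditions `σ`. -/
def ext (σ : ι → Bool) : L2 →ₗ.[ℂ] L2 := M.pairs.ext σ

theorem isSelfAdjoint_ext (σ : ι → Bool) : IsSelfAdjoint (M.ext σ) :=
  M.pairs.isSelfAdjoint_ext (abOperator_isClosedHermitian lam) M.deficiency.2 σ

theorem le_ext (σ : ι → Bool) : abOperator lam ≤ M.ext σ :=
  M.pairs.le_ext (abOperator_isClosedHermitian lam) σ

theorem ext_le (σ : ι → Bool) : M.ext σ ≤ (abOperator lam).adjoint := M.pairs.ext_le_adjoint σ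

theorem mem_ext_domain {σ : ι → Bool} {x : L2} : x ∈ (M.ext σ).domain ↔
    ∃ s ∈ (abOperator lam).domain, ∃ c : ι → ℂ, x = s + ∑ i, c i • M.vec i (σ i) := by
  have hS := abOperator_isClosedHermitian lam
  constructor
  · intro h
    obtain ⟨y, hy⟩ := exists_graph h
    obtain ⟨s, s', c, h1, h2, -⟩ := (M.pairs.mem_ext_graph hS σ).1 hy
    exact ⟨s, mem_domain_of_graph h1, c, h2⟩
  · rintro ⟨s, hs, c, rfl⟩
    obtain ⟨s', hs'⟩ := exists_graph hs
    exact mem_domain_of_graph ((M.pairs.mem_ext_graph hS σ).2 ⟨s, s', c, hs', rfl, rfl⟩)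

theorem vec_mem_ext (σ : ι → Bool) (i : ι) : M.vec i (σ i) ∈ (M.ext σ).domain :=
  mem_domain_of_graph (M.pairs.vec_mem_ext (abOperator_isClosedHermitian lam) σ i)

theorem vec_mem_sector (i : ι) (b : Bool) : M.vec i b ∈ sector (M.mode i) :=
  polarL2_mem_sector _ _

theorem ext_rotate (σ : ι → Bool) (θ : ℝ) : Intertwines (rotate θ) 1 (M.ext σ) := by
  refine Intertwines.of_domain (M.ext_le σ) (adjoint_rotate lam θ) fun x hx => ?_
  obtain ⟨s, hs, c, rfl⟩ := M.mem_ext_domain.1 hx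
  refine M.mem_ext_domain.2 ⟨rotate θ s, (abOperator_rotate lam θ).mem_domain hs,
    fun i => c i * Complex.exp (Complex.I * M.mode i * θ), ?_⟩
  rw [map_add, map_sum]
  congr 1
  refine Finset.sum_congr rfl fun i _ => ?_
  rw [map_smul, mem_sector_iff.1 (M.vec_mem_sector i (σ i)), smul_smul]

/-- The exponents of the boundary profiles. -/
def sgnExpo (i : ι) (b : Bool) : ℝ := bif b then M.expo i else -M.expo i

theorem sgnExpo_sq (i : ι) (b : Bool) : M.sgnExpo i b ^ 2 = (M.mode i + lam) ^ 2 := by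
  cases b <;> simp [sgnExpo, expo]

theorem lt_sgnExpo (i : ι) (b : Bool) : -1 < M.sgnExpo i b := by
  have h1 := M.lt_one i
  have h0 := abs_nonneg ((M.mode i : ℝ) + lam)
  cases b <;> simp only [sgnExpo, expo, cond_true, cond_false] <;> linarith

theorem profile_eq {i : ι} {b : Bool} (h : b = true ∨ M.expo i ≠ 0) :
    profile (M.expo i) b = powProfile cut (M.sgnExpo i b) := by
  cases b
  · have h' := h.resolve_left (by simp)
    simp [profile, sgnExpo, h']
  · rfl

theorem dilation_vec {i : ι} {b : Bool} (h : b = true ∨ M.expo i ≠ 0) (τ : ℝ) :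
    dilation τ (M.vec i b) - ((Real.exp τ * Real.exp (M.sgnExpo i b * τ) : ℝ) : ℂ) • M.vec i b ∈
      (abOperator lam).domain := by
  refine dilation_polarL2_sub_mem (M.isProfile i b) ?_
  rw [M.profile_eq h]
  exact powProfile_cut_shift _ τ

/-- The hypothesis excludes exactly the logarithmic vectors; the selected ones are dilation
eigenvectors modulo the minimal domain. -/
theorem ext_dilation {σ : ι → Bool} (h : ∀ i, σ i = true ∨ M.expo i ≠ 0) :
    IsHomogeneous (-2) (M.ext σ) := by
  rw [isHomogeneous_iff]
  intro τ
  have e : -(-2 * τ) = 2 * τ := by ring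
  rw [e]
  refine Intertwines.of_domain (M.ext_le σ) (adjoint_dilation lam τ) fun x hx => ?_
  obtain ⟨s, hs, c, rfl⟩ := M.mem_ext_domain.1 hx
  have hsum : ∀ t : Finset ι, ∀ f : ι → L2, dilation τ (∑ i ∈ t, f i) = ∑ i ∈ t, dilation τ (f i) :=
    fun t f => map_sum (dilationₗᵢ τ) f t
  rw [dilation_add, hsum]
  refine (M.ext σ).domain.add_mem ?_ (Submodule.sum_mem _ fun i _ => ?_)
  · exact (M.le_ext σ).1 ((abOperator_dilation lam τ).mem_domain hs)
  · rw [dilation_smul]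
    refine (M.ext σ).domain.smul_mem _ ?_
    have h1 := (M.le_ext σ).1 (M.dilation_vec (h i) τ)
    have h2 := (M.ext σ).domain.add_mem h1
      ((M.ext σ).domain.smul_mem (((Real.exp τ * Real.exp (M.sgnExpo i (σ i) * τ) : ℝ) : ℂ))
        (M.vec_mem_ext σ i))
    rwa [sub_add_cancel] at h2

end CriticalModes

/-! ### Comparison of self-adjoint extensions inside the maximal operator. -/

theorem isSelfAdjoint_le_adjoint {S H : L2 →ₗ.[ℂ] L2} (hd : Dense (S.domain : Set L2))
    (hSH : S ≤ H) (hH : IsSelfAdjoint H) : H ≤ S.adjoint := by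
  refine LinearPMap.le_graph_iff.1 ?_
  rintro ⟨y, w⟩ h
  rw [← LinearPMap.isSelfAdjoint_def.1 hH, mem_graph_adjoint_iff hH.dense_domain] at h
  exact (mem_graph_adjoint_iff hd).2 fun a b hab => h a b (graph_le hSH hab)

theorem eq_of_le_of_isSelfAdjoint {H K : L2 →ₗ.[ℂ] L2} (hH : IsSelfAdjoint H)
    (hK : IsSelfAdjoint K) (h : H ≤ K) : H = K := by
  refine le_antisymm h ?_
  have := isSelfAdjoint_le_adjoint hH.dense_domain h hK
  rwa [LinearPMap.isSelfAdjoint_def.1 hH] at this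

theorem isFormalAdjoint_of_isSelfAdjoint {H : L2 →ₗ.[ℂ] L2} (hH : IsSelfAdjoint H) :
    H.IsFormalAdjoint H := by
  have := LinearPMap.adjoint_isFormalAdjoint hH.dense_domain
  rwa [LinearPMap.isSelfAdjoint_def.1 hH] at this

theorem isClosed_of_isSelfAdjoint {H : L2 →ₗ.[ℂ] L2} (hH : IsSelfAdjoint H) : H.IsClosed := by
  rw [← LinearPMap.isSelfAdjoint_def.1 hH]
  exact LinearPMap.adjoint_isClosed hH.dense_domain

/-- Restrictions of the same operator are ordered as their domains. -/
theorem le_of_domain_le {H K T : L2 →ₗ.[ℂ] L2} (hH : H ≤ T) (hK : K ≤ T)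
    (h : H.domain ≤ K.domain) : H ≤ K := by
  refine LinearPMap.le_graph_iff.1 ?_
  rintro ⟨a, b⟩ hab
  obtain ⟨y, hy⟩ := exists_graph (h (mem_domain_of_graph hab))
  rwa [graph_unique (graph_le hH hab) (graph_le hK hy)]

namespace CriticalModes

variable {lam : ℝ} {ι : Type} (M : CriticalModes lam ι) [Fintype ι]

/-! ### Homogeneous extensions -/

/-- The boundary form of the two vectors of a pair is nonzero, which no hermitian operator allows.
-/
theorem not_mem_both {H : L2 →ₗ.[ℂ] L2} (hs : H.IsFormalAdjoint H)
    (hle : H ≤ (abOperator lam).adjoint) (i : ι) (h1 : M.vec i true ∈ H.domain)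
    (h2 : M.vec i false ∈ H.domain) : False := by
  obtain ⟨y1, g1⟩ := exists_graph h1
  obtain ⟨y2, g2⟩ := exists_graph h2
  have e1 := graph_unique (graph_le hle g1) (M.pairs.mem_graph i true)
  have e2 := graph_unique (graph_le hle g2) (M.pairs.mem_graph i false)
  have := isFormalAdjoint_iff_graph.1 hs _ _ _ _ g1 g2
  rw [e1, e2] at this
  exact M.pairs.ne i this

theorem ext_injective : Function.Injective M.ext := by
  intro σ σ' h
  funext i
  by_contra hne
  have h1 := M.vec_mem_ext σ i
  have h2 := M.vec_mem_ext σ' i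
  rw [← h] at h2
  have hs := isFormalAdjoint_of_isSelfAdjoint (M.isSelfAdjoint_ext σ)
  rcases hb : σ i with _ | _ <;> rcases hb' : σ' i with _ | _ <;> rw [hb] at h1 hne <;>
    rw [hb'] at h2 hne
  · exact hne rfl
  · exact M.not_mem_both hs (M.ext_le σ) i h2 h1
  · exact M.not_mem_both hs (M.ext_le σ) i h1 h2
  · exact hne rfl

theorem vec_notMem (i : ι) (b : Bool) : M.vec i b ∉ (abOperator lam).domain := by
  classical
  intro h
  have := M.pairs.coeff_eq_zero (abOperator_isClosedHermitian lam)
    (fun j d => if j = i ∧ d = b then 1 else 0) (by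
      have e : ∑ j, ∑ d, (if j = i ∧ d = b then (1 : ℂ) else 0) • M.pairs.vec j d = M.vec i b := by
        rw [Finset.sum_eq_single i, Finset.sum_eq_single b]
        · simp [pairs]
        · intro d _ hd; simp [hd]
        · simp
        · intro j _ hj; simp [hj]
        · simp
      rw [e]
      exact h) i b
  simp at this

theorem exists_coeff {H : L2 →ₗ.[ℂ] L2} (hle : H ≤ (abOperator lam).adjoint) {x : L2}
    (hx : x ∈ H.domain) : ∃ s ∈ (abOperator lam).domain, ∃ c : ι → Bool → ℂ,
      x = s + ∑ j, ∑ d, c j d • M.vec j d := M.deficiency.2 x (hle.1 hx)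

/-- The self-adjoint extensions which are homogeneous and rotation symmetric, when there is no
logarithmic mode. -/
theorem exists_eq_ext (hk : ∀ i, M.expo i ≠ 0) {H : L2 →ₗ.[ℂ] L2} (hSH : abOperator lam ≤ H)
    (hH : IsSelfAdjoint H) (hhom : IsHomogeneous (-2) H) (hrot : IsRotationSymmetric H) :
    ∃ σ, H = M.ext σ := by
  classical
  have hS := abOperator_isClosedHermitian lam
  have hle := isSelfAdjoint_le_adjoint hS.dense hSH hH
  have hs := isFormalAdjoint_of_isSelfAdjoint hH
  have hcl := isClosed_of_isSelfAdjoint hH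
  rw [isHomogeneous_iff] at hhom
  rw [isRotationSymmetric_iff] at hrot
  have key : ∀ x ∈ H.domain, ∀ s ∈ (abOperator lam).domain, ∀ c : ι → Bool → ℂ,
      x = s + ∑ j, ∑ d, c j d • M.vec j d → ∀ i b, c i b ≠ 0 → M.vec i b ∈ H.domain := by
    intro x hx s hsd c hc i b hcb
    obtain ⟨y, hy⟩ := exists_graph hx
    -- Rotation symmetry isolates mode `i`; homogeneity then has to separate its two boundary
    -- vectors.
    have h1 := mem_domain_of_graph (sectorProj_mem_graph hcl hrot (M.mode i) hy)
    obtain ⟨s', hs'⟩ := exists_graph hsd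
    have h2 := hSH.1 (mem_domain_of_graph
      (sectorProj_mem_graph hS.closed (abOperator_rotate lam) (M.mode i) hs'))
    have h3 : sectorProj (M.mode i) x =
        sectorProj (M.mode i) s + ∑ d, c i d • M.vec i d := by
      have e : ∑ j, ∑ d, c j d • M.vec j d = ∑ d, c i d • M.vec i d +
          ∑ j ∈ Finset.univ.erase i, ∑ d, c j d • M.vec j d :=
        (Finset.add_sum_erase _ _ (Finset.mem_univ i)).symm
      rw [hc, e, sectorProj_add, sectorProj_add,
        sectorProj_of_mem (f := ∑ d, c i d • M.vec i d)]
      · have hz : ∀ t : Finset ι, i ∉ t →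
            sectorProj (M.mode i) (∑ j ∈ t, ∑ d, c j d • M.vec j d) = 0 := by
          intro t
          induction t using Finset.induction_on with
          | empty => intro _; simpa using sectorProj_of_mem (sector (M.mode i)).zero_mem
          | insert j t hj ih =>
            intro hi
            rw [Finset.mem_insert, not_or] at hi
            rw [Finset.sum_insert hj, sectorProj_add, ih hi.2, add_zero]
            refine sectorProj_eq_zero (fun h => hi.1 (M.injective h))
              (Submodule.sum_mem _ fun d _ => Submodule.smul_mem _ _ (M.vec_mem_sector j d))
        rw [hz _ (Finset.notMem_erase i _), add_zero]
      · exact Submodule.sum_mem _ fun d _ => Submodule.smul_mem _ _ (M.vec_mem_sector i d)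
    have h4 : ∑ d, c i d • M.vec i d ∈ H.domain := by
      have := H.domain.sub_mem h1 h2
      rwa [h3, add_sub_cancel_left] at this
    set μ : Bool → ℂ := fun d => ((Real.exp 1 * Real.exp (M.sgnExpo i d * 1) : ℝ) : ℂ) with hμ
    have hv : ∀ d, dilation 1 (M.vec i d) - μ d • M.vec i d ∈ H.domain := fun d =>
      hSH.1 (M.dilation_vec (Or.inr (hk i)) 1)
    have hμne : μ b ≠ μ (!b) := by
      intro h
      have h5 := Complex.ofReal_injective h
      have h6 := Real.exp_injective (mul_left_cancel₀ (Real.exp_pos 1).ne' h5)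
      have h7 := hk i
      cases b <;> simp only [sgnExpo, cond_true, cond_false, Bool.not_true, Bool.not_false] at h6
      · apply h7; linarith
      · apply h7; linarith
    -- The operator `U₁ - μ(!b)` kills the other vector modulo the minimal domain and multiplies
    -- this one by `μ b - μ (!b) ≠ 0`.
    have h5 := (hhom 1).mem_domain h4
    have h6 : dilation 1 (∑ d, c i d • M.vec i d) - μ (!b) • ∑ d, c i d • M.vec i d =
        ∑ d, c i d • (dilation 1 (M.vec i d) - μ d • M.vec i d) +
          (c i b * (μ b - μ (!b))) • M.vec i b := by
      rw [Fintype.sum_bool, Fintype.sum_bool, dilation_add, dilation_smul, dilation_smul]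
      cases b <;> simp only [Bool.not_true, Bool.not_false] <;> module
    have h7 := H.domain.sub_mem h5 (H.domain.smul_mem (μ (!b)) h4)
    rw [h6] at h7
    have h8 : ∑ d, c i d • (dilation 1 (M.vec i d) - μ d • M.vec i d) ∈ H.domain :=
      Submodule.sum_mem _ fun d _ => H.domain.smul_mem _ (hv d)
    have h9 := H.domain.sub_mem h7 h8
    rw [add_sub_cancel_left] at h9
    exact (H.domain.smul_mem_iff (mul_ne_zero hcb (sub_ne_zero.2 hμne))).1 h9
  let σ : ι → Bool := fun i => decide (M.vec i true ∈ H.domain)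
  refine ⟨σ, eq_of_le_of_isSelfAdjoint hH (M.isSelfAdjoint_ext σ)
    (le_of_domain_le hle (M.ext_le σ) fun x hx => ?_)⟩
  obtain ⟨s, hsd, c, hc⟩ := M.exists_coeff hle hx
  have hσ : ∀ i, c i (!(σ i)) = 0 := by
    intro i
    by_contra hne
    have h1 := key x hx s hsd c hc i _ hne
    by_cases ht : M.vec i true ∈ H.domain
    · have : σ i = true := decide_eq_true ht
      rw [this] at h1
      exact M.not_mem_both hs hle i ht h1
    · have : σ i = false := decide_eq_false ht
      rw [this] at h1
      exact ht h1
  refine M.mem_ext_domain.2 ⟨s, hsd, fun i => c i (σ i), ?_⟩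
  rw [hc]
  congr 1
  refine Finset.sum_congr rfl fun i _ => ?_
  have := hσ i
  rw [Fintype.sum_bool]
  cases h : σ i <;> rw [h] at this <;> simp only [Bool.not_true, Bool.not_false] at this <;>
    simp [this, h]

/-- The homogeneous operators strictly between the minimal and the maximal one, when there is only
one mode and it is logarithmic. -/
theorem eq_ext_of_homogeneous [Unique ι] (hk : M.expo default = 0) {H : L2 →ₗ.[ℂ] L2}
    (hSH : abOperator lam ≤ H) (hle : H ≤ (abOperator lam).adjoint) (hne : ¬ H ≤ abOperator lam)
    (hne' : ¬ (abOperator lam).adjoint ≤ H) (hhom : IsHomogeneous (-2) H) :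
    H = M.ext fun _ => true := by
  have hS := abOperator_isClosedHermitian lam
  set l := M.mode default with hl
  have hl0 : (l : ℝ) + lam = 0 := abs_eq_zero.1 hk
  have hvt : M.vec default true = polarL2 (powProfile cut 0) l := by
    simp only [vec, hk, profile, cond_true, hl]
  have hvf : M.vec default false = polarL2 logProfile l := by
    simp only [vec, hk, profile, cond_false, if_true, hl]
  rw [isHomogeneous_iff] at hhom
  have hdec : ∀ x ∈ (abOperator lam).adjoint.domain, ∃ s ∈ (abOperator lam).domain, ∃ a b : ℂ,
      x = s + (a • M.vec default true + b • M.vec default false) := by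
    intro x hx
    obtain ⟨s, hs, c, hc⟩ := M.deficiency.2 x hx
    refine ⟨s, hs, c default true, c default false, ?_⟩
    rw [hc, Fintype.sum_unique, Fintype.sum_bool]
    rfl
  have hlog : ∀ x ∈ H.domain, ∀ s ∈ (abOperator lam).domain, ∀ a b : ℂ,
      x = s + (a • M.vec default true + b • M.vec default false) → b = 0 := by
    intro x hx s hs a b hab
    by_contra hb
    have hxs : a • M.vec default true + b • M.vec default false ∈ H.domain := by
      have := H.domain.sub_mem hx (hSH.1 hs)
      rwa [hab, add_sub_cancel_left] at this
    have h1 := (hhom 1).mem_domain hxs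
    have h2 := hSH.1 (M.dilation_vec (i := default) (b := true) (Or.inl rfl) 1)
    have h3 := hSH.1 (dilation_logProfile_sub_mem hl0 1)
    rw [← hvf, ← hvt] at h3
    have hμ : ((Real.exp 1 * Real.exp (M.sgnExpo default true * 1) : ℝ) : ℂ) =
        (Real.exp 1 : ℂ) := by
      simp [sgnExpo, hk]
    rw [hμ] at h2
    rw [dilation_add, dilation_smul, dilation_smul] at h1
    -- Applying `U₁ - e` to `x` cancels both diagonal terms and leaves, modulo the minimal domain,
    -- `b e` times the constant vector.
    have h4 : (b * ((Real.exp 1 * 1 : ℝ) : ℂ)) • M.vec default true ∈ H.domain := by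
      have h5 := H.domain.sub_mem (H.domain.sub_mem (H.domain.sub_mem h1
        (H.domain.smul_mem a h2)) (H.domain.smul_mem b h3))
        (H.domain.smul_mem (Real.exp 1 : ℂ) hxs)
      convert h5 using 1
      module
    have ht : M.vec default true ∈ H.domain := by
      refine (H.domain.smul_mem_iff (mul_ne_zero hb ?_)).1 h4
      rw [mul_one]
      exact_mod_cast (Real.exp_pos 1).ne'
    have hf : M.vec default false ∈ H.domain := by
      refine (H.domain.smul_mem_iff hb).1 ?_
      have := H.domain.sub_mem hxs (H.domain.smul_mem a ht)
      rwa [add_sub_cancel_left] at this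
    -- A logarithmic component would put both boundary vectors into `D(H)`, making `H` the maximal
    -- operator. Only graph inclusions and homogeneity are involved, not hermiticity.
    refine hne' (le_of_domain_le le_rfl hle fun y hy => ?_)
    obtain ⟨s', hs', a', b', rfl⟩ := hdec y hy
    exact H.domain.add_mem (hSH.1 hs')
      (H.domain.add_mem (H.domain.smul_mem _ ht) (H.domain.smul_mem _ hf))
  refine le_antisymm (le_of_domain_le hle (M.ext_le _) fun x hx => ?_)
    (le_of_domain_le (M.ext_le _) hle fun x hx => ?_)
  · obtain ⟨s, hs, a, b, hab⟩ := hdec x (hle.1 hx)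
    have hb := hlog x hx s hs a b hab
    refine M.mem_ext_domain.2 ⟨s, hs, fun _ => a, ?_⟩
    rw [hab, hb, zero_smul, add_zero, Fintype.sum_unique]
  · have ht : M.vec default true ∈ H.domain := by
      by_contra ht
      refine hne (le_of_domain_le hle hS.le_adjoint fun y hy => ?_)
      obtain ⟨s, hs, a, b, hab⟩ := hdec y (hle.1 hy)
      have hb := hlog y hy s hs a b hab
      rw [hb, zero_smul, add_zero] at hab
      have ha : a = 0 := by
        by_contra ha
        refine ht ((H.domain.smul_mem_iff ha).1 ?_)
        have := H.domain.sub_mem hy (hSH.1 hs)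
        rwa [hab, add_sub_cancel_left] at this
      rw [hab, ha, zero_smul, add_zero]
      exact hs
    obtain ⟨s, hs, c, rfl⟩ := M.mem_ext_domain.1 hx
    rw [Fintype.sum_unique]
    exact H.domain.add_mem (hSH.1 hs) (H.domain.smul_mem _ ht)

/-- A self-adjoint extension is strictly between the minimal and the maximal operator. -/
theorem not_le_of_isSelfAdjoint (M : CriticalModes lam ι) [Nonempty ι] {H : L2 →ₗ.[ℂ] L2} (hSH : abOperator lam ≤ H)
    (hH : IsSelfAdjoint H) : ¬ H ≤ abOperator lam ∧ ¬ (abOperator lam).adjoint ≤ H := by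
  have hS := abOperator_isClosedHermitian lam
  have hle := isSelfAdjoint_le_adjoint hS.dense hSH hH
  have i : ι := Classical.arbitrary ι
  have hm : ∀ b, M.vec i b ∈ (abOperator lam).adjoint.domain := fun b =>
    mem_domain_of_graph (M.pairs.mem_graph i b)
  constructor
  · intro h
    have e : H = abOperator lam := le_antisymm h hSH
    rw [e] at hH
    have h1 := hm true
    rw [LinearPMap.isSelfAdjoint_def.1 hH] at h1
    exact M.vec_notMem i true h1
  · intro h
    exact M.not_mem_both (isFormalAdjoint_of_isSelfAdjoint hH) hle i (h.1 (hm true)) (h.1 (hm false))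

end CriticalModes

/-! ### Identification of the Friedrichs and Krein extensions. -/

theorem tendsto_zero_of_norm_sq {V : Type*} [NormedAddCommGroup V] {u : ℕ → V}
    (h : Tendsto (fun n => ‖u n‖ ^ 2) atTop (𝓝 0)) : Tendsto u atTop (𝓝 0) := by
  rw [tendsto_zero_iff_norm_tendsto_zero]
  have := (Real.continuous_sqrt.tendsto 0).comp h
  simpa [Function.comp_def, Real.sqrt_sq] using this

theorem apply_eq_of_graph {E : Type*} [NormedAddCommGroup E] [InnerProductSpace ℂ E] [CompleteSpace E]
    {T : E →ₗ.[ℂ] E} {x : T.domain} {y : E} (h : ((x : E), y) ∈ T.graph) : T x = y :=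
  graph_unique (T.mem_graph x) h

/-- The form of a profile. -/
theorem re_inner_polarL2 {lam : ℝ} {l : ℤ} {a : ℝ → ℝ} (h : IsProfile lam l a) :
    (⟪polarL2 a l, polarL2 (radialOp lam l a) l⟫_ℂ).re =
      2 * Real.pi * ∫ s, Real.exp (2 * s) * (a s * radialOp lam l a s) := by
  rw [inner_polarL2 (h.memLp l) (h.memLp_radialOp l), Complex.ofReal_re]

theorem powProfile_sub_mem {lam k : ℝ} {l : ℤ} {χ χ' : ℝ → ℝ} (h : IsCutoff χ) (h' : IsCutoff χ')
    (hk : -1 < k) (hkl : k ^ 2 = (l + lam) ^ 2) :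
    polarL2 (powProfile χ k) l - polarL2 (powProfile χ' k) l ∈ (abOperator lam).domain := by
  obtain ⟨r, hr⟩ := h.one
  obtain ⟨r', hr'⟩ := h'.one
  have := polarL2_sub_mem (c := 1) (isProfile_powProfile h hk hkl) (isProfile_powProfile h' hk hkl)
    ⟨min r r', fun s hs => by
      rw [powProfile, powProfile, hr s (hs.trans_le (min_le_left _ _)),
        hr' s (hs.trans_le (min_le_right _ _)), one_mul, one_mul]⟩
  rwa [Complex.ofReal_one, one_smul] at this

namespace CriticalModes

variable {lam : ℝ} {ι : Type} (M : CriticalModes lam ι) [Fintype ι]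

/-- The approximants of the boundary vectors, and their images. -/
theorem friedrichs_approx {i : ι} {b : Bool} (hb : b = true ∨ M.expo i ≠ 0)
    (hk : 0 ≤ M.sgnExpo i b) : ∃ v v' : ℕ → L2,
      (∀ n, (v n, v' n) ∈ (abOperator lam).adjoint.graph) ∧ (∀ n, v n ∈ sector (M.mode i)) ∧
      (∀ n, M.vec i b - v n ∈ (abOperator lam).domain) ∧ Tendsto v atTop (𝓝 0) ∧
      Tendsto (fun n => (⟪v n, v' n⟫_ℂ).re) atTop (𝓝 0) := by
  obtain ⟨χ, hχ, h1, h2⟩ := exists_friedrichs_approx hk (M.sgnExpo_sq i b)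
  have hp : ∀ n, IsProfile lam (M.mode i) (powProfile (χ n) (M.sgnExpo i b)) := fun n =>
    isProfile_powProfile (hχ n) (M.lt_sgnExpo i b) (M.sgnExpo_sq i b)
  refine ⟨fun n => polarL2 (powProfile (χ n) (M.sgnExpo i b)) (M.mode i), fun n =>
    polarL2 (radialOp lam (M.mode i) (powProfile (χ n) (M.sgnExpo i b))) (M.mode i),
    fun n => (hp n).mem_adjoint, fun n => polarL2_mem_sector _ _, fun n => ?_, ?_, ?_⟩
  · rw [vec, M.profile_eq hb]
    exact powProfile_sub_mem isCutoff_cut (hχ n) (M.lt_sgnExpo i b) (M.sgnExpo_sq i b)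
  · refine tendsto_zero_of_norm_sq ?_
    simp only [fun n => norm_sq_polarL2 ((hp n).memLp (M.mode i))]
    simpa using h1.const_mul (2 * Real.pi)
  · simp only [fun n => re_inner_polarL2 (hp n)]
    simpa using h2.const_mul (2 * Real.pi)

theorem krein_approx {i : ι} {b : Bool} (hb : b = true ∨ M.expo i ≠ 0)
    (hk : M.sgnExpo i b ≤ 0) : ∃ v v' : ℕ → L2,
      (∀ n, (v n, v' n) ∈ (abOperator lam).adjoint.graph) ∧ (∀ n, v n ∈ sector (M.mode i)) ∧
      (∀ n, M.vec i b - v n ∈ (abOperator lam).domain) ∧ Tendsto v' atTop (𝓝 0) ∧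
      Tendsto (fun n => (⟪v n, v' n⟫_ℂ).re) atTop (𝓝 0) := by
  obtain ⟨χ, hχ, h1, h2⟩ := exists_krein_approx hk (M.sgnExpo_sq i b)
  have hp : ∀ n, IsProfile lam (M.mode i) (powProfile (χ n) (M.sgnExpo i b)) := fun n =>
    isProfile_powProfile (hχ n) (M.lt_sgnExpo i b) (M.sgnExpo_sq i b)
  refine ⟨fun n => polarL2 (powProfile (χ n) (M.sgnExpo i b)) (M.mode i), fun n =>
    polarL2 (radialOp lam (M.mode i) (powProfile (χ n) (M.sgnExpo i b))) (M.mode i),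
    fun n => (hp n).mem_adjoint, fun n => polarL2_mem_sector _ _, fun n => ?_, ?_, ?_⟩
  · rw [vec, M.profile_eq hb]
    exact powProfile_sub_mem isCutoff_cut (hχ n) (M.lt_sgnExpo i b) (M.sgnExpo_sq i b)
  · refine tendsto_zero_of_norm_sq ?_
    simp only [fun n => norm_sq_polarL2 ((hp n).memLp_radialOp (M.mode i))]
    simpa using h1.const_mul (2 * Real.pi)
  · simp only [fun n => re_inner_polarL2 (hp n)]
    simpa using h2.const_mul (2 * Real.pi)

/-- Modulo the minimal domain, an approximant is the selected boundary vector, so it stays in the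
extension. -/
theorem approx_mem_ext {σ : ι → Bool} {i : ι} {v v' : L2}
    (hg : (v, v') ∈ (abOperator lam).adjoint.graph)
    (h : M.vec i (σ i) - v ∈ (abOperator lam).domain) : (v, v') ∈ (M.ext σ).graph := by
  have h1 := (M.ext σ).domain.sub_mem (M.vec_mem_ext σ i) ((M.le_ext σ).1 h)
  rw [sub_sub_cancel] at h1
  obtain ⟨y, hy⟩ := exists_graph h1
  rwa [← graph_unique (graph_le (M.ext_le σ) hy) hg]

theorem exists_sub_mem {σ : ι → Bool} (x : (M.ext σ).domain) : ∃ c : ι → ℂ,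
    ((x - ∑ i, c i • (⟨M.vec i (σ i), M.vec_mem_ext σ i⟩ : (M.ext σ).domain) :
      (M.ext σ).domain) : L2) ∈ (abOperator lam).domain := by
  obtain ⟨s, hs, c, hc⟩ := M.mem_ext_domain.1 x.2
  refine ⟨c, ?_⟩
  rw [Submodule.coe_sub, Submodule.coe_sum, hc]
  simpa using hs

/-- Nonnegative exponents allow cutoffs shrinking to the origin. The Krein counterpart asks for
nonpositive exponents, and exponent `0` satisfies both. -/
theorem isFriedrichsExtension_ext {σ : ι → Bool} (hb : ∀ i, σ i = true ∨ M.expo i ≠ 0)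
    (hk : ∀ i, 0 ≤ M.sgnExpo i (σ i)) : IsFriedrichsExtension (abOperator lam) (M.ext σ) := by
  choose v v' hg _ hv h1 h2 using fun i => M.friedrichs_approx (hb i) (hk i)
  have hm := fun i n => M.approx_mem_ext (hg i n) (hv i n)
  refine isFriedrichsExtension_of_approx (M.le_ext σ) (M.isSelfAdjoint_ext σ)
    (fun i => ⟨M.vec i (σ i), M.vec_mem_ext σ i⟩)
    (fun i n => ⟨v i n, mem_domain_of_graph (hm i n)⟩) M.exists_sub_mem hv
    (abOperator_nonneg lam) h1 fun i => ?_
  refine (h2 i).congr fun n => ?_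
  rw [quadForm, apply_eq_of_graph (x := ⟨v i n, mem_domain_of_graph (hm i n)⟩) (hm i n)]

theorem isKreinExtension_ext {σ : ι → Bool} (hb : ∀ i, σ i = true ∨ M.expo i ≠ 0)
    (hk : ∀ i, M.sgnExpo i (σ i) ≤ 0) : IsKreinExtension (abOperator lam) (M.ext σ) := by
  choose v v' hg _ hv h1 h2 using fun i => M.krein_approx (hb i) (hk i)
  have hm := fun i n => M.approx_mem_ext (hg i n) (hv i n)
  refine isKreinExtension_of_approx (M.le_ext σ) (M.isSelfAdjoint_ext σ)
    (fun i => ⟨M.vec i (σ i), M.vec_mem_ext σ i⟩)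
    (fun i n => ⟨v i n, mem_domain_of_graph (hm i n)⟩) M.exists_sub_mem hv
    (abOperator_nonneg lam) (fun i => ?_) fun i => ?_
  · refine (h1 i).congr fun n => ?_
    rw [apply_eq_of_graph (x := ⟨v i n, mem_domain_of_graph (hm i n)⟩) (hm i n)]
  · refine (h2 i).congr fun n => ?_
    rw [quadForm, apply_eq_of_graph (x := ⟨v i n, mem_domain_of_graph (hm i n)⟩) (hm i n)]

/-! ### The parts in the critical sectors -/

/-- The boundary vector in its sector. -/
def sectorVec (i : ι) (b : Bool) : sector (M.mode i) := ⟨M.vec i b, M.vec_mem_sector i b⟩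

theorem sectorVec_mem (σ : ι → Bool) (i : ι) :
    M.sectorVec i (σ i) ∈ (sectorPart (M.ext σ) (M.mode i)).domain :=
  mem_sectorPart_domain (M.ext_rotate σ) (M.vec_mem_ext σ i)

/-- Projecting the global decomposition onto the sector removes the other modes, so the part has a
single boundary vector and `Unit` is the index type. -/
theorem exists_sub_mem_sector {σ : ι → Bool} {i : ι}
    (x : (sectorPart (M.ext σ) (M.mode i)).domain) : ∃ c : Unit → ℂ,
    ((x - ∑ j, c j • (⟨M.sectorVec i (σ i), M.sectorVec_mem σ i⟩ :
      (sectorPart (M.ext σ) (M.mode i)).domain) :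
      (sectorPart (M.ext σ) (M.mode i)).domain) : sector (M.mode i)) ∈
        (sectorPart (abOperator lam) (M.mode i)).domain := by
  classical
  have hS := abOperator_isClosedHermitian lam
  obtain ⟨s, hs, c, hc⟩ := M.mem_ext_domain.1 x.2.1
  refine ⟨fun _ => c i, mem_sectorPart_domain (abOperator_rotate lam) ?_⟩
  rw [Fintype.sum_unique]
  change ((x : sector (M.mode i)) : L2) - c i • M.vec i (σ i) ∈ (abOperator lam).domain
  obtain ⟨s', hs'⟩ := exists_graph hs
  have h1 := mem_domain_of_graph
    (sectorProj_mem_graph hS.closed (abOperator_rotate lam) (M.mode i) hs')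
  have h2 : ((x : sector (M.mode i)) : L2) - c i • M.vec i (σ i) = sectorProj (M.mode i) s := by
    have h3 := congrArg (sectorProj (M.mode i)) hc
    rw [sectorProj_of_mem (x : sector (M.mode i)).2, sectorProj_add] at h3
    rw [h3]
    have hz : ∀ t : Finset ι, i ∉ t →
        sectorProj (M.mode i) (∑ j ∈ t, c j • M.vec j (σ j)) = 0 := by
      intro t
      induction t using Finset.induction_on with
      | empty => intro _; simpa using sectorProj_of_mem (sector (M.mode i)).zero_mem
      | insert j t hj ih =>
        intro hi
        rw [Finset.mem_insert, not_or] at hi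
        rw [Finset.sum_insert hj, sectorProj_add, ih hi.2, add_zero]
        exact sectorProj_eq_zero (fun h => hi.1 (M.injective h))
          (Submodule.smul_mem _ _ (M.vec_mem_sector j _))
    rw [← Finset.add_sum_erase _ _ (Finset.mem_univ i), sectorProj_add,
      hz _ (Finset.notMem_erase i _), add_zero,
      sectorProj_of_mem (Submodule.smul_mem _ _ (M.vec_mem_sector i _)), add_sub_cancel_right]
  rw [h2]
  exact h1

theorem sectorPart_nonneg (l : ℤ) (x : (sectorPart (abOperator lam) l).domain) :
    0 ≤ quadForm (sectorPart (abOperator lam) l) x :=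
  abOperator_nonneg lam ⟨(x : sector l), x.2.1⟩

theorem isFriedrichsExtension_sectorPart {σ : ι → Bool} {i : ι}
    (hb : σ i = true ∨ M.expo i ≠ 0) (hk : 0 ≤ M.sgnExpo i (σ i)) :
    IsFriedrichsExtension (sectorPart (abOperator lam) (M.mode i))
      (sectorPart (M.ext σ) (M.mode i)) := by
  obtain ⟨v, v', hg, hsec, hv, h1, h2⟩ := M.friedrichs_approx hb hk
  have hm := fun n => M.approx_mem_ext (hg n) (hv n)
  have hd := fun n => mem_sectorPart_domain (M.ext_rotate σ) (x := ⟨v n, hsec n⟩)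
    (mem_domain_of_graph (hm n))
  refine isFriedrichsExtension_of_approx (ι := Unit) (sectorPart_le (M.le_ext σ) _)
    (isSelfAdjoint_sectorPart (M.isSelfAdjoint_ext σ) (M.ext_rotate σ) _)
    (fun _ => ⟨M.sectorVec i (σ i), M.sectorVec_mem σ i⟩) (fun _ n => ⟨⟨v n, hsec n⟩, hd n⟩)
    M.exists_sub_mem_sector
    (fun _ n => mem_sectorPart_domain (abOperator_rotate lam) (hv n))
    (sectorPart_nonneg _) (fun _ => ?_) fun _ => ?_
  · exact tendsto_subtype_rng.2 h1
  · refine h2.congr fun n => ?_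
    change _ = (⟪v n, (M.ext σ) ⟨v n, _⟩⟫_ℂ).re
    rw [apply_eq_of_graph (x := ⟨v n, mem_domain_of_graph (hm n)⟩) (hm n)]

theorem isKreinExtension_sectorPart {σ : ι → Bool} {i : ι}
    (hb : σ i = true ∨ M.expo i ≠ 0) (hk : M.sgnExpo i (σ i) ≤ 0) :
    IsKreinExtension (sectorPart (abOperator lam) (M.mode i))
      (sectorPart (M.ext σ) (M.mode i)) := by
  obtain ⟨v, v', hg, hsec, hv, h1, h2⟩ := M.krein_approx hb hk
  have hm := fun n => M.approx_mem_ext (hg n) (hv n)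
  have hd := fun n => mem_sectorPart_domain (M.ext_rotate σ) (x := ⟨v n, hsec n⟩)
    (mem_domain_of_graph (hm n))
  refine isKreinExtension_of_approx (ι := Unit) (sectorPart_le (M.le_ext σ) _)
    (isSelfAdjoint_sectorPart (M.isSelfAdjoint_ext σ) (M.ext_rotate σ) _)
    (fun _ => ⟨M.sectorVec i (σ i), M.sectorVec_mem σ i⟩) (fun _ n => ⟨⟨v n, hsec n⟩, hd n⟩)
    M.exists_sub_mem_sector
    (fun _ n => mem_sectorPart_domain (abOperator_rotate lam) (hv n))
    (sectorPart_nonneg _) (fun _ => ?_) fun _ => ?_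
  · refine tendsto_subtype_rng.2 (h1.congr fun n => ?_)
    change _ = (M.ext σ) ⟨v n, _⟩
    rw [apply_eq_of_graph (x := ⟨v n, mem_domain_of_graph (hm n)⟩) (hm n)]
  · refine h2.congr fun n => ?_
    change _ = (⟪v n, (M.ext σ) ⟨v n, _⟩⟫_ℂ).re
    rw [apply_eq_of_graph (x := ⟨v n, mem_domain_of_graph (hm n)⟩) (hm n)]

end CriticalModes

/-! ### The critical modes -/

theorem one_le_sq_of_abs {x : ℝ} (h : 1 ≤ |x|) : 1 ≤ x ^ 2 := by
  rw [← sq_abs]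
  nlinarith

/-- For an integral flux there is one critical mode. -/
def integralModes {lam : ℝ} (n : ℤ) (h : lam = n) : CriticalModes lam Unit where
  mode _ := -n
  injective := Function.injective_of_subsingleton _
  lt_one _ := by rw [h]; simp
  complete k hk := by
    have h1 : k + n ≠ 0 := fun h2 => hk ⟨(), by simp only; linarith⟩
    have h2 : (1 : ℤ) ≤ |k + n| := Int.one_le_abs h1
    have h3 : (1 : ℝ) ≤ |(k : ℝ) + lam| := by
      rw [h]; exact_mod_cast h2
    exact one_le_sq_of_abs h3

/-- For a non-integral flux there are two critical modes. -/
def fractionalModes {lam : ℝ} (h : ¬ ∃ n : ℤ, lam = n) : CriticalModes lam Bool where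
  -- With `true` standing for `-⌊λ⌋ - 1`, the index set coincides with the set of boundary choices.
  mode b := bif b then -⌊lam⌋ - 1 else -⌊lam⌋
  injective := by
    intro a b hab
    cases a <;> cases b <;> simp only [cond_true, cond_false] at hab ⊢ <;> omega
  lt_one b := by
    have h1 := Int.floor_le lam
    have h2 := Int.lt_floor_add_one lam
    have h3 : (⌊lam⌋ : ℝ) ≠ lam := fun h3 => h ⟨_, h3.symm⟩
    have h4 := lt_of_le_of_ne h1 h3
    cases b <;> simp only [cond_true, cond_false] <;> push_cast <;> rw [abs_lt] <;>
      constructor <;> linarith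
  complete k hk := by
    have h1 := Int.floor_le lam
    have h2 := Int.lt_floor_add_one lam
    have h3 : k ≠ -⌊lam⌋ - 1 := fun h3 => hk ⟨true, h3.symm⟩
    have h4 : k ≠ -⌊lam⌋ := fun h4 => hk ⟨false, h4.symm⟩
    refine one_le_sq_of_abs (le_abs.2 ?_)
    rcases lt_or_ge k (-⌊lam⌋ - 1) with h5 | h5
    · right
      have h6 : k + ⌊lam⌋ ≤ -2 := by omega
      have h7 : (k : ℝ) + ⌊lam⌋ ≤ -2 := by exact_mod_cast h6
      linarith
    · left
      have h6 : 1 ≤ k + ⌊lam⌋ := by omega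
      have h7 : (1 : ℝ) ≤ k + ⌊lam⌋ := by exact_mod_cast h6
      linarith

theorem fractionalModes_expo_ne {lam : ℝ} (h : ¬ ∃ n : ℤ, lam = n) (i : Bool) :
    (fractionalModes h).expo i ≠ 0 := by
  intro h0
  have h1 := abs_eq_zero.1 h0
  refine h ⟨-(fractionalModes h).mode i, ?_⟩
  push_cast
  linarith

end AharonovBohm

end

/-! ### Assembly of the integral and the nonintegral case. -/

theorem mainTheorem12 (lam : ℝ) :
    ((∃ n : ℤ, lam = n) →
      AharonovBohm.HasDeficiencyIndices (AharonovBohm.abOperator lam) 1 1 ∧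
      ∃ FF : AharonovBohm.L2 →ₗ.[ℂ] AharonovBohm.L2,
        AharonovBohm.IsFriedrichsExtension (AharonovBohm.abOperator lam) FF ∧
        AharonovBohm.IsKreinExtension (AharonovBohm.abOperator lam) FF ∧
        AharonovBohm.IsHomogeneous (-2) FF ∧
        (∀ H : AharonovBohm.L2 →ₗ.[ℂ] AharonovBohm.L2,
          AharonovBohm.IsSelfAdjointExtension (AharonovBohm.abOperator lam) H →
          AharonovBohm.IsHomogeneous (-2) H → H = FF) ∧
        (∀ H : AharonovBohm.L2 →ₗ.[ℂ] AharonovBohm.L2,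
          AharonovBohm.abOperator lam < H → H < (AharonovBohm.abOperator lam).adjoint →
          AharonovBohm.IsHomogeneous (-2) H → H = FF)) ∧
    ((¬ ∃ n : ℤ, lam = n) →
      AharonovBohm.HasDeficiencyIndices (AharonovBohm.abOperator lam) 2 2 ∧
      ∃ FF KK FK KF : AharonovBohm.L2 →ₗ.[ℂ] AharonovBohm.L2,
        AharonovBohm.IsFriedrichsExtension (AharonovBohm.abOperator lam) FF ∧
        AharonovBohm.IsKreinExtension (AharonovBohm.abOperator lam) KK ∧
        AharonovBohm.IsFriedrichsExtension
          (AharonovBohm.sectorPart (AharonovBohm.abOperator lam) (-⌊lam⌋ - 1))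
          (AharonovBohm.sectorPart FK (-⌊lam⌋ - 1)) ∧
        AharonovBohm.IsKreinExtension
          (AharonovBohm.sectorPart (AharonovBohm.abOperator lam) (-⌊lam⌋))
          (AharonovBohm.sectorPart FK (-⌊lam⌋)) ∧
        AharonovBohm.IsKreinExtension
          (AharonovBohm.sectorPart (AharonovBohm.abOperator lam) (-⌊lam⌋ - 1))
          (AharonovBohm.sectorPart KF (-⌊lam⌋ - 1)) ∧
        AharonovBohm.IsFriedrichsExtension
          (AharonovBohm.sectorPart (AharonovBohm.abOperator lam) (-⌊lam⌋))
          (AharonovBohm.sectorPart KF (-⌊lam⌋)) ∧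
        [FF, KK, FK, KF].Nodup ∧
        ∀ H : AharonovBohm.L2 →ₗ.[ℂ] AharonovBohm.L2,
          (AharonovBohm.IsSelfAdjointExtension (AharonovBohm.abOperator lam) H ∧
            AharonovBohm.IsHomogeneous (-2) H ∧ AharonovBohm.IsRotationSymmetric H) ↔
          (H = FF ∨ H = KK ∨ H = FK ∨ H = KF)) := by
  constructor
  · rintro ⟨n, hn⟩
    let M := AharonovBohm.integralModes n hn
    have hk : ∀ i, M.expo i = 0 := fun i => by
      have : ((M.mode i : ℤ) : ℝ) + lam = 0 := by
        change ((-n : ℤ) : ℝ) + lam = 0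
        rw [hn]; push_cast; ring
      rw [AharonovBohm.CriticalModes.expo, this, abs_zero]
    have hs : ∀ i, M.sgnExpo i true = 0 := fun i => hk i
    -- The only exponent is `0`, which is both nonnegative and nonpositive, so one extension is
    -- Friedrichs and Krein at once.
    refine ⟨M.deficiency.1, M.ext fun _ => true,
      M.isFriedrichsExtension_ext (fun _ => Or.inl rfl) fun i => (hs i).ge,
      M.isKreinExtension_ext (fun _ => Or.inl rfl) fun i => (hs i).le,
      M.ext_dilation fun _ => Or.inl rfl, fun H hH hhom => ?_, fun H h1 h2 hhom => ?_⟩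
    · obtain ⟨h1, h2⟩ := M.not_le_of_isSelfAdjoint hH.1 hH.2
      exact M.eq_ext_of_homogeneous (hk _) hH.1 (AharonovBohm.isSelfAdjoint_le_adjoint
        (AharonovBohm.abOperator_isClosedHermitian lam).dense hH.1 hH.2) h1 h2 hhom
    · exact M.eq_ext_of_homogeneous (hk _) h1.le h2.le h1.not_ge h2.not_ge hhom
  · intro h
    let M := AharonovBohm.fractionalModes h
    have hne : ∀ i, M.expo i ≠ 0 := AharonovBohm.fractionalModes_expo_ne h
    have hb : ∀ (σ : Bool → Bool) i, σ i = true ∨ M.expo i ≠ 0 := fun σ i => Or.inr (hne i)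
    have hF : ∀ i, 0 ≤ M.sgnExpo i true := fun i => abs_nonneg _
    have hK : ∀ i, M.sgnExpo i false ≤ 0 := fun i => neg_nonpos.2 (abs_nonneg _)
    -- The choice `true` is the regular, Friedrichs condition. Hence `id` is Friedrichs in the mode
    -- indexed by `true` and Krein in the one indexed by `false`, and `not` interchanges them.
    refine ⟨M.deficiency.1, M.ext fun _ => true, M.ext fun _ => false, M.ext id, M.ext not,
      M.isFriedrichsExtension_ext (hb _) hF, M.isKreinExtension_ext (hb _) hK,
      M.isFriedrichsExtension_sectorPart (i := true) (hb _ _) (hF true),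
      M.isKreinExtension_sectorPart (i := false) (hb _ _) (hK false),
      M.isKreinExtension_sectorPart (i := true) (hb _ _) (hK true),
      M.isFriedrichsExtension_sectorPart (i := false) (hb _ _) (hF false), ?_, fun H => ?_⟩
    · have h0 : [fun _ => true, fun _ => false, id, not].Nodup := by decide
      -- Distinctness reduces to that of the four functions from `Bool` to `Bool`, since `M.ext` is
      -- injective.
      exact h0.map M.ext_injective
    · constructor
      · rintro ⟨hH, hhom, hrot⟩
        obtain ⟨σ, rfl⟩ := M.exists_eq_ext hne hH.1 hH.2 hhom hrot
        have hall : ∀ σ : Bool → Bool, σ = (fun _ => true) ∨ σ = (fun _ => false) ∨ σ = id ∨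
            σ = not := by decide
        have hσ := hall σ
        rcases hσ with rfl | rfl | rfl | rfl
        · exact Or.inl rfl
        · exact Or.inr (Or.inl rfl)
        · exact Or.inr (Or.inr (Or.inl rfl))
        · exact Or.inr (Or.inr (Or.inr rfl))
      · have key : ∀ σ, AharonovBohm.IsSelfAdjointExtension (AharonovBohm.abOperator lam) (M.ext σ) ∧
            AharonovBohm.IsHomogeneous (-2) (M.ext σ) ∧
            AharonovBohm.IsRotationSymmetric (M.ext σ) := fun σ =>
          ⟨⟨M.le_ext σ, M.isSelfAdjoint_ext σ⟩, M.ext_dilation (hb σ),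
            AharonovBohm.isRotationSymmetric_iff.2 (M.ext_rotate σ)⟩
        rintro (rfl | rfl | rfl | rfl) <;> exact key _
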